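/- **Setting.** A tile is a pair $\tau=(\mathrm{spt}(\tau),m)$ with $\mathrm{spt}(\tau)\subset\mathbb{R}^2$ a convex polygon with nonempty interior and $m$ a mark; $\tau+v:=(\mathrm{spt}(\tau)+v,m)$. A patch is a set of tiles with pairwise disjoint interiors, and a tiling is a patch whose tiles cover $\mathbb{R}^2$. Let $\rho_1,\dots,\rho_k$ ($k\ge1$) be pairwise translationally inequivalent tiles (prototiles) and let $\lambda>1$. A self-similar substitution $\Phi$ with expansion $\lambda$ assigns to each $\rho_i$ a patch $\Phi(\rho_i)$ that consists of translates of prototiles and has support $\lambda\,\mathrm{spt}(\rho_i)$. It extends to sets of translates of prototiles by $\Phi(\{\rho_{i(j)}+v_j\}_j)=\bigcup_j(\Phi(\rho_{i(j)})+\lambda v_j)$. The tiling space $\Omega_\Phi$ is the set of all tilings $T$ of $\mathbb{R}^2$ such that every finite patch in $T$ is contained in a translate of some $\Phi^m(\rho_i)$, $m\ge1$. Assume that $\Phi$ is primitive (for all $i,j$, a translate of $\rho_i$ occurs in $\Phi^n(\rho_j)$ for some $n$). Assume that $\Omega_\Phi$ has finite local complexity (FLC): for each $R$, up to translation only finitely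 many patches of diameter at most $R$ occur in tilings of $\Omega_\Phi$. Assume finally that $\Omega_\Phi$ is non-periodic: $T-v=T$ with $T\in\Omega_\Phi$ implies $v=0$. For $R>0$ let $B_R[T]$ be the set of tiles of $T$ whose support meets the open ball of radius $R$ about $0$. Let $d(T,T')$ be the infimum of $1/\sqrt2$ and of all $\varepsilon>0$ for which there are $v,v'$ with $|v|,|v'|<\varepsilon/2$ and $B_{1/\varepsilon}[T-v]=B_{1/\varepsilon}[T'-v']$. Write $T\sim_sT'$ if $T,T'\in\Omega_\Phi$ and $d(\Phi^n(T),\Phi^n(T'))\to0$ as $n\to\infty$. A pair $(T,T')\in\Omega_\Phi\times\Omega_\Phi$ is a *branch pair* if $T\not\sim_sT'$ and there is an open half-plane $H$ bounded by a line through $0$ such that $T-x\sim_sT'-x$ for all $x\in H$. Its *asymptotic sector* $S(T,T')$ is the connected component of $\{v\in\mathbb{S}^1: T-tv\sim_sT'-tv\ \text{for all } t>0\}$ that contains $H\cap\mathbb{S}^1$, for such an $H$. (If different choices of $H$ give different sectors, the statements below hold for every choice of sector.) Its boundary $\partial S(T,T')$ is taken in $\mathbb{S}^1$. A branch pair is *isolated*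 if $S(T,T')=\mathbb{S}^1$; it is a *corner pair* if $S(T,T')\ne\mathbb{S}^1$ contains a closed semicircle in its interior; it is a *line pair* if $S(T,T')$ is an open semicircle. **Theorem.** Suppose that $\Omega_\Phi$ has no isolated branch pairs. Then there are branch pairs $(T_1,T_1')$ and $(T_2,T_2')$ in $\Omega_\Phi\times\Omega_\Phi$ with $\partial S(T_1,T_1')\ne\partial S(T_2,T_2')$. If, moreover, $\Omega_\Phi$ has no corner pairs, then every line pair $(T,T')$ is non-collapsing: $T-tv\not\sim_sT'-tv$ for all $t\in\mathbb{R}$ and all $v\in\partial S(T,T')$. -/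

import Mathlib

open Filter Topology
open scoped Pointwise RealInnerProductSpace

noncomputable section

namespace SubstTiling

/-- The Euclidean plane. -/
abbrev Plane : Type := EuclideanSpace ℝ (Fin 2)

/-- The unit circle, as the space of directions (with the subspace topology). -/
abbrev Circ : Type := Metric.sphere (0 : Plane) 1

/-- A (marked) tile: a support together with a mark. Prototiles, hence all tiles that occur in the
tiling spaces below, have convex polygonal support; see `Substitution`. -/
@[ext]
structure Tile (M : Type*) where
  support : Set Plane
  mark : M

/-- Translation of tiles: `v +ᵥ (spt, m) = (v + spt, m)`. On sets of tiles, the pointwise action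
gives the translate `v +ᵥ P`; in particular `T - v` is `(-v) +ᵥ T`. -/
instance (M : Type*) : AddAction Plane (Tile M) where
  vadd v τ := ⟨v +ᵥ τ.support, τ.mark⟩
  zero_vadd τ := Tile.ext (zero_vadd Plane τ.support) rfl
  add_vadd v w τ := Tile.ext (add_vadd v w τ.support) rfl

/-- A convex polygon: the convex hull of finitely many points, with nonempty interior. -/
def IsConvexPolygon (S : Set Plane) : Prop :=
  ∃ F : Set Plane, F.Finite ∧ S = convexHull ℝ F ∧ (interior S).Nonempty

/-- A patch is a collection of tiles with pairwise disjoint interiors. -/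
def IsPatch {M : Type*} (P : Set (Tile M)) : Prop :=
  P.Pairwise fun σ τ => Disjoint (interior σ.support) (interior τ.support)

/-- The support of a collection of tiles. -/
def patchSupport {M : Type*} (P : Set (Tile M)) : Set Plane :=
  ⋃ τ ∈ P, τ.support

/-- A tiling of the plane is a patch whose support is the whole plane. -/
def IsTiling {M : Type*} (T : Set (Tile M)) : Prop :=
  IsPatch T ∧ patchSupport T = Set.univ

/-- `T - v`. -/
def shift {M : Type*} (T : Set (Tile M)) (v : Plane) : Set (Tile M) :=
  (-v) +ᵥ T

/-- `B_R[T]`, the set of tiles of `T` that meet the open ball of radius `R` about the origin. -/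
def ballPatch {M : Type*} (R : ℝ) (T : Set (Tile M)) : Set (Tile M) :=
  {τ ∈ T | (Metric.ball (0 : Plane) R ∩ τ.support).Nonempty}

/-- The tiling metric: two tilings are within `ε` if, after translations of length less than
`ε / 2`, they agree on the ball of radius `1 / ε` about the origin. (The cap `1 / √2` is the
usual one, needed for the triangle inequality.) -/
def tilingDist {M : Type*} (T T' : Set (Tile M)) : ℝ :=
  sInf ({ε : ℝ | 0 < ε ∧ ∃ v v' : Plane, ‖v‖ < ε / 2 ∧ ‖v'‖ < ε / 2 ∧
      ballPatch (1 / ε) (shift T v) = ballPatch (1 / ε) (shift T' v')} ∪ {1 / √2})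

/-- A set of tilings has translationally finite local complexity if for every `R` the patches of
diameter at most `R` that occur in its members are, up to translation, finite in number. -/
def FLC {M : Type*} (X : Set (Set (Tile M))) : Prop :=
  ∀ R : ℝ, ∃ 𝓕 : Set (Set (Tile M)), 𝓕.Finite ∧
    ∀ T ∈ X, ∀ P ⊆ T, (∀ x ∈ patchSupport P, ∀ y ∈ patchSupport P, dist x y ≤ R) →
      ∃ Q ∈ 𝓕, ∃ v : Plane, P = v +ᵥ Q

/-- A set of tilings is non-periodic if translation acts freely on it. -/
def NonPeriodic {M : Type*} (X : Set (Set (Tile M))) : Prop :=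
  ∀ T ∈ X, ∀ v : Plane, shift T v = T → v = 0

/-- A self-similar substitution in the plane, on prototiles indexed by `ι` with convex polygonal
supports, whose expansion is multiplication by `scale > 1`. -/
structure Substitution (ι M : Type*) where
  /-- the prototiles `ρ i` -/
  proto : ι → Tile M
  /-- the expansion factor -/
  scale : ℝ
  /-- the patch substituted for the prototile `ρ i` -/
  subst : ι → Set (Tile M)
  polygonal : ∀ i, IsConvexPolygon (proto i).support
  inequivalent : ∀ i j, ∀ v : Plane, v +ᵥ proto i = proto j → i = j
  one_lt_scale : 1 < scale
  subst_isPatch : ∀ i, IsPatch (subst i)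
  subst_translate : ∀ i, ∀ τ ∈ subst i, ∃ (j : ι) (v : Plane), τ = v +ᵥ proto j
  subst_support : ∀ i, patchSupport (subst i) = scale • (proto i).support

namespace Substitution

/-- The extension of the substitution to collections of translates of prototiles:
`Φ {ρ_{i(j)} + v_j} = ⋃ j, (Φ ρ_{i(j)} + λ v_j)`. -/
def apply {ι M : Type*} (Φ : Substitution ι M) (P : Set (Tile M)) : Set (Tile M) :=
  {τ | ∃ (i : ι) (v : Plane), v +ᵥ Φ.proto i ∈ P ∧ τ ∈ (Φ.scale • v) +ᵥ Φ.subst i}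

/-- `P` is allowed for `Φ` if `P ⊆ Φ^m(ρ i) - v` for some `m ≥ 1`, `i` and `v`. -/
def Allowed {ι M : Type*} (Φ : Substitution ι M) (P : Set (Tile M)) : Prop :=
  ∃ (m : ℕ) (i : ι) (v : Plane), 1 ≤ m ∧ P ⊆ shift (Φ.apply^[m] {Φ.proto i}) v

/-- The substitution tiling space `Ω_Φ`. -/
def tilingSpace {ι M : Type*} (Φ : Substitution ι M) : Set (Set (Tile M)) :=
  {T | IsTiling T ∧ ∀ P ⊆ T, P.Finite → Φ.Allowed P}

/-- `Φ` is primitive: for all `i`, `j`, a translate of `ρ i` occurs in some `Φ^n(ρ j)`. -/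
def Primitive {ι M : Type*} (Φ : Substitution ι M) : Prop :=
  ∀ i j, ∃ (n : ℕ) (v : Plane), v +ᵥ Φ.proto i ∈ Φ.apply^[n] {Φ.proto j}

/-- The stable manifold `W^s(T)` in `Ω_Φ`. -/
def stableManifold {ι M : Type*} (Φ : Substitution ι M) (T : Set (Tile M)) :
    Set (Set (Tile M)) :=
  {T' ∈ Φ.tilingSpace |
    Tendsto (fun n : ℕ => tilingDist (Φ.apply^[n] T') (Φ.apply^[n] T)) atTop (𝓝 0)}

/-- Stable equivalence `T ∼ₛ T'`. -/
def StablyEquiv {ι M : Type*} (Φ : Substitution ι M) (T T' : Set (Tile M)) : Prop :=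
  T ∈ Φ.stableManifold T'

/-- `(T, T')` is a branch pair: `T ≁ₛ T'`, and `T - x ∼ₛ T' - x` for all `x` in some open
half-plane bounded by a line through the origin. -/
def IsBranchPair {ι M : Type*} (Φ : Substitution ι M) (T T' : Set (Tile M)) : Prop :=
  T ∈ Φ.tilingSpace ∧ T' ∈ Φ.tilingSpace ∧ ¬ Φ.StablyEquiv T T' ∧
    ∃ u : Circ, ∀ x : Plane, 0 < ⟪x, (u : Plane)⟫ → Φ.StablyEquiv (shift T x) (shift T' x)

/-- The directions `v` with `T - t v ∼ₛ T' - t v` for all `t > 0`. -/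
def asymptoticDirections {ι M : Type*} (Φ : Substitution ι M) (T T' : Set (Tile M)) :
    Set Circ :=
  {v | ∀ t : ℝ, 0 < t → Φ.StablyEquiv (shift T (t • (v : Plane))) (shift T' (t • (v : Plane)))}

end Substitution

/-- The open semicircle centred at `u`. -/
def openSemicircle (u : Circ) : Set Circ := {v | 0 < ⟪(v : Plane), (u : Plane)⟫}

/-- The closed semicircle centred at `u`. -/
def closedSemicircle (u : Circ) : Set Circ := {v | 0 ≤ ⟪(v : Plane), (u : Plane)⟫}

namespace Substitution

/-- `S` is an asymptotic sector `S(T, T')` of the branch pair `(T, T')`: the connected component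
of the set of asymptotic directions that contains an open semicircle `H ∩ 𝕊¹` contained in it.
(A branch pair may have two asymptotic sectors, a pair of opposite open semicircles.) -/
def IsSector {ι M : Type*} (Φ : Substitution ι M) (T T' : Set (Tile M)) (S : Set Circ) : Prop :=
  Φ.IsBranchPair T T' ∧ ∃ u : Circ, openSemicircle u ⊆ Φ.asymptoticDirections T T' ∧
    S = connectedComponentIn (Φ.asymptoticDirections T T') u

/-- Isolated pair: the asymptotic sector is the whole circle. -/
def IsIsolatedPair {ι M : Type*} (Φ : Substitution ι M) (T T' : Set (Tile M)) : Prop :=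
  Φ.IsSector T T' Set.univ

/-- Corner pair: the asymptotic sector is a proper subset of the circle that contains a closed
semicircle in its interior. -/
def IsCornerPair {ι M : Type*} (Φ : Substitution ι M) (T T' : Set (Tile M)) : Prop :=
  ∃ S, Φ.IsSector T T' S ∧ S ≠ Set.univ ∧ ∃ u, closedSemicircle u ⊆ interior S

/-- Line pair: the asymptotic sector is an open semicircle. -/
def IsLinePair {ι M : Type*} (Φ : Substitution ι M) (T T' : Set (Tile M)) : Prop :=
  ∃ u, Φ.IsSector T T' (openSemicircle u)

end Substitution

end SubstTiling

end

/-! ### Translation of tiles, patches and tilings -/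

namespace SubstTiling

variable {ι M : Type*}

/-! Stable equivalence of T - x and T' - x means that, for some k, Φ^k T and Φ^k T' have the same
tiles at λ^k x (`stablyEquiv_shift_iff`). A pair is therefore studied through its set of asymptotic
points (`Asy`), which is open by finite local complexity. Repetitivity and non-periodicity make the
waiting time uniform: a ball of radius r of asymptotic points forces agreement at its centre after a
number of substitutions depending only on r (`exists_uniform_step`). Hence pairs with a common ball
of asymptotic points have limits in which both asymptotic and non-asymptotic points are controlled
(`exists_limit_asy`). Blowing up at a non-asymptotic point that lies on the boundary of a ball of
asymptotic points gives a branch pair (`exists_branchAt_of_tangent`).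

For the first claim, suppose that all sectors have the same boundary F. If f ∈ F, no normal of a
branch pair has positive inner product with f, so a moving-disc argument propagates asymptoticity in
the direction -f (`asy_add_smul`). Taking f in the boundary of one sector and translating that pair
to infinity along f produces a branch pair whose whole boundary line, parallel to f, is
non-asymptotic; hence -f ∈ F too, and every asymptotic set is a union of lines parallel to f. This
is impossible (`not_invariant_direction`): a tiling would then be asymptotic to its translate by a
multiple of f on each strip parallel to f. The finitely many multiples that occur are commensurable,
and a common one would be a period.

For the second claim, suppose that a branch pair has an asymptotic point on its boundary line.
Starting from a last non-asymptotic point before it, a power of the substitution reproduces the pair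
exactly near that point (`exists_selfSimilar`), so the asymptotic segment thickens to a cone. The
blow-up then has two distinct, non-opposite half-planes (`exists_two_halfPlanes`) and, in the
absence of isolated pairs, is a corner pair. -/

theorem vadd_support (v : Plane) (τ : Tile M) : (v +ᵥ τ).support = v +ᵥ τ.support := rfl

theorem mem_vadd_support {v x : Plane} {τ : Tile M} :
    x ∈ (v +ᵥ τ).support ↔ x - v ∈ τ.support := by
  rw [vadd_support, Set.mem_vadd_set_iff_neg_vadd_mem, vadd_eq_add, neg_add_eq_sub]

theorem mem_interior_vadd_support {v x : Plane} {τ : Tile M} :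
    x ∈ interior (v +ᵥ τ).support ↔ x - v ∈ interior τ.support := by
  rw [vadd_support, interior_vadd, Set.mem_vadd_set_iff_neg_vadd_mem, vadd_eq_add, neg_add_eq_sub]

theorem mem_vadd_tiles {v : Plane} {T : Set (Tile M)} {τ : Tile M} :
    τ ∈ v +ᵥ T ↔ -v +ᵥ τ ∈ T := Set.mem_vadd_set_iff_neg_vadd_mem

theorem mem_shift {v : Plane} {T : Set (Tile M)} {τ : Tile M} :
    τ ∈ shift T v ↔ v +ᵥ τ ∈ T := by
  rw [shift, mem_vadd_tiles, neg_neg]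

theorem shift_shift (T : Set (Tile M)) (v w : Plane) : shift (shift T v) w = shift T (v + w) := by
  ext τ
  simp only [mem_shift, vadd_vadd]

theorem shift_zero (T : Set (Tile M)) : shift T 0 = T := by
  ext τ
  simp [mem_shift]

theorem shift_mono {T T' : Set (Tile M)} (h : T ⊆ T') (v : Plane) : shift T v ⊆ shift T' v :=
  fun _ hτ => mem_shift.2 (h (mem_shift.1 hτ))

theorem shift_injective (v : Plane) : Function.Injective fun T : Set (Tile M) => shift T v := by
  intro T T' h
  have := congrArg (fun T => shift T (-v)) h
  simpa [shift_shift, shift_zero] using this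

/-- The tiles of `T` that contain the point `x`. -/
def tilesAt (T : Set (Tile M)) (x : Plane) : Set (Tile M) := {τ ∈ T | x ∈ τ.support}

theorem mem_tilesAt {T : Set (Tile M)} {x : Plane} {τ : Tile M} :
    τ ∈ tilesAt T x ↔ τ ∈ T ∧ x ∈ τ.support := Iff.rfl

theorem tilesAt_shift (T : Set (Tile M)) (v x : Plane) :
    tilesAt (shift T v) x = shift (tilesAt T (x + v)) v := by
  ext τ
  simp only [mem_tilesAt, mem_shift, mem_vadd_support, add_sub_cancel_right]

theorem tilesAt_shift_eq_iff {T T' : Set (Tile M)} {v x : Plane} :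
    tilesAt (shift T v) x = tilesAt (shift T' v) x ↔ tilesAt T (x + v) = tilesAt T' (x + v) := by
  rw [tilesAt_shift, tilesAt_shift]
  exact (shift_injective v).eq_iff

theorem vadd_isPatch {P : Set (Tile M)} (h : IsPatch P) (v : Plane) : IsPatch (v +ᵥ P) := by
  intro σ hσ τ hτ hne
  rw [mem_vadd_tiles] at hσ hτ
  have : Disjoint (interior (-v +ᵥ σ).support) (interior (-v +ᵥ τ).support) :=
    h hσ hτ (fun h => hne (by simpa using congrArg (v +ᵥ ·) h))
  rw [Set.disjoint_left] at this ⊢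
  intro x hx hx'
  refine this (a := x - v) ?_ ?_
  · rw [mem_interior_vadd_support]; simpa using hx
  · rw [mem_interior_vadd_support]; simpa using hx'

theorem mem_patchSupport {P : Set (Tile M)} {x : Plane} :
    x ∈ patchSupport P ↔ ∃ τ ∈ P, x ∈ τ.support := by
  simp [patchSupport]

theorem shift_isTiling {T : Set (Tile M)} (h : IsTiling T) (v : Plane) : IsTiling (shift T v) := by
  refine ⟨vadd_isPatch h.1 _, ?_⟩
  rw [Set.eq_univ_iff_forall]
  intro x
  have : x + v ∈ patchSupport T := by rw [h.2]; trivial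
  obtain ⟨τ, hτ, hx⟩ := mem_patchSupport.1 this
  refine mem_patchSupport.2 ⟨-v +ᵥ τ, ?_, ?_⟩
  · rw [mem_shift]; simpa using hτ
  · rw [mem_vadd_support]; simpa using hx

theorem IsTiling.tilesAt_nonempty {T : Set (Tile M)} (h : IsTiling T) (x : Plane) :
    (tilesAt T x).Nonempty := by
  have : x ∈ patchSupport T := by rw [h.2]; trivial
  obtain ⟨τ, hτ, hx⟩ := mem_patchSupport.1 this
  exact ⟨τ, hτ, hx⟩

/-! ### The substitution on patches and on the tiling space -/

namespace Substitution

variable (Φ : Substitution ι M)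

theorem scale_pos : 0 < Φ.scale := zero_lt_one.trans Φ.one_lt_scale

theorem scale_ne : Φ.scale ≠ 0 := Φ.scale_pos.ne'

/-- A collection of translates of prototiles. -/
def Tiles (P : Set (Tile M)) : Prop := ∀ τ ∈ P, ∃ (i : ι) (v : Plane), τ = v +ᵥ Φ.proto i

variable {Φ}

theorem mem_apply {P : Set (Tile M)} {τ : Tile M} :
    τ ∈ Φ.apply P ↔ ∃ (i : ι) (v : Plane), v +ᵥ Φ.proto i ∈ P ∧
      -(Φ.scale • v) +ᵥ τ ∈ Φ.subst i := by
  simp only [apply, Set.mem_ofPred_eq, mem_vadd_tiles]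

theorem apply_shift (P : Set (Tile M)) (v : Plane) :
    Φ.apply (shift P v) = shift (Φ.apply P) (Φ.scale • v) := by
  ext τ
  rw [mem_shift, mem_apply, mem_apply]
  constructor
  · rintro ⟨i, w, h, h'⟩
    refine ⟨i, v + w, ?_, ?_⟩
    · rwa [mem_shift, vadd_vadd] at h
    · rw [vadd_vadd]; convert h' using 2; rw [smul_add]; abel
  · rintro ⟨i, w, h, h'⟩
    refine ⟨i, w - v, ?_, ?_⟩
    · rw [mem_shift, vadd_vadd]; simpa using h
    · rw [vadd_vadd] at h'; convert h' using 2; rw [smul_sub]; abel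

theorem apply_iterate_shift (n : ℕ) (P : Set (Tile M)) (v : Plane) :
    Φ.apply^[n] (shift P v) = shift (Φ.apply^[n] P) (Φ.scale ^ n • v) := by
  induction n with
  | zero => simp
  | succ n ih =>
    rw [Function.iterate_succ_apply', ih, apply_shift, Function.iterate_succ_apply', smul_smul,
      pow_succ']

theorem apply_mono {P Q : Set (Tile M)} (h : P ⊆ Q) : Φ.apply P ⊆ Φ.apply Q := by
  intro τ hτ
  rw [mem_apply] at hτ ⊢
  obtain ⟨i, v, h1, h2⟩ := hτ
  exact ⟨i, v, h h1, h2⟩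

theorem apply_iterate_mono (n : ℕ) {P Q : Set (Tile M)} (h : P ⊆ Q) :
    Φ.apply^[n] P ⊆ Φ.apply^[n] Q := by
  induction n with
  | zero => simpa
  | succ n ih =>
    rw [Function.iterate_succ_apply', Function.iterate_succ_apply']
    exact apply_mono ih

theorem apply_tiles (P : Set (Tile M)) : Φ.Tiles (Φ.apply P) := by
  intro τ hτ
  obtain ⟨i, v, -, h⟩ := mem_apply.1 hτ
  obtain ⟨j, w, hw⟩ := Φ.subst_translate i _ h
  refine ⟨j, Φ.scale • v + w, ?_⟩
  rw [add_vadd, ← hw]; simp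

/-- A tile of the substituted patch lies in the inflated support of the tile it comes from. -/
theorem support_of_mem_subst {i : ι} {v : Plane} {τ : Tile M}
    (h : -(Φ.scale • v) +ᵥ τ ∈ Φ.subst i) {x : Plane} (hx : Φ.scale • x ∈ τ.support) :
    x ∈ (v +ᵥ Φ.proto i).support := by
  have h1 : Φ.scale • (x - v) ∈ patchSupport (Φ.subst i) := by
    refine mem_patchSupport.2 ⟨_, h, ?_⟩
    rw [mem_vadd_support, smul_sub]; simpa using hx
  rw [Φ.subst_support, Set.smul_mem_smul_set_iff₀ Φ.scale_ne] at h1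
  rwa [mem_vadd_support]

/-- A substituted tile lies in the inflated support of its parent, so only the tiles at `x` matter.
This locality is what makes pointwise agreement persist under substitution. -/
theorem tilesAt_apply (P : Set (Tile M)) (x : Plane) :
    tilesAt (Φ.apply P) (Φ.scale • x) = tilesAt (Φ.apply (tilesAt P x)) (Φ.scale • x) := by
  apply Set.Subset.antisymm
  · rintro τ ⟨hτ, hx⟩
    refine ⟨?_, hx⟩
    obtain ⟨i, v, h, h'⟩ := mem_apply.1 hτ
    exact mem_apply.2 ⟨i, v, ⟨h, support_of_mem_subst h' hx⟩, h'⟩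
  · rintro τ ⟨hτ, hx⟩
    exact ⟨apply_mono (fun _ h => h.1) hτ, hx⟩

theorem tilesAt_apply_congr {P Q : Set (Tile M)} {x : Plane} (h : tilesAt P x = tilesAt Q x) :
    tilesAt (Φ.apply P) (Φ.scale • x) = tilesAt (Φ.apply Q) (Φ.scale • x) := by
  rw [tilesAt_apply, h, ← tilesAt_apply]

theorem tilesAt_iterate_congr (n : ℕ) {P Q : Set (Tile M)} {x : Plane}
    (h : tilesAt P x = tilesAt Q x) :
    tilesAt (Φ.apply^[n] P) (Φ.scale ^ n • x) = tilesAt (Φ.apply^[n] Q) (Φ.scale ^ n • x) := by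
  induction n with
  | zero => simpa
  | succ n ih =>
    rw [Function.iterate_succ_apply', Function.iterate_succ_apply', pow_succ', mul_smul]
    exact tilesAt_apply_congr ih

theorem proto_isCompact (i : ι) : IsCompact (Φ.proto i).support := by
  obtain ⟨F, hF, h, -⟩ := Φ.polygonal i
  rw [h]
  exact hF.isCompact_convexHull ℝ

theorem proto_convex (i : ι) : Convex ℝ (Φ.proto i).support := by
  obtain ⟨F, hF, h, -⟩ := Φ.polygonal i
  rw [h]
  exact convex_convexHull ℝ F

theorem proto_interior_nonempty (i : ι) : (interior (Φ.proto i).support).Nonempty := by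
  obtain ⟨F, hF, h, h'⟩ := Φ.polygonal i
  exact h'

theorem proto_nonempty (i : ι) : (Φ.proto i).support.Nonempty :=
  (proto_interior_nonempty i).mono interior_subset

theorem Tiles.isCompact {P : Set (Tile M)} (h : Φ.Tiles P) {τ : Tile M} (hτ : τ ∈ P) :
    IsCompact τ.support := by
  obtain ⟨i, v, rfl⟩ := h τ hτ
  exact (proto_isCompact i).vadd v

theorem Tiles.isClosed {P : Set (Tile M)} (h : Φ.Tiles P) {τ : Tile M} (hτ : τ ∈ P) :
    IsClosed τ.support := (h.isCompact hτ).isClosed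

theorem Tiles.interior_nonempty {P : Set (Tile M)} (h : Φ.Tiles P) {τ : Tile M} (hτ : τ ∈ P) :
    (interior τ.support).Nonempty := by
  obtain ⟨i, v, rfl⟩ := h τ hτ
  obtain ⟨x, hx⟩ := proto_interior_nonempty (Φ := Φ) i
  exact ⟨x + v, by rw [mem_interior_vadd_support]; simpa⟩

theorem Tiles.closure_interior {P : Set (Tile M)} (h : Φ.Tiles P) {τ : Tile M} (hτ : τ ∈ P) :
    τ.support ⊆ closure (interior τ.support) := by
  obtain ⟨i, v, rfl⟩ := h τ hτ
  have h1 : Convex ℝ (v +ᵥ Φ.proto i).support := (proto_convex i).vadd v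
  rw [h1.closure_interior_eq_closure_of_nonempty_interior]
  · exact subset_closure
  · exact h.interior_nonempty hτ

theorem Tiles.shift {P : Set (Tile M)} (h : Φ.Tiles P) (v : Plane) : Φ.Tiles (shift P v) := by
  intro τ hτ
  obtain ⟨i, w, hw⟩ := h _ (mem_shift.1 hτ)
  refine ⟨i, -v + w, ?_⟩
  rw [add_vadd, ← hw]; simp

/-- In a patch, a tile that meets the interior of another one is equal to it. -/
theorem eq_of_mem_interior {P : Set (Tile M)} (hP : IsPatch P) (h : Φ.Tiles P) {σ τ : Tile M}
    (hσ : σ ∈ P) (hτ : τ ∈ P) {x : Plane} (hx : x ∈ interior σ.support) (hx' : x ∈ τ.support) :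
    σ = τ := by
  by_contra hne
  have h1 := mem_closure_iff.1 (h.closure_interior hτ hx') _ isOpen_interior hx
  obtain ⟨y, hy1, hy2⟩ := h1
  exact Set.disjoint_left.1 (hP hσ hτ hne) hy1 hy2

/-- The functional ⟪·, v⟫ attains a maximum on `S`, and translation by a nonzero `v` would raise it.
-/
theorem eq_of_vadd_eq_of_isCompact {S : Set Plane} (hc : IsCompact S) (hne : S.Nonempty)
    {v : Plane} (h : v +ᵥ S = S) : v = 0 := by
  by_contra hv
  obtain ⟨x, hx, hmax⟩ := hc.exists_isMaxOn hne
    (f := fun y : Plane => ⟪y, v⟫) (by fun_prop)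
  have h1 : v + x ∈ S := by
    rw [← h]; exact Set.vadd_mem_vadd_set hx
  have h2 := hmax h1
  simp only [Set.mem_ofPred_eq, inner_add_left] at h2
  have := real_inner_self_pos.2 hv
  linarith

theorem vadd_proto_injective {i j : ι} {v w : Plane} (h : v +ᵥ Φ.proto i = w +ᵥ Φ.proto j) :
    i = j ∧ v = w := by
  have h1 : (-w + v) +ᵥ Φ.proto i = Φ.proto j := by
    rw [add_vadd, h]; simp
  obtain rfl := Φ.inequivalent i j _ h1
  refine ⟨rfl, ?_⟩
  have h2 := eq_of_vadd_eq_of_isCompact (proto_isCompact i) (proto_nonempty i)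
    (v := -w + v) (congrArg Tile.support h1)
  rw [neg_add_eq_zero] at h2
  exact h2.symm

theorem patchSupport_apply {P : Set (Tile M)} (h : Φ.Tiles P) :
    patchSupport (Φ.apply P) = Φ.scale • patchSupport P := by
  ext x
  obtain ⟨y, rfl⟩ : ∃ y : Plane, x = Φ.scale • y := ⟨Φ.scale⁻¹ • x, by
    rw [smul_smul, mul_inv_cancel₀ Φ.scale_ne, one_smul]⟩
  rw [Set.smul_mem_smul_set_iff₀ Φ.scale_ne, mem_patchSupport, mem_patchSupport]
  constructor
  · rintro ⟨τ, hτ, hx⟩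
    obtain ⟨i, v, h1, h2⟩ := mem_apply.1 hτ
    exact ⟨_, h1, support_of_mem_subst h2 hx⟩
  · rintro ⟨τ, hτ, hy⟩
    obtain ⟨i, v, rfl⟩ := h τ hτ
    have h1 : Φ.scale • (y - v) ∈ patchSupport (Φ.subst i) := by
      rw [Φ.subst_support, Set.smul_mem_smul_set_iff₀ Φ.scale_ne]
      exact mem_vadd_support.1 hy
    obtain ⟨σ, hσ, hσx⟩ := mem_patchSupport.1 h1
    refine ⟨Φ.scale • v +ᵥ σ, mem_apply.2 ⟨i, v, hτ, by simpa using hσ⟩, ?_⟩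
    rw [mem_vadd_support, ← smul_sub]; exact hσx

theorem apply_isPatch {P : Set (Tile M)} (hP : IsPatch P) : IsPatch (Φ.apply P) := by
  intro σ hσ τ hτ hne
  obtain ⟨i, v, h1, h2⟩ := mem_apply.1 hσ
  obtain ⟨j, w, h3, h4⟩ := mem_apply.1 hτ
  by_cases heq : v +ᵥ Φ.proto i = w +ᵥ Φ.proto j
  · obtain ⟨rfl, rfl⟩ := vadd_proto_injective heq
    have h5 := vadd_isPatch (Φ.subst_isPatch i) (Φ.scale • v)
    exact h5 (mem_vadd_tiles.2 h2) (mem_vadd_tiles.2 h4) hne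
  · have h5 : Disjoint (interior (v +ᵥ Φ.proto i).support) (interior (w +ᵥ Φ.proto j).support) :=
      hP h1 h3 heq
    rw [Set.disjoint_left] at h5 ⊢
    intro x hx hx'
    have key : ∀ (k : ι) (u : Plane) (ρ : Tile M), -(Φ.scale • u) +ᵥ ρ ∈ Φ.subst k →
        x ∈ interior ρ.support → Φ.scale⁻¹ • x ∈ interior (u +ᵥ Φ.proto k).support := by
      intro k u ρ hρ hxρ
      have h6 : interior ρ.support ⊆ Φ.scale • (u +ᵥ Φ.proto k).support := by
        intro y hy
        rw [Set.mem_smul_set_iff_inv_smul_mem₀ Φ.scale_ne]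
        refine support_of_mem_subst hρ ?_
        rw [smul_smul, mul_inv_cancel₀ Φ.scale_ne, one_smul]
        exact interior_subset hy
      have h7 := interior_maximal h6 isOpen_interior hxρ
      rwa [interior_smul₀ Φ.scale_ne, Set.mem_smul_set_iff_inv_smul_mem₀ Φ.scale_ne] at h7
    exact h5 (key _ _ _ h2 hx) (key _ _ _ h4 hx')

theorem apply_iterate_isPatch (n : ℕ) {P : Set (Tile M)} (hP : IsPatch P) :
    IsPatch (Φ.apply^[n] P) := by
  induction n with
  | zero => simpa
  | succ n ih => rw [Function.iterate_succ_apply']; exact apply_isPatch ih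

theorem Tiles.apply_iterate (n : ℕ) {P : Set (Tile M)} (h : Φ.Tiles P) :
    Φ.Tiles (Φ.apply^[n] P) := by
  cases n with
  | zero => simpa
  | succ n => rw [Function.iterate_succ_apply']; exact apply_tiles _

theorem patchSupport_apply_iterate (n : ℕ) {P : Set (Tile M)} (h : Φ.Tiles P) :
    patchSupport (Φ.apply^[n] P) = Φ.scale ^ n • patchSupport P := by
  induction n with
  | zero => simp
  | succ n ih =>
    rw [Function.iterate_succ_apply', patchSupport_apply (h.apply_iterate n), ih, smul_smul,
      pow_succ']

theorem singleton_tiles (i : ι) : Φ.Tiles {Φ.proto i} := by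
  rintro τ rfl
  exact ⟨i, 0, by simp⟩

theorem isPatch_singleton (τ : Tile M) : IsPatch {τ} := Set.pairwise_singleton _ _

theorem Allowed.mono {P Q : Set (Tile M)} (h : P ⊆ Q) (hQ : Φ.Allowed Q) : Φ.Allowed P := by
  obtain ⟨m, i, v, hm, h'⟩ := hQ
  exact ⟨m, i, v, hm, h.trans h'⟩

theorem Allowed.shift {P : Set (Tile M)} (h : Φ.Allowed P) (v : Plane) :
    Φ.Allowed (SubstTiling.shift P v) := by
  obtain ⟨m, i, w, hm, h⟩ := h
  exact ⟨m, i, w + v, hm, by rw [← shift_shift]; exact shift_mono h v⟩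

theorem Allowed.apply {P : Set (Tile M)} (h : Φ.Allowed P) : Φ.Allowed (Φ.apply P) := by
  obtain ⟨m, i, w, hm, h⟩ := h
  refine ⟨m + 1, i, Φ.scale • w, by omega, ?_⟩
  rw [Function.iterate_succ_apply', ← apply_shift]
  exact apply_mono h

theorem tiles_of_mem {T : Set (Tile M)} (hT : T ∈ Φ.tilingSpace) : Φ.Tiles T := by
  intro τ hτ
  obtain ⟨m, i, v, hm, h⟩ := hT.2 {τ} (by simpa) (Set.finite_singleton _)
  exact (((singleton_tiles i).apply_iterate m).shift v) τ (h rfl)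

theorem shift_mem {T : Set (Tile M)} (hT : T ∈ Φ.tilingSpace) (v : Plane) :
    shift T v ∈ Φ.tilingSpace := by
  refine ⟨shift_isTiling hT.1 v, fun P hP hfin => ?_⟩
  have h1 : shift P (-v) ⊆ T := by
    have := shift_mono hP (-v)
    rwa [shift_shift, add_neg_cancel, shift_zero] at this
  have h2 := (hT.2 _ h1 hfin.vadd_set).shift v
  rwa [shift_shift, neg_add_cancel, shift_zero] at h2

theorem apply_mem {T : Set (Tile M)} (hT : T ∈ Φ.tilingSpace) : Φ.apply T ∈ Φ.tilingSpace := by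
  refine ⟨⟨apply_isPatch hT.1.1, ?_⟩, fun P hP hfin => ?_⟩
  · rw [patchSupport_apply (tiles_of_mem hT), hT.1.2, Set.smul_set_univ₀ Φ.scale_ne]
  · have h1 : ∀ τ : P, ∃ σ ∈ T, (τ : Tile M) ∈ Φ.apply {σ} := by
      rintro ⟨τ, hτ⟩
      obtain ⟨i, v, h1, h2⟩ := mem_apply.1 (hP hτ)
      exact ⟨_, h1, mem_apply.2 ⟨i, v, rfl, h2⟩⟩
    choose f hf hf' using h1
    have := hfin.to_subtype
    have h2 := (hT.2 (Set.range f) (by rintro _ ⟨τ, rfl⟩; exact hf τ) (Set.finite_range f)).apply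
    refine h2.mono fun τ hτ => ?_
    exact apply_mono (by rintro _ rfl; exact ⟨_, rfl⟩) (hf' ⟨τ, hτ⟩)

theorem apply_iterate_mem (n : ℕ) {T : Set (Tile M)} (hT : T ∈ Φ.tilingSpace) :
    Φ.apply^[n] T ∈ Φ.tilingSpace := by
  induction n with
  | zero => simpa
  | succ n ih => rw [Function.iterate_succ_apply']; exact apply_mem ih

theorem eq_of_forall_tilesAt {T T' : Set (Tile M)} (hT : T ∈ Φ.tilingSpace)
    (hT' : T' ∈ Φ.tilingSpace) (h : ∀ x, tilesAt T x = tilesAt T' x) : T = T' := by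
  have key : ∀ S S' : Set (Tile M), S ∈ Φ.tilingSpace → (∀ x, tilesAt S x = tilesAt S' x) →
      S ⊆ S' := by
    intro S S' hS h τ hτ
    obtain ⟨x, hx⟩ := (tiles_of_mem hS).interior_nonempty hτ
    have : τ ∈ tilesAt S x := ⟨hτ, interior_subset hx⟩
    rw [h] at this
    exact this.1
  exact (key _ _ hT h).antisymm (key _ _ hT' fun x => (h x).symm)

/-- If the tiles of a tiling that meet an open set belong to a patch, the two agree there. -/
theorem tilesAt_eq_of_subset {T P : Set (Tile M)} (hT : IsTiling T) (hP : IsPatch P)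
    (hP' : Φ.Tiles P) {U : Set Plane} (hU : IsOpen U)
    (h : ∀ x ∈ U, tilesAt T x ⊆ P) {x : Plane} (hx : x ∈ U) : tilesAt T x = tilesAt P x := by
  refine Set.Subset.antisymm (fun τ hτ => ⟨h x hx hτ, hτ.2⟩) fun σ hσ => ⟨?_, hσ.2⟩
  obtain ⟨y, hyU, hyσ⟩ := mem_closure_iff.1 (hP'.closure_interior hσ.1 hσ.2) U hU hx
  obtain ⟨τ, hτ⟩ := hT.tilesAt_nonempty y
  rw [eq_of_mem_interior hP hP' hσ.1 (h y hyU hτ) hyσ hτ.2]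
  exact hτ.1

/-! ### Uniform bounds on prototiles -/

theorem exists_radius [Finite ι] (Φ : Substitution ι M) :
    ∃ D : ℝ, 0 < D ∧ ∀ i, ∀ x ∈ (Φ.proto i).support, ‖x‖ ≤ D := by
  have := fun i => (proto_isCompact (Φ := Φ) i).isBounded.exists_norm_le
  choose D hD using this
  obtain ⟨E, hE⟩ := (Set.finite_range D).bddAbove
  refine ⟨max E 1, by positivity, fun i x hx => (hD i x hx).trans ?_⟩
  exact (hE ⟨i, rfl⟩).trans (le_max_left _ _)

theorem exists_inradius [Finite ι] (Φ : Substitution ι M) :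
    ∃ r : ℝ, 0 < r ∧ ∀ i, ∀ a b : Plane, ‖a - b‖ < r →
      ¬ Disjoint (interior (a +ᵥ Φ.proto i).support) (interior (b +ᵥ Φ.proto i).support) := by
  have : ∀ i, ∃ r : ℝ, 0 < r ∧ ∃ c, Metric.ball c r ⊆ interior (Φ.proto i).support := by
    intro i
    obtain ⟨c, hc⟩ := proto_interior_nonempty (Φ := Φ) i
    obtain ⟨r, hr, h⟩ := Metric.isOpen_iff.1 isOpen_interior c hc
    exact ⟨r, hr, c, h⟩
  choose r hr c hc using this
  have h1 : ∃ r₀ : ℝ, 0 < r₀ ∧ ∀ i, r₀ ≤ r i := by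
    cases isEmpty_or_nonempty ι
    · exact ⟨1, one_pos, fun i => isEmptyElim i⟩
    · obtain ⟨i, hi⟩ := Finite.exists_min r
      exact ⟨r i, hr i, hi⟩
  obtain ⟨r₀, hr₀, h1⟩ := h1
  refine ⟨r₀, hr₀, fun i a b hab => ?_⟩
  rw [Set.not_disjoint_iff]
  refine ⟨a + c i, ?_, ?_⟩
  · rw [mem_interior_vadd_support]
    apply hc
    simpa using hr i
  · rw [mem_interior_vadd_support]
    apply hc
    rw [Metric.mem_ball, dist_eq_norm]
    have : a + c i - b - c i = a - b := by abel
    rw [this]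
    exact hab.trans_le (h1 i)

/-- Return vectors are discrete: the common tile gives two tiles of `T` of the same type, displaced
by less than the inradius. They overlap, hence coincide. -/
theorem small_return {T : Set (Tile M)} (hT : T ∈ Φ.tilingSpace) {r : ℝ}
    (hr : ∀ i, ∀ a b : Plane, ‖a - b‖ < r →
      ¬ Disjoint (interior (a +ᵥ Φ.proto i).support) (interior (b +ᵥ Φ.proto i).support))
    {a b x : Plane} (hab : ‖a - b‖ < r) (h : tilesAt (shift T a) x = tilesAt (shift T b) x) :
    a = b := by
  obtain ⟨τ, hτ⟩ := (shift_mem hT a).1.tilesAt_nonempty x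
  have hτ' := hτ
  rw [h] at hτ'
  have h1 := mem_shift.1 hτ.1
  have h2 := mem_shift.1 hτ'.1
  obtain ⟨i, v, rfl⟩ := tiles_of_mem (shift_mem hT a) τ hτ.1
  rw [vadd_vadd] at h1 h2
  by_contra hne
  refine hr i (a + v) (b + v) (by simpa using hab) (hT.1.1 h1 h2 fun h3 => hne ?_)
  exact add_right_cancel (vadd_proto_injective h3).2

/-! ### Iterates of a single tile and existence of tilings -/

theorem mem_apply_iterate {n : ℕ} {P : Set (Tile M)} {τ : Tile M} :
    τ ∈ Φ.apply^[n] P ↔ ∃ σ ∈ P, τ ∈ Φ.apply^[n] {σ} := by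
  induction n generalizing τ with
  | zero => simp
  | succ n ih =>
    simp only [Function.iterate_succ_apply']
    constructor
    · intro h
      obtain ⟨i, v, h1, h2⟩ := mem_apply.1 h
      obtain ⟨σ, hσ, h3⟩ := ih.1 h1
      exact ⟨σ, hσ, mem_apply.2 ⟨i, v, h3, h2⟩⟩
    · rintro ⟨σ, hσ, h⟩
      obtain ⟨i, v, h1, h2⟩ := mem_apply.1 h
      exact mem_apply.2 ⟨i, v, ih.2 ⟨σ, hσ, h1⟩, h2⟩

theorem singleton_vadd (v : Plane) (τ : Tile M) : ({v +ᵥ τ} : Set (Tile M)) = shift {τ} (-v) := by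
  ext σ
  rw [mem_shift, Set.mem_singleton_iff, Set.mem_singleton_iff, neg_vadd_eq_iff]

theorem iterate_singleton_vadd (n : ℕ) (v : Plane) (τ : Tile M) :
    Φ.apply^[n] {v +ᵥ τ} = shift (Φ.apply^[n] {τ}) (-(Φ.scale ^ n • v)) := by
  rw [singleton_vadd, apply_iterate_shift, smul_neg]

theorem one_lt_scale_pow {n : ℕ} (hn : n ≠ 0) : 1 < Φ.scale ^ n :=
  one_lt_pow₀ Φ.one_lt_scale hn

theorem scale_pow_pos (n : ℕ) : 0 < Φ.scale ^ n := pow_pos Φ.scale_pos n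

/-- Some tile recurs, under a power of the substitution, in the interior of its own image. -/
theorem exists_interior_recurrence [Finite ι] [Nonempty ι] (hprim : Φ.Primitive) :
    ∃ (i : ι) (N : ℕ) (u : Plane), N ≠ 0 ∧ u +ᵥ Φ.proto i ∈ Φ.apply^[N] {Φ.proto i} ∧
      (u +ᵥ Φ.proto i).support ⊆ interior (Φ.scale ^ N • (Φ.proto i).support) := by
  obtain ⟨D, hD, hD'⟩ := Φ.exists_radius
  obtain ⟨i⟩ := ‹Nonempty ι›
  obtain ⟨c, hc⟩ := proto_interior_nonempty (Φ := Φ) i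
  obtain ⟨r, hr, hcr⟩ := Metric.isOpen_iff.1 isOpen_interior c hc
  -- The inflated inball must be wider than any tile, so that the tile found at its centre stays
  -- inside the inflated prototile; primitivity then leads back to type `i`.
  obtain ⟨n, hn⟩ := pow_unbounded_of_one_lt (2 * D / r) Φ.one_lt_scale
  have hn0 : 2 * D < Φ.scale ^ (n + 1) * r := by
    have h1 : Φ.scale ^ n ≤ Φ.scale ^ (n + 1) :=
      pow_le_pow_right₀ Φ.one_lt_scale.le (Nat.le_succ n)
    rw [div_lt_iff₀ hr] at hn
    nlinarith
  set L := Φ.scale ^ (n + 1) with hL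
  have hLpos : 0 < L := scale_pow_pos _
  have hcov : L • c ∈ patchSupport (Φ.apply^[n + 1] {Φ.proto i}) := by
    rw [patchSupport_apply_iterate _ (singleton_tiles i)]
    refine Set.smul_mem_smul_set ?_
    simpa [patchSupport] using interior_subset hc
  obtain ⟨σ, hσ, hσc⟩ := mem_patchSupport.1 hcov
  obtain ⟨j, v, rfl⟩ := (singleton_tiles i).apply_iterate (n + 1) σ hσ
  obtain ⟨m, w, hw⟩ := hprim i j
  have hsub : (v +ᵥ Φ.proto j).support ⊆ interior (L • (Φ.proto i).support) := by
    intro x hx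
    rw [interior_smul₀ hLpos.ne', Set.mem_smul_set_iff_inv_smul_mem₀ hLpos.ne']
    apply hcr
    have h1 := hD' j _ (mem_vadd_support.1 hx)
    have h2 := hD' j _ (mem_vadd_support.1 hσc)
    have h3 : ‖x - L • c‖ ≤ 2 * D := by
      have : x - L • c = (x - v) - (L • c - v) := by abel
      rw [this]
      exact (norm_sub_le _ _).trans (by linarith)
    rw [Metric.mem_ball, dist_eq_norm]
    have h4 : L⁻¹ • x - c = L⁻¹ • (x - L • c) := by
      rw [smul_sub, smul_smul, inv_mul_cancel₀ hLpos.ne', one_smul]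
    rw [h4, norm_smul, norm_inv, Real.norm_of_nonneg hLpos.le, inv_mul_lt_iff₀ hLpos]
    linarith
  have hmem : (Φ.scale ^ m • v + w) +ᵥ Φ.proto i ∈ Φ.apply^[m] {v +ᵥ Φ.proto j} := by
    rw [iterate_singleton_vadd, mem_shift, vadd_vadd, neg_add_cancel_left]
    exact hw
  refine ⟨i, m + (n + 1), Φ.scale ^ m • v + w, by omega, ?_, ?_⟩
  · rw [Function.iterate_add_apply]
    exact apply_iterate_mono m (Set.singleton_subset_iff.2 hσ) hmem
  · have h1 : ((Φ.scale ^ m • v + w) +ᵥ Φ.proto i).support ⊆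
        Φ.scale ^ m • (v +ᵥ Φ.proto j).support := by
      have h2 : Φ.Tiles {v +ᵥ Φ.proto j} := by
        rintro _ rfl; exact ⟨j, v, rfl⟩
      have h3 := patchSupport_apply_iterate m h2
      have h4 : patchSupport {v +ᵥ Φ.proto j} = (v +ᵥ Φ.proto j).support := by simp [patchSupport]
      rw [h4] at h3
      rw [← h3]
      exact fun x hx => mem_patchSupport.2 ⟨_, hmem, hx⟩
    refine h1.trans ((Set.smul_set_mono hsub).trans ?_)
    rw [← interior_smul₀ (scale_pow_pos m).ne', smul_smul, ← pow_add]

/-- With the origin moved to the fixed point of the recurrence, a tile belongs to its own image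
under Φ^N. Its iterates increase, and they exhaust the plane because the origin is an interior
point. -/
theorem tilingSpace_nonempty [Finite ι] [Nonempty ι] (hprim : Φ.Primitive) :
    Φ.tilingSpace.Nonempty := by
  obtain ⟨i, N, u, hN, hu, hsub⟩ := exists_interior_recurrence hprim
  set L := Φ.scale ^ N with hL
  have hL1 : 1 < L := one_lt_scale_pow hN
  have hL0 : 0 < L := zero_lt_one.trans hL1
  set K := (Φ.proto i).support with hK
  -- `c` is the fixed point of x ↦ L⁻¹(x + u), a contraction that maps `K` into its interior.
  set c : Plane := (L - 1)⁻¹ • u with hc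
  have hcu : c + u = L • c := by
    have : u = (L - 1) • c := by rw [hc, smul_smul, mul_inv_cancel₀ (by linarith), one_smul]
    rw [this, sub_smul, one_smul]; abel
  have hstep : ∀ x ∈ K, L⁻¹ • (x + u) ∈ interior K := by
    intro x hx
    have h1 : x + u ∈ (u +ᵥ Φ.proto i).support := by rw [mem_vadd_support]; simpa
    have h2 := hsub h1
    rwa [interior_smul₀ hL0.ne', Set.mem_smul_set_iff_inv_smul_mem₀ hL0.ne'] at h2
  have hcK : c ∈ interior K := by
    obtain ⟨x₀, hx₀⟩ := proto_nonempty (Φ := Φ) i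
    have h1 : ∀ k : ℕ, c + (L⁻¹) ^ k • (x₀ - c) ∈ K := by
      intro k
      induction k with
      | zero => simpa
      | succ k ih =>
        have h2 := interior_subset (hstep _ ih)
        have h3 : L⁻¹ • (c + L⁻¹ ^ k • (x₀ - c) + u) = c + L⁻¹ ^ (k + 1) • (x₀ - c) := by
          have : c + L⁻¹ ^ k • (x₀ - c) + u = L • c + L⁻¹ ^ k • (x₀ - c) := by rw [← hcu]; abel
          rw [this, smul_add, smul_smul, inv_mul_cancel₀ hL0.ne', one_smul, smul_smul, pow_succ']
        rwa [h3] at h2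
    have h4 : Tendsto (fun k : ℕ => c + (L⁻¹) ^ k • (x₀ - c)) atTop
        (𝓝 (c + (0 : ℝ) • (x₀ - c))) := by
      refine tendsto_const_nhds.add (Tendsto.smul_const ?_ _)
      exact tendsto_pow_atTop_nhds_zero_of_lt_one (by positivity) (inv_lt_one_of_one_lt₀ hL1)
    rw [zero_smul, add_zero] at h4
    have h5 : c ∈ K := (proto_isCompact i).isClosed.mem_of_tendsto h4 (Eventually.of_forall h1)
    have h6 := hstep c h5
    rwa [hcu, smul_smul, inv_mul_cancel₀ hL0.ne', one_smul] at h6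
  set Q : Set (Tile M) := shift {Φ.proto i} c with hQ
  have hQt : Φ.Tiles Q := (singleton_tiles i).shift c
  have hQP : IsPatch Q := vadd_isPatch (isPatch_singleton _) _
  have hQsub : Q ⊆ Φ.apply^[N] Q := by
    intro τ hτ
    rw [hQ, mem_shift, Set.mem_singleton_iff] at hτ
    rw [hQ, apply_iterate_shift, mem_shift]
    rw [← hτ, vadd_vadd, add_comm, hcu] at hu
    rwa [hτ] at hu
  set P : ℕ → Set (Tile M) := fun k => Φ.apply^[N * k] Q with hP
  have hmono : Monotone P := by
    refine monotone_nat_of_le_succ fun k => ?_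
    simp only [hP]
    rw [mul_add, mul_one, Function.iterate_add_apply]
    exact apply_iterate_mono _ hQsub
  refine ⟨⋃ k, P k, ⟨?_, ?_⟩, fun F hF hfin => ?_⟩
  · intro σ hσ τ hτ hne
    obtain ⟨k, hk⟩ := Set.mem_iUnion.1 hσ
    obtain ⟨l, hl⟩ := Set.mem_iUnion.1 hτ
    exact apply_iterate_isPatch _ hQP (hmono (le_max_left k l) hk) (hmono (le_max_right k l) hl) hne
  · rw [Set.eq_univ_iff_forall]
    intro x
    obtain ⟨ε, hε, hball⟩ := Metric.isOpen_iff.1 isOpen_interior c hcK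
    obtain ⟨k, hk⟩ := pow_unbounded_of_one_lt (‖x‖ / ε) hL1
    have hLk : 0 < L ^ k := pow_pos hL0 k
    have h1 : x ∈ patchSupport (P k) := by
      simp only [hP]
      rw [patchSupport_apply_iterate _ hQt, pow_mul, ← hL,
        Set.mem_smul_set_iff_inv_smul_mem₀ hLk.ne', mem_patchSupport]
      refine ⟨-c +ᵥ Φ.proto i, by rw [hQ, mem_shift]; simp, ?_⟩
      rw [mem_vadd_support]
      apply interior_subset
      apply hball
      rw [Metric.mem_ball, dist_eq_norm, sub_neg_eq_add, add_sub_cancel_right, norm_smul, norm_inv,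
        Real.norm_of_nonneg hLk.le, inv_mul_lt_iff₀ hLk]
      rwa [div_lt_iff₀ hε] at hk
    obtain ⟨τ, hτ, hx⟩ := mem_patchSupport.1 h1
    exact mem_patchSupport.2 ⟨τ, Set.mem_iUnion.2 ⟨k, hτ⟩, hx⟩
  · have h1 : ∀ τ : F, ∃ k, (τ : Tile M) ∈ P k := fun τ => Set.mem_iUnion.1 (hF τ.2)
    choose f hf using h1
    have := hfin.to_subtype
    obtain ⟨B, hB⟩ := (Set.finite_range f).bddAbove
    -- `B + 1` instead of `B`, because `Allowed` asks for at least one substitution.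
    refine ⟨N * (B + 1), i, Φ.scale ^ (N * (B + 1)) • c, Nat.mul_pos (Nat.pos_of_ne_zero hN)
      (Nat.succ_pos B), fun τ hτ => ?_⟩
    rw [← apply_iterate_shift]
    exact hmono ((hB ⟨⟨τ, hτ⟩, rfl⟩).trans (Nat.le_succ B)) (hf ⟨τ, hτ⟩)

/-! ### Local finiteness -/

theorem norm_le_of_mem_ballPatch {D R : ℝ} (hD : ∀ i, ∀ x ∈ (Φ.proto i).support, ‖x‖ ≤ D)
    {T : Set (Tile M)} (hT : Φ.Tiles T) {τ : Tile M} (hτ : τ ∈ ballPatch R T) {x : Plane}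
    (hx : x ∈ τ.support) : ‖x‖ ≤ R + 2 * D := by
  obtain ⟨y, hy, hyτ⟩ := hτ.2
  obtain ⟨i, v, rfl⟩ := hT τ hτ.1
  have h1 := hD i _ (mem_vadd_support.1 hx)
  have h2 := hD i _ (mem_vadd_support.1 hyτ)
  rw [mem_ball_zero_iff] at hy
  have : x = y + ((x - v) - (y - v)) := by abel
  rw [this]
  calc _ ≤ ‖y‖ + (‖x - v‖ + ‖y - v‖) := (norm_add_le _ _).trans (by gcongr; exact norm_sub_le _ _)
    _ ≤ _ := by linarith

/-- An infinite ball patch would have subpatches of every finite cardinality, hence infinitely many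
translation classes of bounded diameter. -/
theorem ballPatch_finite [Finite ι] (hflc : FLC Φ.tilingSpace) {T : Set (Tile M)}
    (hT : T ∈ Φ.tilingSpace) (R : ℝ) : (ballPatch R T).Finite := by
  obtain ⟨D, hD, hD'⟩ := Φ.exists_radius
  by_contra hinf
  obtain ⟨𝓕, h𝓕, h⟩ := hflc (2 * (R + 2 * D))
  have h1 : ∀ n : ℕ, ∃ Q ∈ 𝓕, Q.ncard = n := by
    intro n
    obtain ⟨P, hP, -, hn⟩ := Set.Infinite.exists_subset_ncard_eq (s := ballPatch R T) hinf n
    obtain ⟨Q, hQ, v, hv⟩ := h T hT P (fun τ hτ => (hP hτ).1) (by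
      intro x hx y hy
      obtain ⟨σ, hσ, hx⟩ := mem_patchSupport.1 hx
      obtain ⟨τ, hτ, hy⟩ := mem_patchSupport.1 hy
      have h1 := norm_le_of_mem_ballPatch hD' (tiles_of_mem hT) (hP hσ) hx
      have h2 := norm_le_of_mem_ballPatch hD' (tiles_of_mem hT) (hP hτ) hy
      rw [dist_eq_norm]
      exact (norm_sub_le _ _).trans (by linarith))
    refine ⟨Q, hQ, ?_⟩
    rw [← hn, hv, ← Set.image_vadd, Set.ncard_image_of_injective _ (AddAction.injective v)]
  choose Q hQ hn using h1
  have hinj : Function.Injective Q := fun a b hab => by rw [← hn a, hab, hn b]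
  exact (Set.infinite_of_injective_forall_mem hinj hQ) h𝓕

theorem mem_ballPatch {R : ℝ} {T : Set (Tile M)} {τ : Tile M} :
    τ ∈ ballPatch R T ↔ ∃ x, ‖x‖ < R ∧ τ ∈ tilesAt T x := by
  constructor
  · rintro ⟨h, x, hx, hx'⟩
    exact ⟨x, mem_ball_zero_iff.1 hx, h, hx'⟩
  · rintro ⟨x, hx, h, hx'⟩
    exact ⟨h, x, mem_ball_zero_iff.2 hx, hx'⟩

theorem ballPatch_eq_iff {R : ℝ} {T T' : Set (Tile M)} :
    ballPatch R T = ballPatch R T' ↔ ∀ x, ‖x‖ < R → tilesAt T x = tilesAt T' x := by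
  constructor
  · intro h x hx
    ext τ
    constructor
    · intro hτ
      have : τ ∈ ballPatch R T := mem_ballPatch.2 ⟨x, hx, hτ⟩
      rw [h] at this
      exact ⟨this.1, hτ.2⟩
    · intro hτ
      have : τ ∈ ballPatch R T' := mem_ballPatch.2 ⟨x, hx, hτ⟩
      rw [← h] at this
      exact ⟨this.1, hτ.2⟩
  · intro h
    ext τ
    rw [mem_ballPatch, mem_ballPatch]
    refine exists_congr fun x => and_congr_right fun hx => ?_
    rw [h x hx]

/-- Tiles are closed and locally finite in number, so those that miss `x` also miss a neighbourhood
of `x`. -/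
theorem eventually_tilesAt_subset [Finite ι] (hflc : FLC Φ.tilingSpace) {T : Set (Tile M)}
    (hT : T ∈ Φ.tilingSpace) (x : Plane) : ∀ᶠ y in 𝓝 x, tilesAt T y ⊆ tilesAt T x := by
  have hfin := ballPatch_finite hflc hT (‖x‖ + 1)
  have h1 : ∀ᶠ y in 𝓝 x, ∀ τ ∈ ballPatch (‖x‖ + 1) T, y ∈ τ.support → x ∈ τ.support := by
    rw [Filter.eventually_all_finite hfin]
    intro τ hτ
    by_cases hx : x ∈ τ.support
    · exact Eventually.of_forall fun _ _ => hx
    · have := ((tiles_of_mem hT).isClosed hτ.1).isOpen_compl.mem_nhds hx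
      filter_upwards [this] with y hy hy'
      exact absurd hy' hy
  have h2 : ∀ᶠ y in 𝓝 x, ‖y‖ < ‖x‖ + 1 :=
    continuous_norm.continuousAt.eventually_lt continuousAt_const (by linarith)
  filter_upwards [h1, h2] with y hy1 hy2 τ hτ
  exact ⟨hτ.1, hy1 τ (mem_ballPatch.2 ⟨y, hy2, hτ⟩) hτ.2⟩

theorem eventually_tilesAt_eq [Finite ι] (hflc : FLC Φ.tilingSpace) {T T' : Set (Tile M)}
    (hT : T ∈ Φ.tilingSpace) (hT' : T' ∈ Φ.tilingSpace) {x : Plane}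
    (h : tilesAt T x = tilesAt T' x) : ∀ᶠ y in 𝓝 x, tilesAt T y = tilesAt T' y := by
  filter_upwards [eventually_tilesAt_subset hflc hT x, eventually_tilesAt_subset hflc hT' x]
    with y h1 h2
  ext τ
  constructor
  · intro hτ
    have := h1 hτ
    rw [h] at this
    exact ⟨this.1, hτ.2⟩
  · intro hτ
    have := h2 hτ
    rw [← h] at this
    exact ⟨this.1, hτ.2⟩

/-! ### Eventual agreement at a point -/

variable (Φ) in
/-- `T` and `T'` eventually agree at `x`: for some `k` the tiles of `Φ^k T` and `Φ^k T'` that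
contain `λ^k x` are the same. -/
def Asy (T T' : Set (Tile M)) (x : Plane) : Prop :=
  ∃ k : ℕ, tilesAt (Φ.apply^[k] T) (Φ.scale ^ k • x) = tilesAt (Φ.apply^[k] T') (Φ.scale ^ k • x)

theorem agree_mono {T T' : Set (Tile M)} {x : Plane} {k l : ℕ} (hkl : k ≤ l)
    (h : tilesAt (Φ.apply^[k] T) (Φ.scale ^ k • x) =
      tilesAt (Φ.apply^[k] T') (Φ.scale ^ k • x)) :
    tilesAt (Φ.apply^[l] T) (Φ.scale ^ l • x) = tilesAt (Φ.apply^[l] T') (Φ.scale ^ l • x) := by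
  obtain ⟨m, rfl⟩ := Nat.exists_eq_add_of_le' hkl
  rw [Function.iterate_add_apply, Function.iterate_add_apply, pow_add, mul_smul]
  exact tilesAt_iterate_congr m h

theorem asy_of_tilesAt_eq {T T' : Set (Tile M)} {x : Plane} (h : tilesAt T x = tilesAt T' x) :
    Φ.Asy T T' x := ⟨0, by simpa⟩

theorem Asy.refl (T : Set (Tile M)) (x : Plane) : Φ.Asy T T x := ⟨0, rfl⟩

theorem Asy.symm {T T' : Set (Tile M)} {x : Plane} (h : Φ.Asy T T' x) : Φ.Asy T' T x := by
  obtain ⟨k, hk⟩ := h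
  exact ⟨k, hk.symm⟩

theorem Asy.trans {T T' T'' : Set (Tile M)} {x : Plane} (h : Φ.Asy T T' x) (h' : Φ.Asy T' T'' x) :
    Φ.Asy T T'' x := by
  obtain ⟨k, hk⟩ := h
  obtain ⟨l, hl⟩ := h'
  exact ⟨max k l, (agree_mono (le_max_left k l) hk).trans (agree_mono (le_max_right k l) hl)⟩

theorem asy_congr {T T' S S' : Set (Tile M)} {x : Plane} (h : tilesAt T x = tilesAt S x)
    (h' : tilesAt T' x = tilesAt S' x) : Φ.Asy T T' x ↔ Φ.Asy S S' x := by
  refine exists_congr fun k => ?_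
  rw [tilesAt_iterate_congr k h, tilesAt_iterate_congr k h']

theorem asy_iterate {T T' : Set (Tile M)} {x : Plane} (n : ℕ) :
    Φ.Asy (Φ.apply^[n] T) (Φ.apply^[n] T') (Φ.scale ^ n • x) ↔ Φ.Asy T T' x := by
  constructor
  · rintro ⟨k, hk⟩
    rw [← Function.iterate_add_apply, ← Function.iterate_add_apply, smul_smul, ← pow_add] at hk
    exact ⟨_, hk⟩
  · rintro ⟨k, hk⟩
    refine ⟨k, ?_⟩
    rw [← Function.iterate_add_apply, ← Function.iterate_add_apply, smul_smul, ← pow_add]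
    exact agree_mono (Nat.le_add_right k n) hk

theorem asy_iterate' {T T' : Set (Tile M)} {x : Plane} (n : ℕ) :
    Φ.Asy (Φ.apply^[n] T) (Φ.apply^[n] T') x ↔ Φ.Asy T T' ((Φ.scale ^ n)⁻¹ • x) := by
  rw [← asy_iterate (T := T) n, smul_smul, mul_inv_cancel₀ (scale_pow_pos n).ne', one_smul]

theorem asy_shift {T T' : Set (Tile M)} {v x : Plane} :
    Φ.Asy (shift T v) (shift T' v) x ↔ Φ.Asy T T' (x + v) := by
  refine exists_congr fun k => ?_
  rw [apply_iterate_shift, apply_iterate_shift, tilesAt_shift_eq_iff, smul_add]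

theorem isOpen_asy [Finite ι] (hflc : FLC Φ.tilingSpace) {T T' : Set (Tile M)}
    (hT : T ∈ Φ.tilingSpace) (hT' : T' ∈ Φ.tilingSpace) : IsOpen {x | Φ.Asy T T' x} := by
  rw [isOpen_iff_mem_nhds]
  rintro x ⟨k, hk⟩
  have h1 := eventually_tilesAt_eq hflc (apply_iterate_mem k hT) (apply_iterate_mem k hT') hk
  have h2 : Tendsto (fun y : Plane => Φ.scale ^ k • y) (𝓝 x) (𝓝 (Φ.scale ^ k • x)) :=
    (continuous_const_smul _).tendsto x
  filter_upwards [h2.eventually h1] with y hy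
  exact ⟨k, hy⟩

/-- Compactness of `K` for a fixed pair. The number of steps still depends on the pair;
`exists_uniform_step` removes this dependence. -/
theorem exists_uniform_agree [Finite ι] (hflc : FLC Φ.tilingSpace) {T T' : Set (Tile M)}
    (hT : T ∈ Φ.tilingSpace) (hT' : T' ∈ Φ.tilingSpace) {K : Set Plane} (hK : IsCompact K)
    (h : ∀ x ∈ K, Φ.Asy T T' x) :
    ∃ k : ℕ, ∀ x ∈ K, tilesAt (Φ.apply^[k] T) (Φ.scale ^ k • x) =
      tilesAt (Φ.apply^[k] T') (Φ.scale ^ k • x) := by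
  refine hK.induction_on (p := fun K => ∃ k : ℕ, ∀ x ∈ K, tilesAt (Φ.apply^[k] T)
    (Φ.scale ^ k • x) = tilesAt (Φ.apply^[k] T') (Φ.scale ^ k • x)) ⟨0, by simp⟩ ?_ ?_ ?_
  · rintro s t hst ⟨k, hk⟩
    exact ⟨k, fun x hx => hk x (hst hx)⟩
  · rintro s t ⟨k, hk⟩ ⟨l, hl⟩
    refine ⟨max k l, ?_⟩
    rintro x (hx | hx)
    · exact agree_mono (le_max_left k l) (hk x hx)
    · exact agree_mono (le_max_right k l) (hl x hx)
  · intro x hx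
    obtain ⟨k, hk⟩ := h x hx
    have h1 := eventually_tilesAt_eq hflc (apply_iterate_mem k hT) (apply_iterate_mem k hT') hk
    have h2 : Tendsto (fun y : Plane => Φ.scale ^ k • y) (𝓝 x) (𝓝 (Φ.scale ^ k • x)) :=
      (continuous_const_smul _).tendsto x
    exact ⟨_, mem_nhdsWithin_of_mem_nhds (h2.eventually h1), k, fun y hy => hy⟩

/-! ### Stable equivalence -/

theorem tilingDist_nonneg (T T' : Set (Tile M)) : 0 ≤ tilingDist T T' := by
  refine Real.sInf_nonneg ?_
  rintro x (hx | hx)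
  · exact hx.1.le
  · rw [Set.mem_singleton_iff] at hx
    rw [hx]; positivity

theorem tilingDist_le {T T' : Set (Tile M)} {R : ℝ} (hR : 0 < R)
    (h : ballPatch R T = ballPatch R T') : tilingDist T T' ≤ R⁻¹ := by
  refine csInf_le ⟨0, ?_⟩ (Or.inl ⟨inv_pos.2 hR, 0, 0, ?_, ?_, ?_⟩)
  · rintro x (hx | hx)
    · exact hx.1.le
    · rw [Set.mem_singleton_iff] at hx
      rw [hx]; positivity
  · rw [norm_zero]; positivity
  · rw [norm_zero]; positivity
  · simpa [shift_zero] using h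

theorem exists_shift_of_tilingDist_lt {T T' : Set (Tile M)} {ε : ℝ} (hε : ε ≤ 1 / 2)
    (h : tilingDist T T' < ε) :
    ∃ z : Plane, ‖z‖ < ε ∧ tilesAt (shift T z) 0 = tilesAt T' 0 := by
  rw [tilingDist] at h
  obtain ⟨a, ha, haε⟩ := exists_lt_of_csInf_lt ((Set.singleton_nonempty _).inr) h
  rcases ha with ⟨ha0, v, v', hv, hv', hb⟩ | ha
  · refine ⟨v - v', (norm_sub_le _ _).trans_lt (by linarith), ?_⟩
    rw [ballPatch_eq_iff] at hb
    have h1 := hb (-v') (by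
      rw [norm_neg]
      refine hv'.trans_le ?_
      rw [le_div_iff₀ ha0]
      nlinarith)
    have h2 : tilesAt (shift (shift T v) (-v')) 0 = tilesAt (shift (shift T' v') (-v')) 0 :=
      tilesAt_shift_eq_iff.2 (by simpa using h1)
    rwa [shift_shift, shift_shift, add_neg_cancel, shift_zero, ← sub_eq_add_neg] at h2
  -- The cap 1/√2 exceeds 1/2 and so cannot be what makes the distance small.
  · rw [Set.mem_singleton_iff] at ha
    have : (1 : ℝ) / 2 < 1 / √2 := by
      apply one_div_lt_one_div_of_lt (by positivity)
      rw [Real.sqrt_lt' (by norm_num)]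
      norm_num
    linarith

/-- If the distance tends to 0, small vectors z_n eventually align the iterates at the origin.
Substitution multiplies such a vector by λ, and small returns are unique, so z_{n+1} = λ z_n;
boundedness forces z_n = 0. Conversely, agreement at the origin holds on a small ball, which the
substitution inflates. -/
theorem stablyEquiv_iff [Finite ι] (hflc : FLC Φ.tilingSpace) {T T' : Set (Tile M)}
    (hT : T ∈ Φ.tilingSpace) (hT' : T' ∈ Φ.tilingSpace) :
    Φ.StablyEquiv T T' ↔ Φ.Asy T T' 0 := by
  constructor
  · rintro ⟨-, h⟩
    obtain ⟨r, hr, hr'⟩ := Φ.exists_inradius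
    have hlam := Φ.scale_pos
    set ε : ℝ := min (1 / 2) (r / (2 * (Φ.scale + 1))) with hεdef
    have hε : 0 < ε := by positivity
    -- This makes ‖z_{n+1} - λ z_n‖ smaller than the inradius.
    have hεr : ε * (Φ.scale + 1) < r := by
      have : ε ≤ r / (2 * (Φ.scale + 1)) := min_le_right _ _
      rw [le_div_iff₀ (by positivity)] at this
      nlinarith
    obtain ⟨n₀, hn₀⟩ := eventually_atTop.1 (h.eventually (gt_mem_nhds hε))
    have h1 : ∀ n : ℕ, ∃ z : Plane, ‖z‖ < ε ∧
        tilesAt (shift (Φ.apply^[n₀ + n] T) z) 0 = tilesAt (Φ.apply^[n₀ + n] T') 0 := fun n =>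
      exists_shift_of_tilingDist_lt (min_le_left _ _) (hn₀ (n₀ + n) (Nat.le_add_right _ _))
    choose z hz hz' using h1
    have h2 : ∀ n, z (n + 1) = Φ.scale • z n := by
      intro n
      have h3 := tilesAt_apply_congr (Φ := Φ) (hz' n)
      rw [smul_zero, apply_shift, ← Function.iterate_succ_apply' Φ.apply,
        ← Function.iterate_succ_apply' Φ.apply] at h3
      have h4 := hz' (n + 1)
      rw [← add_assoc] at h4
      refine small_return (apply_iterate_mem (n₀ + n + 1) hT) hr' (x := 0) ?_ (h4.trans h3.symm)
      calc _ ≤ ‖z (n + 1)‖ + ‖Φ.scale • z n‖ := norm_sub_le _ _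
        _ < r := by
          rw [norm_smul, Real.norm_of_nonneg hlam.le]
          nlinarith [hz n, hz (n + 1)]
    have h3 : ∀ n, z n = Φ.scale ^ n • z 0 := by
      intro n
      induction n with
      | zero => simp
      | succ n ih => rw [h2, ih, smul_smul, pow_succ']
    have h4 : z 0 = 0 := by
      by_contra hne
      have hpos := norm_pos_iff.2 hne
      obtain ⟨n, hn⟩ := pow_unbounded_of_one_lt (ε / ‖z 0‖) Φ.one_lt_scale
      rw [div_lt_iff₀ hpos] at hn
      have := hz n
      rw [h3, norm_smul, Real.norm_of_nonneg (scale_pow_pos n).le] at this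
      linarith
    refine ⟨n₀, ?_⟩
    have := hz' 0
    rw [h4, shift_zero] at this
    simpa using this
  · rintro ⟨k, hk⟩
    refine ⟨hT, ?_⟩
    rw [smul_zero] at hk
    have h1 := eventually_tilesAt_eq hflc (apply_iterate_mem k hT) (apply_iterate_mem k hT') hk
    obtain ⟨r, hr, hball⟩ := Metric.eventually_nhds_iff.1 h1
    have h2 : ∀ j : ℕ, tilingDist (Φ.apply^[j + k] T) (Φ.apply^[j + k] T') ≤ (Φ.scale ^ j * r)⁻¹ := by
      intro j
      refine tilingDist_le (mul_pos (scale_pow_pos j) hr) (ballPatch_eq_iff.2 fun x hx => ?_)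
      rw [Function.iterate_add_apply, Function.iterate_add_apply]
      have h3 : tilesAt (Φ.apply^[k] T) ((Φ.scale ^ j)⁻¹ • x) =
          tilesAt (Φ.apply^[k] T') ((Φ.scale ^ j)⁻¹ • x) := by
        apply hball
        rw [dist_zero_right, norm_smul, norm_inv, Real.norm_of_nonneg (scale_pow_pos j).le,
          inv_mul_lt_iff₀ (scale_pow_pos j)]
        exact hx
      have h4 := tilesAt_iterate_congr (Φ := Φ) j h3
      rwa [smul_smul, mul_inv_cancel₀ (scale_pow_pos j).ne', one_smul] at h4
    rw [← tendsto_add_atTop_iff_nat k]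
    refine squeeze_zero (fun j => tilingDist_nonneg _ _) h2 ?_
    refine tendsto_inv_atTop_zero.comp ?_
    exact (tendsto_pow_atTop_atTop_of_one_lt Φ.one_lt_scale).atTop_mul_const hr

theorem stablyEquiv_shift_iff [Finite ι] (hflc : FLC Φ.tilingSpace) {T T' : Set (Tile M)}
    (hT : T ∈ Φ.tilingSpace) (hT' : T' ∈ Φ.tilingSpace) (x : Plane) :
    Φ.StablyEquiv (shift T x) (shift T' x) ↔ Φ.Asy T T' x := by
  rw [stablyEquiv_iff hflc (shift_mem hT x) (shift_mem hT' x), asy_shift, zero_add]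

/-! ### Compactness of the tiling space -/

/-- FLC counts patches up to translation only; a prototile in its own position lies in the patch as
D < ρ, and it pins the translation down. -/
theorem ballPatches_finite [Finite ι] (hflc : FLC Φ.tilingSpace) {D : ℝ}
    (hD : ∀ i, ∀ x ∈ (Φ.proto i).support, ‖x‖ ≤ D) (i : ι) {ρ : ℝ} (hρ : D < ρ) :
    {P | ∃ T ∈ Φ.tilingSpace, Φ.proto i ∈ T ∧ ballPatch ρ T = P}.Finite := by
  obtain ⟨𝓕, h𝓕, h⟩ := hflc (2 * (ρ + 2 * D))
  have h1 : (⋃ Q ∈ {Q ∈ 𝓕 | Q.Finite}, ⋃ σ ∈ Q,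
      {P : Set (Tile M) | ∃ v : Plane, v +ᵥ σ = Φ.proto i ∧ v +ᵥ Q = P}).Finite := by
    refine (h𝓕.subset (Set.sep_subset _ _)).biUnion fun Q hQ => hQ.2.biUnion fun σ hσ => ?_
    refine Set.Subsingleton.finite ?_
    rintro _ ⟨v, hv, rfl⟩ _ ⟨w, hw, rfl⟩
    have h2 : (-v) +ᵥ Φ.proto i = (-w) +ᵥ Φ.proto i := by
      rw [← hv, neg_vadd_vadd, hv, ← hw, neg_vadd_vadd]
    rw [neg_injective (vadd_proto_injective h2).2]
  refine h1.subset ?_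
  rintro P ⟨T, hT, hi, rfl⟩
  obtain ⟨Q, hQ, v, hv⟩ := h T hT (ballPatch ρ T) (fun τ hτ => hτ.1) (by
      intro x hx y hy
      obtain ⟨σ, hσ, hx⟩ := mem_patchSupport.1 hx
      obtain ⟨τ, hτ, hy⟩ := mem_patchSupport.1 hy
      have h1 := norm_le_of_mem_ballPatch hD (tiles_of_mem hT) hσ hx
      have h2 := norm_le_of_mem_ballPatch hD (tiles_of_mem hT) hτ hy
      rw [dist_eq_norm]
      exact (norm_sub_le _ _).trans (by linarith))
  have hQfin : Q.Finite := by
    have h2 : Q = -v +ᵥ ballPatch ρ T := by rw [hv]; simp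
    rw [h2]
    exact (ballPatch_finite hflc hT ρ).vadd_set
  obtain ⟨x, hx⟩ := proto_nonempty (Φ := Φ) i
  have h3 : Φ.proto i ∈ ballPatch ρ T := mem_ballPatch.2 ⟨x, (hD i x hx).trans_lt hρ, hi, hx⟩
  rw [hv, mem_vadd_tiles] at h3
  simp only [Set.mem_iUnion]
  exact ⟨Q, ⟨hQ, hQfin⟩, _, h3, v, by simp, hv.symm⟩

/-- With a prototile in fixed position only finitely many patches of each radius are possible, so
the ultrafilter selects one of them. -/
theorem exists_local_limit [Finite ι] (hflc : FLC Φ.tilingSpace) (U : Ultrafilter ℕ)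
    {T : ℕ → Set (Tile M)} (hT : ∀ n, T n ∈ Φ.tilingSpace) (i : ι)
    (hi : ∀ᶠ n in (U : Filter ℕ), Φ.proto i ∈ T n) :
    ∃ S ∈ Φ.tilingSpace, ∀ ρ, ∀ᶠ n in (U : Filter ℕ), ballPatch ρ (T n) = ballPatch ρ S := by
  obtain ⟨D, hD, hD'⟩ := Φ.exists_radius
  set S : Set (Tile M) := {τ | ∀ᶠ n in (U : Filter ℕ), τ ∈ T n} with hS
  have hloc : ∀ ρ, ∀ᶠ n in (U : Filter ℕ), ballPatch ρ (T n) = ballPatch ρ S := by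
    intro ρ
    set ρ' := max ρ (D + 1) with hρ'
    have hfin := ballPatches_finite hflc hD' i (ρ := ρ')
      (lt_of_lt_of_le (by linarith) (le_max_right _ _))
    have h1 : ∀ᶠ n in (U : Filter ℕ),
        ballPatch ρ' (T n) ∈ {P | ∃ T ∈ Φ.tilingSpace, Φ.proto i ∈ T ∧ ballPatch ρ' T = P} := by
      filter_upwards [hi] with n hn
      exact ⟨T n, hT n, hn, rfl⟩
    have h2 : ∃ P, ∀ᶠ n in (U : Filter ℕ), ballPatch ρ' (T n) = P := by
      have h3 := (Ultrafilter.eventually_exists_mem_iff (f := U) hfin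
        (P := fun P n => ballPatch ρ' (T n) = P)).1 (h1.mono fun n hn => ⟨_, hn, rfl⟩)
      obtain ⟨P, -, hP⟩ := h3
      exact ⟨P, hP⟩
    obtain ⟨P, hP⟩ := h2
    filter_upwards [hP] with n hn
    have hsub : ∀ τ, (∃ x, ‖x‖ < ρ' ∧ x ∈ τ.support) → (τ ∈ T n ↔ τ ∈ S) := by
      rintro τ ⟨x, hx, hxτ⟩
      constructor
      · intro hτ
        filter_upwards [hP] with m hm
        have : τ ∈ ballPatch ρ' (T n) := mem_ballPatch.2 ⟨x, hx, hτ, hxτ⟩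
        rw [hn, ← hm] at this
        exact this.1
      · intro hτ
        obtain ⟨m, hm, hτm⟩ := (hP.and hτ).exists
        have : τ ∈ ballPatch ρ' (T m) := mem_ballPatch.2 ⟨x, hx, hτm, hxτ⟩
        rw [hm, ← hn] at this
        exact this.1
    rw [ballPatch_eq_iff]
    intro x hx
    ext τ
    rw [mem_tilesAt, mem_tilesAt]
    exact and_congr_left fun hxτ => hsub τ ⟨x, hx.trans_le (le_max_left _ _), hxτ⟩
  refine ⟨S, ⟨⟨?_, ?_⟩, ?_⟩, hloc⟩
  · intro σ hσ τ hτ hne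
    obtain ⟨n, h1, h2⟩ := (Eventually.and (show ∀ᶠ n in (U : Filter ℕ), σ ∈ T n from hσ) hτ).exists
    exact (hT n).1.1 h1 h2 hne
  · rw [Set.eq_univ_iff_forall]
    intro x
    obtain ⟨n, hn⟩ := (hloc (‖x‖ + 1)).exists
    obtain ⟨τ, hτ⟩ := (hT n).1.tilesAt_nonempty x
    rw [ballPatch_eq_iff.1 hn x (by linarith)] at hτ
    exact mem_patchSupport.2 ⟨τ, hτ⟩
  · intro P hP hfin
    have h1 : ∀ᶠ n in (U : Filter ℕ), ∀ τ ∈ P, τ ∈ T n :=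
      (Filter.eventually_all_finite hfin).2 fun τ hτ => hP hτ
    obtain ⟨n, hn⟩ := h1.exists
    exact (hT n).2 P hn hfin

/-- Compactness for pairs of tilings that agree at a given point: along an ultrafilter, such a
sequence converges locally, up to a common translation that tends to zero. -/
theorem exists_limit_pair [Finite ι] (hflc : FLC Φ.tilingSpace) (U : Ultrafilter ℕ)
    {T T' : ℕ → Set (Tile M)} (hT : ∀ n, T n ∈ Φ.tilingSpace) (hT' : ∀ n, T' n ∈ Φ.tilingSpace)
    {p : Plane} (h : ∀ᶠ n in (U : Filter ℕ), tilesAt (T n) p = tilesAt (T' n) p) :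
    ∃ S ∈ Φ.tilingSpace, ∃ S' ∈ Φ.tilingSpace, ∃ v : ℕ → Plane, Tendsto v U (𝓝 0) ∧
      ∀ ρ, ∀ᶠ n in (U : Filter ℕ), ∀ x, ‖x‖ < ρ →
        tilesAt (shift (T n) (v n)) x = tilesAt S x ∧
        tilesAt (shift (T' n) (v n)) x = tilesAt S' x := by
  obtain ⟨D, hD, hD'⟩ := Φ.exists_radius
  have h1 : ∀ n, ∃ (i : ι) (a : Plane), a +ᵥ Φ.proto i ∈ tilesAt (T n) p := by
    intro n
    obtain ⟨τ, hτ⟩ := (hT n).1.tilesAt_nonempty p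
    obtain ⟨i, a, rfl⟩ := tiles_of_mem (hT n) τ hτ.1
    exact ⟨i, a, hτ⟩
  -- A common tile at `p` anchors both tilings; its type is constant along the ultrafilter, and its
  -- position converges.
  choose i a ha using h1
  have h2 : ∃ j, ∀ᶠ n in (U : Filter ℕ), i n = j := by
    exact (Ultrafilter.eventually_exists_iff (f := U) (P := fun j n => i n = j)).1
      (Eventually.of_forall fun n => ⟨_, rfl⟩)
  obtain ⟨j, hj⟩ := h2
  have h3 : ∀ n, a n ∈ Metric.closedBall p D := by
    intro n
    rw [mem_closedBall_iff_norm, norm_sub_rev]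
    exact hD' _ _ (mem_vadd_support.1 (ha n).2)
  obtain ⟨b, -, hb⟩ := (isCompact_closedBall p D).ultrafilter_le_nhds (U.map a)
    (by
      rw [le_principal_iff, Ultrafilter.mem_coe, Ultrafilter.mem_map]
      exact Filter.mem_of_superset Filter.univ_mem fun n _ => h3 n)
  have hb : Tendsto a U (𝓝 b) := hb
  have hmem : ∀ᶠ n in (U : Filter ℕ), Φ.proto j ∈ shift (T n) (a n) := by
    filter_upwards [hj] with n hn
    rw [mem_shift, ← hn]
    exact (ha n).1
  have hmem' : ∀ᶠ n in (U : Filter ℕ), Φ.proto j ∈ shift (T' n) (a n) := by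
    filter_upwards [hj, h] with n hn hn'
    rw [mem_shift, ← hn]
    have := ha n
    rw [hn'] at this
    exact this.1
  obtain ⟨S, hS, hSloc⟩ := exists_local_limit hflc U (fun n => shift_mem (hT n) (a n)) j hmem
  obtain ⟨S', hS', hSloc'⟩ := exists_local_limit hflc U (fun n => shift_mem (hT' n) (a n)) j hmem'
  refine ⟨shift S (-b), shift_mem hS _, shift S' (-b), shift_mem hS' _, fun n => a n - b, ?_, ?_⟩
  · simpa using hb.sub_const b
  · intro ρ
    filter_upwards [hSloc (ρ + ‖b‖), hSloc' (ρ + ‖b‖)] with n hn hn' x hx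
    rw [ballPatch_eq_iff] at hn hn'
    have hxb : ‖x + -b‖ < ρ + ‖b‖ := (norm_add_le _ _).trans_lt (by rw [norm_neg]; linarith)
    simp only [sub_eq_add_neg]
    rw [← shift_shift, ← shift_shift, tilesAt_shift_eq_iff, tilesAt_shift_eq_iff]
    exact ⟨hn _ hxb, hn' _ hxb⟩

theorem exists_limit [Finite ι] (hflc : FLC Φ.tilingSpace) (U : Ultrafilter ℕ)
    {T : ℕ → Set (Tile M)} (hT : ∀ n, T n ∈ Φ.tilingSpace) :
    ∃ S ∈ Φ.tilingSpace, ∃ v : ℕ → Plane, Tendsto v U (𝓝 0) ∧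
      ∀ ρ, ∀ᶠ n in (U : Filter ℕ), ∀ x, ‖x‖ < ρ →
        tilesAt (shift (T n) (v n)) x = tilesAt S x := by
  obtain ⟨S, hS, _, _, v, hv, h⟩ := exists_limit_pair hflc U hT hT (p := 0)
    (Eventually.of_forall fun _ => rfl)
  exact ⟨S, hS, v, hv, fun ρ => (h ρ).mono fun n hn x hx => (hn x hx).1⟩

/-! ### Surjectivity of the substitution -/

theorem exists_mem_of_proto [Finite ι] [Nonempty ι] (hprim : Φ.Primitive) (i : ι) :
    ∃ T ∈ Φ.tilingSpace, Φ.proto i ∈ T := by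
  obtain ⟨T, hT⟩ := tilingSpace_nonempty hprim
  obtain ⟨τ, hτ⟩ := hT.1.tilesAt_nonempty 0
  obtain ⟨j, v, rfl⟩ := tiles_of_mem hT τ hτ.1
  obtain ⟨n, w, hw⟩ := hprim i j
  refine ⟨shift (Φ.apply^[n] (shift T v)) w, shift_mem (apply_iterate_mem n (shift_mem hT v)) w, ?_⟩
  rw [mem_shift]
  refine apply_iterate_mono n (Set.singleton_subset_iff.2 ?_) hw
  rw [mem_shift]
  exact hτ.1

/-- Each ball patch of `T` lies in some Φ(S_n) by the definition of the tiling space. A local limit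
of the S_n is a preimage once the translations v_n → 0 used in the limit are shown to vanish. -/
theorem apply_surj [Finite ι] [Nonempty ι] (hprim : Φ.Primitive) (hflc : FLC Φ.tilingSpace)
    {T : Set (Tile M)} (hT : T ∈ Φ.tilingSpace) : ∃ S ∈ Φ.tilingSpace, Φ.apply S = T := by
  have h1 : ∀ n : ℕ, ∃ S ∈ Φ.tilingSpace, ballPatch n T ⊆ Φ.apply S := by
    intro n
    obtain ⟨m, i, v, hm, h⟩ := hT.2 (ballPatch n T) (fun τ hτ => hτ.1) (ballPatch_finite hflc hT n)
    obtain ⟨T', hT', hi⟩ := exists_mem_of_proto hprim i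
    obtain ⟨m, rfl⟩ := Nat.exists_eq_add_of_le' hm
    refine ⟨shift (Φ.apply^[m] T') (Φ.scale⁻¹ • v), shift_mem (apply_iterate_mem m hT') _, ?_⟩
    rw [apply_shift, smul_smul, mul_inv_cancel₀ Φ.scale_ne, one_smul,
      ← Function.iterate_succ_apply' Φ.apply]
    exact h.trans (shift_mono (apply_iterate_mono _ (Set.singleton_subset_iff.2 hi)) v)
  choose S hS hsub using h1
  have hagree : ∀ (n : ℕ) (x : Plane), ‖x‖ < n → tilesAt T x = tilesAt (Φ.apply (S n)) x := by
    intro n x hx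
    refine tilesAt_eq_of_subset hT.1 (apply_mem (hS n)).1.1 (apply_tiles _) Metric.isOpen_ball
      (U := Metric.ball 0 n) (fun y hy τ hτ => ?_) (mem_ball_zero_iff.2 hx)
    exact hsub n (mem_ballPatch.2 ⟨y, mem_ball_zero_iff.1 hy, hτ⟩)
  obtain ⟨S₀, hS₀, v, hv, hloc⟩ := exists_limit hflc (hyperfilter ℕ) hS
  have hlarge : ∀ c : ℝ, ∀ᶠ n : ℕ in (hyperfilter ℕ : Filter ℕ), c < n := fun c =>
    Nat.hyperfilter_le_atTop (tendsto_natCast_atTop_atTop.eventually_gt_atTop c)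
  have hkey : ∀ x, ∀ᶠ n in (hyperfilter ℕ : Filter ℕ),
      tilesAt (shift T (Φ.scale • v n)) (Φ.scale • x) = tilesAt (Φ.apply S₀) (Φ.scale • x) := by
    intro x
    filter_upwards [hloc (‖x‖ + 1), hv.eventually (Metric.ball_mem_nhds 0 one_pos),
      hlarge (Φ.scale * (‖x‖ + 1))] with n h1 h2 h3
    rw [dist_zero_right] at h2
    have h4 := tilesAt_apply_congr (Φ := Φ) (h1 x (by linarith))
    rw [← h4, apply_shift, tilesAt_shift_eq_iff]
    apply hagree
    rw [← smul_add, norm_smul, Real.norm_of_nonneg Φ.scale_pos.le]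
    refine lt_of_le_of_lt ?_ h3
    gcongr
    · exact Φ.scale_pos.le
    · exact (norm_add_le _ _).trans (by linarith)
  obtain ⟨r, hr, hr'⟩ := Φ.exists_inradius
  have hlam := Φ.scale_pos
  have hsmall : ∀ᶠ n in (hyperfilter ℕ : Filter ℕ), ‖v n‖ < r / (2 * Φ.scale) := by
    have := hv.eventually (Metric.ball_mem_nhds 0 (ε := r / (2 * Φ.scale)) (by positivity))
    simpa [dist_zero_right] using this
  obtain ⟨n₀, h0, h0'⟩ := ((hkey 0).and hsmall).exists
  -- T - λ v_n has the same tiles at the origin for almost all n; small returns being unique, v_n is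
  -- constant, and its limit is 0.
  have hconst : ∀ᶠ n in (hyperfilter ℕ : Filter ℕ), v n = v n₀ := by
    filter_upwards [hkey 0, hsmall] with n hn hn'
    have h1 := small_return hT hr' (a := Φ.scale • v n) (b := Φ.scale • v n₀) (x := Φ.scale • 0) ?_
      (hn.trans h0.symm)
    · exact smul_right_injective _ Φ.scale_ne h1
    · rw [← smul_sub, norm_smul, Real.norm_of_nonneg hlam.le]
      have h2 := norm_sub_le (v n) (v n₀)
      rw [lt_div_iff₀ (by positivity)] at hn' h0'
      nlinarith
  have hv0 : v n₀ = 0 :=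
    tendsto_nhds_unique (tendsto_const_nhds.congr' (hconst.mono fun n hn => hn.symm)) hv
  refine ⟨S₀, hS₀, eq_of_forall_tilesAt (apply_mem hS₀) hT fun x => ?_⟩
  obtain ⟨n, h1, h2⟩ := ((hkey (Φ.scale⁻¹ • x)).and hconst).exists
  rw [h2, hv0, smul_zero, shift_zero, smul_smul, mul_inv_cancel₀ Φ.scale_ne, one_smul] at h1
  exact h1.symm

theorem apply_iterate_surj [Finite ι] [Nonempty ι] (hprim : Φ.Primitive)
    (hflc : FLC Φ.tilingSpace) (n : ℕ) {T : Set (Tile M)} (hT : T ∈ Φ.tilingSpace) :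
    ∃ S ∈ Φ.tilingSpace, Φ.apply^[n] S = T := by
  induction n generalizing T with
  | zero => exact ⟨T, hT, rfl⟩
  | succ n ih =>
    obtain ⟨S, hS, rfl⟩ := apply_surj hprim hflc hT
    obtain ⟨S', hS', rfl⟩ := ih hS
    exact ⟨S', hS', Function.iterate_succ_apply' _ _ _⟩

/-! ### Repetitivity -/

variable (Φ) in
/-- A translate of `ρ i` occurs in `Φ^n (ρ j)`. -/
def Reach (n : ℕ) (j i : ι) : Prop := ∃ v : Plane, v +ᵥ Φ.proto i ∈ Φ.apply^[n] {Φ.proto j}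

theorem reach_of_mem {n : ℕ} {j i : ι} {v w : Plane}
    (h : v +ᵥ Φ.proto i ∈ Φ.apply^[n] {w +ᵥ Φ.proto j}) : Φ.Reach n j i := by
  rw [iterate_singleton_vadd, mem_shift, vadd_vadd] at h
  exact ⟨_, h⟩

theorem Reach.exists_vadd {n : ℕ} {j i : ι} (h : Φ.Reach n j i) (w : Plane) :
    ∃ v : Plane, v +ᵥ Φ.proto i ∈ Φ.apply^[n] {w +ᵥ Φ.proto j} := by
  obtain ⟨v, hv⟩ := h
  refine ⟨Φ.scale ^ n • w + v, ?_⟩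
  rw [iterate_singleton_vadd, mem_shift, vadd_vadd, neg_add_cancel_left]
  exact hv

theorem Reach.trans {m n : ℕ} {j i k : ι} (h : Φ.Reach m j i) (h' : Φ.Reach n i k) :
    Φ.Reach (m + n) j k := by
  obtain ⟨v, hv⟩ := h
  obtain ⟨w, hw⟩ := h'.exists_vadd v
  refine ⟨w, ?_⟩
  rw [add_comm, Function.iterate_add_apply]
  exact apply_iterate_mono n (Set.singleton_subset_iff.2 hv) hw

theorem Reach.split {m n : ℕ} {j k : ι} (h : Φ.Reach (m + n) j k) :
    ∃ i, Φ.Reach m j i ∧ Φ.Reach n i k := by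
  obtain ⟨v, hv⟩ := h
  rw [add_comm, Function.iterate_add_apply, mem_apply_iterate] at hv
  obtain ⟨σ, hσ, hv⟩ := hv
  obtain ⟨i, w, rfl⟩ := (singleton_tiles j).apply_iterate m σ hσ
  exact ⟨i, ⟨w, hσ⟩, reach_of_mem hv⟩

theorem reach_zero (i : ι) : Φ.Reach 0 i i := ⟨0, by simp⟩

theorem Reach.loop {n : ℕ} {i : ι} (h : Φ.Reach n i i) (k : ℕ) : Φ.Reach (k * n) i i := by
  induction k with
  | zero => simpa using reach_zero i
  | succ k ih => rw [Nat.succ_mul]; exact ih.trans h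

theorem exists_mem_iterate (n : ℕ) (w : Plane) (j : ι) :
    ∃ (i : ι) (v : Plane), v +ᵥ Φ.proto i ∈ Φ.apply^[n] {w +ᵥ Φ.proto j} := by
  have h1 : Φ.Tiles {w +ᵥ Φ.proto j} := by rintro _ rfl; exact ⟨j, w, rfl⟩
  obtain ⟨x, hx⟩ := proto_nonempty (Φ := Φ) j
  have h2 : Φ.scale ^ n • (w + x) ∈ patchSupport (Φ.apply^[n] {w +ᵥ Φ.proto j}) := by
    rw [patchSupport_apply_iterate n h1]
    refine Set.smul_mem_smul_set (mem_patchSupport.2 ⟨_, rfl, ?_⟩)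
    rw [mem_vadd_support]; simpa
  obtain ⟨τ, hτ, -⟩ := mem_patchSupport.1 h2
  obtain ⟨i, v, rfl⟩ := h1.apply_iterate n τ hτ
  exact ⟨i, v, hτ⟩

theorem exists_common_loop [Finite ι] (hprim : Φ.Primitive) :
    ∃ q : ℕ, 0 < q ∧ ∀ i, Φ.Reach q i i := by
  have h1 : ∀ i, ∃ l : ℕ, 0 < l ∧ Φ.Reach l i i := by
    intro i
    obtain ⟨j, v, hv⟩ := exists_mem_iterate (Φ := Φ) 1 0 i
    obtain ⟨n, hn⟩ := hprim i j
    exact ⟨1 + n, by omega, (reach_of_mem hv).trans hn⟩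
  choose l hl hl' using h1
  cases nonempty_fintype ι
  refine ⟨∏ i, l i, Finset.prod_pos fun i _ => hl i, fun i => ?_⟩
  obtain ⟨k, hk⟩ := Finset.dvd_prod_of_mem l (Finset.mem_univ i)
  rw [hk, mul_comm]
  exact (hl' i).loop k

/-- Going q - 1 further times round a loop at `i` of length n + b turns the length n + b from `i` to
`j` into a multiple of q. -/
theorem reach_same_class (hprim : Φ.Primitive) {q : ℕ} (hq : 0 < q) {b : ℕ} {a i j : ι}
    (hi : Φ.Reach b a i) (hj : Φ.Reach b a j) : ∃ k, Φ.Reach (k * q) i j := by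
  obtain ⟨n, hn⟩ := hprim a i
  have hn : Φ.Reach n i a := hn
  obtain ⟨q, rfl⟩ := Nat.exists_eq_add_of_le' hq
  refine ⟨n + b, ?_⟩
  have h := ((hn.trans hi).loop q).trans (hn.trans hj)
  convert h using 1
  ring

theorem reach_class_symm (hprim : Φ.Primitive) {q : ℕ} (hq : 0 < q) {k : ℕ} {i j : ι}
    (h : Φ.Reach (k * q) j i) : ∃ l, Φ.Reach (l * q) i j := by
  obtain ⟨n, hn⟩ := hprim j i
  have hn : Φ.Reach n i j := hn
  obtain ⟨q, rfl⟩ := Nat.exists_eq_add_of_le' hq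
  refine ⟨n + q * k, ?_⟩
  have h := hn.trans ((h.trans hn).loop q)
  convert h using 1
  ring

/-- Loops of length `q` pad all connections to a common length. -/
theorem exists_uniform_reach [Finite ι] {q : ℕ} (hq : ∀ i, Φ.Reach q i i) :
    ∃ K : ℕ, ∀ j i, (∃ k, Φ.Reach (k * q) j i) → Φ.Reach (K * q) j i := by
  have h1 : ∀ p : ι × ι, ∃ k, (∃ k, Φ.Reach (k * q) p.1 p.2) → Φ.Reach (k * q) p.1 p.2 := by
    intro p
    by_cases h : ∃ k, Φ.Reach (k * q) p.1 p.2
    · obtain ⟨k, hk⟩ := h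
      exact ⟨k, fun _ => hk⟩
    · exact ⟨0, fun h' => absurd h' h⟩
  choose k hk using h1
  obtain ⟨K, hK⟩ := (Set.finite_range k).bddAbove
  refine ⟨K, fun j i h => ?_⟩
  obtain ⟨d, hd⟩ := Nat.exists_eq_add_of_le (hK ⟨(j, i), rfl⟩)
  rw [hd, add_mul]
  exact (hk (j, i) h).trans ((hq i).loop d)

/-- Primitivity as stated lets the exponent depend on the two prototiles, so a patch may occur only
in iterates from one residue class modulo a common loop length q. One occurrence of `Q` in Φ^N S
shows that `S` is in the right class, and then every supertile of level `N` contains `Q`. -/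
theorem exists_occurrence [Finite ι] (hprim : Φ.Primitive) {T₀ : Set (Tile M)}
    (hT₀ : T₀ ∈ Φ.tilingSpace) {Q : Set (Tile M)} (hQ : Q ⊆ T₀) (hfin : Q.Finite)
    (hne : Q.Nonempty) :
    ∃ N : ℕ, ∀ S ∈ Φ.tilingSpace, (∃ a, shift Q a ⊆ Φ.apply^[N] S) →
      ∀ (j : ι) (w : Plane), w +ᵥ Φ.proto j ∈ S → ∃ b, shift Q b ⊆ Φ.apply^[N] {w +ᵥ Φ.proto j} := by
  obtain ⟨q, hq, hloop⟩ := exists_common_loop hprim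
  obtain ⟨K, hK⟩ := exists_uniform_reach hloop
  obtain ⟨m, i, v, hm, hQi⟩ := hT₀.2 Q hQ hfin
  have h1 : Φ.Reach (m + (q - 1) * m) i i := by
    have h2 := (hloop i).loop m
    convert h2 using 1
    obtain ⟨q, rfl⟩ := Nat.exists_eq_add_of_le' hq
    simp
    ring
  -- Replacing the prototile `i` by a suitable `i'` turns the exponent m into the multiple m q of
  -- the loop length.
  obtain ⟨i', -, h2⟩ := h1.split
  obtain ⟨u, hu⟩ := h2
  set B := m + (q - 1) * m with hB
  have hBq : B = m * q := by
    obtain ⟨q, rfl⟩ := Nat.exists_eq_add_of_le' hq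
    rw [hB]; simp
    ring
  have hQi' : ∃ v', Q ⊆ shift (Φ.apply^[B] {Φ.proto i'}) v' := by
    refine ⟨Φ.scale ^ m • u + v, hQi.trans ?_⟩
    rw [← shift_shift]
    refine shift_mono ?_ v
    have h3 := apply_iterate_mono (Φ := Φ) m (Set.singleton_subset_iff.2 hu)
    rw [iterate_singleton_vadd, ← Function.iterate_add_apply, ← hB] at h3
    have h4 := shift_mono h3 (Φ.scale ^ m • u)
    rwa [shift_shift, neg_add_cancel, shift_zero] at h4
  obtain ⟨v', hQi'⟩ := hQi'
  refine ⟨B + K * q, fun S hS ⟨a, ha⟩ j w hjw => ?_⟩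
  obtain ⟨τ, hτ⟩ := hne
  obtain ⟨l, x, rfl⟩ := tiles_of_mem hT₀ τ (hQ hτ)
  have hil : Φ.Reach (m * q) i' l := by
    have h3 := hQi' hτ
    rw [mem_shift, vadd_vadd, hBq] at h3
    exact ⟨_, h3⟩
  obtain ⟨l', x', hl'⟩ := exists_mem_iterate (Φ := Φ) (B + K * q) w j
  have hT := apply_iterate_mem (B + K * q) hS
  have hl'T := apply_iterate_mono (B + K * q) (Set.singleton_subset_iff.2 hjw) hl'
  have hlT : (-a + x) +ᵥ Φ.proto l ∈ Φ.apply^[B + K * q] S := by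
    refine ha ?_
    rw [mem_shift, vadd_vadd, add_neg_cancel_left]
    exact hτ
  -- Both tiles lie in one iterate of one prototile, so they belong to the same residue class.
  have hcls : ∃ k, Φ.Reach (k * q) l' l := by
    obtain ⟨m', i'', y, -, hy⟩ := hT.2 {x' +ᵥ Φ.proto l', (-a + x) +ᵥ Φ.proto l}
      (by rintro _ (rfl | rfl) <;> assumption) (Set.toFinite _)
    have h3 := mem_shift.1 (hy (Set.mem_insert _ _))
    have h4 := mem_shift.1 (hy (Set.mem_insert_of_mem _ rfl))
    rw [vadd_vadd] at h3 h4
    exact reach_same_class hprim hq ⟨_, h3⟩ ⟨_, h4⟩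
  have hji' : Φ.Reach (K * q) j i' := by
    refine hK j i' ?_
    obtain ⟨k₁, hk₁⟩ := hcls
    obtain ⟨k₂, hk₂⟩ := reach_class_symm hprim hq hil
    refine ⟨m + K + k₁ + k₂, ?_⟩
    have h3 := ((reach_of_mem hl').trans hk₁).trans hk₂
    convert h3 using 1
    rw [hBq]; ring
  obtain ⟨y, hy⟩ := hji'.exists_vadd w
  refine ⟨-(Φ.scale ^ B • y) - v', ?_⟩
  rw [Function.iterate_add_apply]
  refine subset_trans ?_ (apply_iterate_mono B (Set.singleton_subset_iff.2 hy))
  rw [iterate_singleton_vadd]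
  have h3 := shift_mono hQi' (-(Φ.scale ^ B • y) - v')
  rwa [shift_shift, add_sub_cancel] at h3

/-- Repetitivity: all patches of radius `ρ` of a tiling recur in it with uniformly bounded gaps. -/
theorem repetitive [Finite ι] [Nonempty ι] (hprim : Φ.Primitive) (hflc : FLC Φ.tilingSpace)
    (ρ : ℝ) : ∃ R : ℝ, ∀ T ∈ Φ.tilingSpace, ∀ y c : Plane, ∃ z : Plane, ‖z - c‖ ≤ R ∧
      ∀ x, ‖x‖ < ρ → tilesAt (shift T y) x = tilesAt (shift T z) x := by
  suffices H : ∀ ρ : ℝ, 0 < ρ → ∃ R : ℝ, ∀ T ∈ Φ.tilingSpace, ∀ y c : Plane, ∃ z : Plane,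
      ‖z - c‖ ≤ R ∧ ∀ x, ‖x‖ < ρ → tilesAt (shift T y) x = tilesAt (shift T z) x by
    obtain ⟨R, hR⟩ := H (max ρ 1) (by positivity)
    refine ⟨R, fun T hT y c => ?_⟩
    obtain ⟨z, hz, hz'⟩ := hR T hT y c
    exact ⟨z, hz, fun x hx => hz' x (hx.trans_le (le_max_left _ _))⟩
  intro ρ hρ
  obtain ⟨D, hD, hD'⟩ := Φ.exists_radius
  obtain ⟨𝓕, h𝓕, h⟩ := hflc (2 * (ρ + 2 * D))
  have h1 : ∀ Q : Set (Tile M), ∃ N : ℕ, ∀ T₀ ∈ Φ.tilingSpace, Q ⊆ T₀ → Q.Finite → Q.Nonempty →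
      ∀ S ∈ Φ.tilingSpace, (∃ a, shift Q a ⊆ Φ.apply^[N] S) →
      ∀ (j : ι) (w : Plane), w +ᵥ Φ.proto j ∈ S →
        ∃ b, shift Q b ⊆ Φ.apply^[N] {w +ᵥ Φ.proto j} := by
    intro Q
    by_cases hQ : ∃ T₀ ∈ Φ.tilingSpace, Q ⊆ T₀ ∧ Q.Finite ∧ Q.Nonempty
    · obtain ⟨T₀, hT₀, h1, h2, h3⟩ := hQ
      obtain ⟨N, hN⟩ := exists_occurrence hprim hT₀ h1 h2 h3
      exact ⟨N, fun _ _ _ _ _ => hN⟩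
    · exact ⟨0, fun T₀ hT₀ h1 h2 h3 => absurd ⟨T₀, hT₀, h1, h2, h3⟩ hQ⟩
  choose N hN using h1
  -- `R` bounds the diameters of the supertiles that are needed for the finitely many patch classes.
  obtain ⟨R, hR⟩ := (h𝓕.image fun Q => Φ.scale ^ N Q * (2 * D)).bddAbove
  refine ⟨R, fun T hT y c => ?_⟩
  have hTy := shift_mem hT y
  obtain ⟨Q, hQ, a, ha⟩ := h _ hTy (ballPatch ρ (shift T y)) (fun τ hτ => hτ.1) (by
      intro x hx y hy
      obtain ⟨σ, hσ, hx⟩ := mem_patchSupport.1 hx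
      obtain ⟨τ, hτ, hy⟩ := mem_patchSupport.1 hy
      have h1 := norm_le_of_mem_ballPatch hD' (tiles_of_mem hTy) hσ hx
      have h2 := norm_le_of_mem_ballPatch hD' (tiles_of_mem hTy) hτ hy
      rw [dist_eq_norm]
      exact (norm_sub_le _ _).trans (by linarith))
  have hQP : Q = shift (ballPatch ρ (shift T y)) a := by rw [ha, shift, neg_vadd_vadd]
  obtain ⟨τ, hτ⟩ := hTy.1.tilesAt_nonempty 0
  have hτP : τ ∈ ballPatch ρ (shift T y) := mem_ballPatch.2 ⟨0, by simpa using hρ, hτ⟩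
  -- Desubstituting `N Q` times exhibits a supertile of `T` over `c`; it contains a copy of the
  -- patch.
  obtain ⟨S, hS, hST⟩ := apply_iterate_surj hprim hflc (N Q) hT
  have hLpos := scale_pow_pos (Φ := Φ) (N Q)
  obtain ⟨σ, hσ⟩ := hS.1.tilesAt_nonempty ((Φ.scale ^ N Q)⁻¹ • c)
  obtain ⟨j, w, rfl⟩ := tiles_of_mem hS σ hσ.1
  have hQT : shift Q (-a - y) ⊆ T := by
    rw [hQP, shift_shift, show a + (-a - y) = -y by abel]
    have h2 := shift_mono (show ballPatch ρ (shift T y) ⊆ shift T y from fun τ hτ => hτ.1) (-y)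
    rw [shift_shift, add_neg_cancel, shift_zero] at h2
    simpa using h2
  obtain ⟨b, hb⟩ := hN Q (shift (shift T y) a) (shift_mem hTy a)
    (by rw [hQP]; exact shift_mono (fun τ hτ => hτ.1) a)
    (by rw [hQP]; exact (ballPatch_finite hflc hTy ρ).vadd_set)
    (by rw [hQP]; exact ⟨-a +ᵥ τ, mem_shift.2 (by simpa using hτP)⟩)
    S hS ⟨-a - y, by rw [hST]; exact hQT⟩ j w hσ.1
  have hsub : ballPatch ρ (shift T y) ⊆ shift (Φ.apply^[N Q] {w +ᵥ Φ.proto j}) (-(a + b)) := by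
    have h2 := shift_mono hb (-(a + b))
    rwa [shift_shift, show b + -(a + b) = -a by abel, shift, neg_neg, ← ha] at h2
  have hjT : Φ.apply^[N Q] {w +ᵥ Φ.proto j} ⊆ T := by
    rw [← hST]
    exact apply_iterate_mono _ (Set.singleton_subset_iff.2 hσ.1)
  refine ⟨-(a + b), ?_, fun x hx => ?_⟩
  · set z := -(a + b) with hz
    have h3 : z ∈ patchSupport (Φ.apply^[N Q] {w +ᵥ Φ.proto j}) := by
      refine mem_patchSupport.2 ⟨_, mem_shift.1 (hsub hτP), ?_⟩
      rw [mem_vadd_support, sub_self]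
      exact hτ.2
    rw [patchSupport_apply_iterate _ (by rintro _ rfl; exact ⟨j, w, rfl⟩),
      Set.mem_smul_set_iff_inv_smul_mem₀ hLpos.ne', mem_patchSupport] at h3
    obtain ⟨_, rfl, h3⟩ := h3
    have h4 := hD' j _ (mem_vadd_support.1 h3)
    have h5 := hD' j _ (mem_vadd_support.1 hσ.2)
    have h6 : z - c = Φ.scale ^ N Q • (((Φ.scale ^ N Q)⁻¹ • z - w) - ((Φ.scale ^ N Q)⁻¹ • c - w)) := by
      rw [sub_sub_sub_cancel_right, smul_sub, smul_smul, smul_smul, mul_inv_cancel₀ hLpos.ne',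
        one_smul, one_smul]
    rw [h6, norm_smul, Real.norm_of_nonneg hLpos.le]
    refine le_trans (b := Φ.scale ^ N Q * (2 * D)) ?_ (hR ⟨Q, hQ, rfl⟩)
    gcongr
    exact (norm_sub_le _ _).trans (by linarith)
  · have h2 := shift_mem hT (-(a + b))
    refine tilesAt_eq_of_subset hTy.1 h2.1.1 (tiles_of_mem h2) Metric.isOpen_ball
      (U := Metric.ball 0 ρ) (fun y' hy' τ' hτ' => ?_) (mem_ball_zero_iff.2 hx)
    exact shift_mono hjT _ (hsub (mem_ballPatch.2 ⟨y', mem_ball_zero_iff.1 hy', hτ'⟩))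

/-! ### Uniformity of eventual agreement -/

theorem shift_comm (A : Set (Tile M)) (a b : Plane) :
    shift (shift A a) b = shift (shift A b) a := by
  rw [shift_shift, shift_shift, add_comm]

/-- By repetitivity each patch of radius 2 has a copy near the origin. A short local period of Φ^m T
on a large enough ball is therefore a global one. The radius is independent of `m`, as repetitivity
is applied to `T` before substituting. -/
theorem exists_local_period_bound [Finite ι] [Nonempty ι] (hprim : Φ.Primitive)
    (hflc : FLC Φ.tilingSpace) (hper : NonPeriodic Φ.tilingSpace) :
    ∃ R : ℝ, 0 < R ∧ ∀ T ∈ Φ.tilingSpace, ∀ (m : ℕ) (w : Plane), ‖w‖ ≤ 1 →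
      (∀ x, ‖x‖ < R → tilesAt (Φ.apply^[m] T) (Φ.scale ^ m • x) =
        tilesAt (Φ.apply^[m] (shift T w)) (Φ.scale ^ m • x)) → w = 0 := by
  obtain ⟨R, hR⟩ := repetitive hprim hflc 2
  refine ⟨max R 0 + 1, by positivity, fun T hT m w hw h => ?_⟩
  have hY := apply_iterate_mem m hT
  have hall : ∀ y, tilesAt (Φ.apply^[m] T) (Φ.scale ^ m • y) =
      tilesAt (shift (Φ.apply^[m] T) (Φ.scale ^ m • w)) (Φ.scale ^ m • y) := by
    intro y
    obtain ⟨z, hz, hz'⟩ := hR T hT y 0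
    rw [sub_zero] at hz
    have h0 := tilesAt_iterate_congr (Φ := Φ) m (hz' 0 (by simp))
    have h1 := tilesAt_iterate_congr (Φ := Φ) m (hz' w (by linarith))
    have h2 := h z (by linarith [le_max_left R 0])
    rw [apply_iterate_shift, apply_iterate_shift, tilesAt_shift, tilesAt_shift, smul_zero, zero_add,
      zero_add] at h0
    rw [apply_iterate_shift, apply_iterate_shift, tilesAt_shift, tilesAt_shift] at h1
    rw [apply_iterate_shift, tilesAt_shift] at h2
    rw [tilesAt_shift]
    apply shift_injective (Φ.scale ^ m • y)
    dsimp only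
    rw [h0, h2, add_comm (Φ.scale ^ m • z), add_comm (Φ.scale ^ m • y), shift_comm, ← h1,
      shift_comm]
  have heq := eq_of_forall_tilesAt hY (shift_mem hY (Φ.scale ^ m • w)) fun x => by
    have := hall ((Φ.scale ^ m)⁻¹ • x)
    rwa [smul_smul, mul_inv_cancel₀ (scale_pow_pos m).ne', one_smul] at this
  have := hper _ hY _ heq.symm
  exact (smul_eq_zero.1 this).resolve_left (scale_pow_pos m).ne'

/-- Pairs that violate every K have limits S, S'. For most n, S - (v'_n - v_n) and S' agree on a
large ball after substitution. Two such offsets differ by a short local period, hence are equal, so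
the waiting time of one pair serves for all of them. -/
theorem exists_uniform_agree_zero [Finite ι] [Nonempty ι] (hprim : Φ.Primitive)
    (hflc : FLC Φ.tilingSpace) (hper : NonPeriodic Φ.tilingSpace) :
    ∃ (R : ℝ) (K : ℕ), 0 < R ∧ ∀ T ∈ Φ.tilingSpace, ∀ T' ∈ Φ.tilingSpace,
      (∀ x, ‖x‖ < R → Φ.Asy T T' x) → tilesAt (Φ.apply^[K] T) 0 = tilesAt (Φ.apply^[K] T') 0 := by
  obtain ⟨R, hR, hper'⟩ := exists_local_period_bound hprim hflc hper
  by_contra! hcon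
  have h1 := fun K => hcon (R + 4) K (by linarith)
  choose T hT T' hT' hasy hne using h1
  obtain ⟨S, hS, v, hv, hloc⟩ := exists_limit hflc (hyperfilter ℕ) hT
  obtain ⟨S', hS', v', hv', hloc'⟩ := exists_limit hflc (hyperfilter ℕ) hT'
  have hm : ∀ n, ∃ m : ℕ, ∀ x, ‖x‖ ≤ R + 3 → tilesAt (Φ.apply^[m] (T n)) (Φ.scale ^ m • x) =
      tilesAt (Φ.apply^[m] (T' n)) (Φ.scale ^ m • x) := by
    intro n
    obtain ⟨m, hm⟩ := exists_uniform_agree hflc (hT n) (hT' n)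
      (isCompact_closedBall (0 : Plane) (R + 3)) fun x hx => hasy n x (by
        rw [mem_closedBall_zero_iff] at hx; linarith)
    exact ⟨m, fun x hx => hm x (mem_closedBall_zero_iff.2 hx)⟩
  choose m hm using hm
  set G : ℕ → Prop := fun n => ‖v n‖ < 1 / 4 ∧ ‖v' n‖ < 1 / 4 ∧
    (∀ x, ‖x‖ < R + 5 → tilesAt (shift (T n) (v n)) x = tilesAt S x) ∧
    (∀ x, ‖x‖ < R + 5 → tilesAt (shift (T' n) (v' n)) x = tilesAt S' x) with hG
  have hGev : ∀ᶠ n in (hyperfilter ℕ : Filter ℕ), G n := by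
    have e1 := hv.eventually (Metric.ball_mem_nhds 0 (ε := 1 / 4) (by norm_num))
    have e2 := hv'.eventually (Metric.ball_mem_nhds 0 (ε := 1 / 4) (by norm_num))
    filter_upwards [e1, e2, hloc (R + 5), hloc' (R + 5)] with n h1 h2 h3 h4
    exact ⟨by simpa [dist_zero_right] using h1, by simpa [dist_zero_right] using h2, h3, h4⟩
  have hS1 : ∀ n, G n → ∀ (k : ℕ) (x : Plane), ‖x‖ < R + 2 →
      tilesAt (Φ.apply^[k] (shift S (v' n - v n))) (Φ.scale ^ k • x) =
        tilesAt (Φ.apply^[k] (shift (T n) (v' n))) (Φ.scale ^ k • x) := by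
    rintro n ⟨g1, g2, g3, g4⟩ k x hx
    apply tilesAt_iterate_congr
    have : ‖x + (v' n - v n)‖ < R + 5 := by
      calc _ ≤ ‖x‖ + (‖v' n‖ + ‖v n‖) := (norm_add_le _ _).trans (by gcongr; exact norm_sub_le _ _)
        _ < _ := by linarith
    have h2 := (tilesAt_shift_eq_iff (v := v' n - v n)).2 (g3 _ this)
    rw [shift_shift, add_sub_cancel] at h2
    exact h2.symm
  have hS2 : ∀ n, G n → ∀ (k : ℕ) (x : Plane), ‖x‖ < R + 2 →
      tilesAt (Φ.apply^[k] S') (Φ.scale ^ k • x) =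
        tilesAt (Φ.apply^[k] (shift (T' n) (v' n))) (Φ.scale ^ k • x) := by
    rintro n ⟨g1, g2, g3, g4⟩ k x hx
    apply tilesAt_iterate_congr
    exact (g4 x (by linarith)).symm
  have hS3 : ∀ n, G n → ∀ (k : ℕ), m n ≤ k → ∀ x, ‖x‖ < R + 2 →
      tilesAt (Φ.apply^[k] (shift S (v' n - v n))) (Φ.scale ^ k • x) =
        tilesAt (Φ.apply^[k] S') (Φ.scale ^ k • x) := by
    intro n hn k hk x hx
    rw [hS1 n hn k x hx, hS2 n hn k x hx, apply_iterate_shift, apply_iterate_shift,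
      tilesAt_shift_eq_iff, ← smul_add]
    refine agree_mono hk (hm n _ ?_)
    exact (norm_add_le _ _).trans (by linarith [hn.2.1])
  have hconst : ∀ n₁ n₂, G n₁ → G n₂ → v' n₁ - v n₁ = v' n₂ - v n₂ := by
    intro n₁ n₂ h1 h2
    have hw : v' n₂ - v n₂ - (v' n₁ - v n₁) = 0 := by
      refine hper' (shift S (v' n₁ - v n₁)) (shift_mem hS _) (max (m n₁) (m n₂)) _ ?_ fun x hx => ?_
      · calc _ ≤ (‖v' n₂‖ + ‖v n₂‖) + (‖v' n₁‖ + ‖v n₁‖) :=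
            (norm_sub_le _ _).trans (add_le_add (norm_sub_le _ _) (norm_sub_le _ _))
          _ ≤ 1 := by linarith [h1.1, h1.2.1, h2.1, h2.2.1]
      · rw [shift_shift, add_sub_cancel, hS3 n₁ h1 _ (le_max_left _ _) x (by linarith),
          hS3 n₂ h2 _ (le_max_right _ _) x (by linarith)]
    exact (sub_eq_zero.1 hw).symm
  obtain ⟨n₁, h1⟩ := hGev.exists
  -- The n-th pair was chosen to disagree after `n` steps, which is impossible for n ≥ m(n₁).
  obtain ⟨n, hn, hnm⟩ := (hGev.and (Nat.hyperfilter_le_atTop (eventually_ge_atTop (m n₁)))).exists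
  refine hne n ?_
  have hx : ‖-v' n‖ < R + 2 := by rw [norm_neg]; linarith [hn.2.1]
  have h2 := hS3 n₁ h1 n hnm (-v' n) hx
  rw [hconst n₁ n h1 hn, hS1 n hn n _ hx, hS2 n hn n _ hx, apply_iterate_shift, apply_iterate_shift,
    tilesAt_shift_eq_iff, ← smul_add, neg_add_cancel, smul_zero] at h2
  exact h2

/-- Two tilings that eventually agree at all points of a ball of radius `r` agree at its centre
after a number of substitutions that depends only on `r`. -/
theorem exists_uniform_step [Finite ι] [Nonempty ι] (hprim : Φ.Primitive)
    (hflc : FLC Φ.tilingSpace) (hper : NonPeriodic Φ.tilingSpace) {r : ℝ} (hr : 0 < r) :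
    ∃ K : ℕ, ∀ T ∈ Φ.tilingSpace, ∀ T' ∈ Φ.tilingSpace, ∀ c : Plane,
      (∀ x, ‖x - c‖ < r → Φ.Asy T T' x) →
      tilesAt (Φ.apply^[K] T) (Φ.scale ^ K • c) = tilesAt (Φ.apply^[K] T') (Φ.scale ^ K • c) := by
  obtain ⟨R, K, hR, hK⟩ := exists_uniform_agree_zero hprim hflc hper
  -- Substituting `j` times inflates the radius r beyond R.
  obtain ⟨j, hj⟩ := pow_unbounded_of_one_lt (R / r) Φ.one_lt_scale
  rw [div_lt_iff₀ hr] at hj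
  refine ⟨K + j, fun T hT T' hT' c h => ?_⟩
  have h1 := hK _ (apply_iterate_mem j (shift_mem hT c)) _ (apply_iterate_mem j (shift_mem hT' c))
    fun x hx => by
      rw [asy_iterate', asy_shift]
      apply h
      rw [add_sub_cancel_right, norm_smul, norm_inv, Real.norm_of_nonneg (scale_pow_pos j).le,
        inv_mul_lt_iff₀ (scale_pow_pos j)]
      linarith
  rwa [← Function.iterate_add_apply, ← Function.iterate_add_apply, apply_iterate_shift,
    apply_iterate_shift, tilesAt_shift_eq_iff, zero_add] at h1

/-- The waiting time is uniform over the plane, so some Φ^K T has an exact period. -/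
theorem eq_zero_of_forall_asy [Finite ι] [Nonempty ι] (hprim : Φ.Primitive)
    (hflc : FLC Φ.tilingSpace) (hper : NonPeriodic Φ.tilingSpace) {T : Set (Tile M)}
    (hT : T ∈ Φ.tilingSpace) {w : Plane} (h : ∀ x, Φ.Asy T (shift T w) x) : w = 0 := by
  obtain ⟨K, hK⟩ := exists_uniform_step hprim hflc hper one_pos
  have hY := apply_iterate_mem K hT
  have h1 : shift (Φ.apply^[K] T) (Φ.scale ^ K • w) = Φ.apply^[K] T := by
    refine eq_of_forall_tilesAt (shift_mem hY _) hY fun x => ?_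
    have h2 := hK T hT _ (shift_mem hT w) ((Φ.scale ^ K)⁻¹ • x) fun y _ => h y
    rw [smul_smul, mul_inv_cancel₀ (scale_pow_pos K).ne', one_smul, apply_iterate_shift] at h2
    exact h2.symm
  exact (smul_eq_zero.1 (hper _ hY _ h1)).resolve_left (scale_pow_pos K).ne'

/-- Limits of pairs of tilings, with the sets of points of eventual agreement under control. -/
theorem exists_limit_asy [Finite ι] [Nonempty ι] (hprim : Φ.Primitive)
    (hflc : FLC Φ.tilingSpace) (hper : NonPeriodic Φ.tilingSpace) {T T' : ℕ → Set (Tile M)}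
    (hT : ∀ n, T n ∈ Φ.tilingSpace) (hT' : ∀ n, T' n ∈ Φ.tilingSpace) {p₀ : Plane} {δ₀ : ℝ}
    (hδ₀ : 0 < δ₀) (h₀ : ∀ᶠ n in atTop, ∀ x, ‖x - p₀‖ < δ₀ → Φ.Asy (T n) (T' n) x) :
    ∃ S ∈ Φ.tilingSpace, ∃ S' ∈ Φ.tilingSpace,
      (∀ p, (∃ δ > 0, ∀ᶠ n in atTop, ∀ x, ‖x - p‖ < δ → Φ.Asy (T n) (T' n) x) → Φ.Asy S S' p) ∧
      ∀ p, (∀ᶠ n in atTop, ¬ Φ.Asy (T n) (T' n) p) → ¬ Φ.Asy S S' p := by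
  obtain ⟨K, hK⟩ := exists_uniform_step hprim hflc hper hδ₀
  have hLpos := scale_pow_pos (Φ := Φ) K
  -- Limits are taken after `K` substitutions, where the pairs share a tile that anchors them
  -- simultaneously; surjectivity then brings the limits back.
  obtain ⟨S₁, hS₁, S₁', hS₁', v, hv, hloc⟩ := exists_limit_pair hflc (hyperfilter ℕ)
    (fun n => apply_iterate_mem K (hT n)) (fun n => apply_iterate_mem K (hT' n))
    (p := Φ.scale ^ K • p₀) (Nat.hyperfilter_le_atTop
      (h₀.mono fun n hn => hK _ (hT n) _ (hT' n) p₀ hn))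
  obtain ⟨S, hS, rfl⟩ := apply_iterate_surj hprim hflc K hS₁
  obtain ⟨S', hS', rfl⟩ := apply_iterate_surj hprim hflc K hS₁'
  have key : ∀ x : Plane, ∀ᶠ n in (hyperfilter ℕ : Filter ℕ), ∀ y, ‖y - x‖ < 1 →
      (Φ.Asy S S' y ↔ Φ.Asy (T n) (T' n) (y + (Φ.scale ^ K)⁻¹ • v n)) := by
    intro x
    filter_upwards [hloc (Φ.scale ^ K * (‖x‖ + 1))] with n hn y hy
    have h1 : ‖Φ.scale ^ K • y‖ < Φ.scale ^ K * (‖x‖ + 1) := by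
      rw [norm_smul, Real.norm_of_nonneg hLpos.le]
      gcongr
      calc ‖y‖ = ‖x + (y - x)‖ := by rw [add_sub_cancel]
        _ < _ := (norm_add_le _ _).trans_lt (by linarith)
    rw [← asy_iterate K, ← asy_congr (hn _ h1).1 (hn _ h1).2, asy_shift, asy_iterate', smul_add,
      smul_smul, inv_mul_cancel₀ hLpos.ne', one_smul]
  have hv' : Tendsto (fun n => (Φ.scale ^ K)⁻¹ • v n) (hyperfilter ℕ) (𝓝 0) := by
    simpa using hv.const_smul ((Φ.scale ^ K)⁻¹)
  have hsmall : ∀ ε > 0, ∀ᶠ n in (hyperfilter ℕ : Filter ℕ), ‖(Φ.scale ^ K)⁻¹ • v n‖ < ε := by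
    intro ε hε
    simpa only [dist_zero_right] using (Metric.tendsto_nhds.1 hv') ε hε
  refine ⟨S, hS, S', hS', ?_, ?_⟩
  · rintro p ⟨δ, hδ, hp⟩
    obtain ⟨n, h1, h2, h3⟩ :=
      ((key p).and ((hsmall δ hδ).and (Nat.hyperfilter_le_atTop hp))).exists
    rw [h1 p (by simp)]
    exact h3 _ (by rwa [add_sub_cancel_left])
  · intro p hp hasy
    obtain ⟨ε, hε, hball⟩ := Metric.isOpen_iff.1 (isOpen_asy hflc hS hS') p hasy
    obtain ⟨n, h1, h2, h3⟩ := ((key p).and ((hsmall (min ε 1) (by positivity)).and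
      (Nat.hyperfilter_le_atTop hp))).exists
    refine h3 ?_
    have h4 : ‖p - (Φ.scale ^ K)⁻¹ • v n - p‖ < min ε 1 := by
      rwa [sub_sub_cancel_left, norm_neg]
    have h5 := (h1 _ (h4.trans_le (min_le_right _ _))).1 (hball (by
      rw [Metric.mem_ball, dist_eq_norm]; exact h4.trans_le (min_le_left _ _)))
    rwa [sub_add_cancel] at h5

/-! ### Branch pairs from tangent balls -/

variable (Φ) in
/-- `T` and `T'` do not eventually agree at the origin, but they do at all points of the open
half-plane with inner normal `u`. -/
def BranchAt (T T' : Set (Tile M)) (u : Plane) : Prop :=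
  T ∈ Φ.tilingSpace ∧ T' ∈ Φ.tilingSpace ∧ ¬ Φ.Asy T T' 0 ∧ ∀ x : Plane, 0 < ⟪x, u⟫ → Φ.Asy T T' x

theorem norm_sub_lt_norm_iff {x u : Plane} : ‖x - u‖ < ‖u‖ ↔ ‖x‖ ^ 2 < 2 * ⟪x, u⟫ := by
  rw [← pow_lt_pow_iff_left₀ (norm_nonneg _) (norm_nonneg _) two_ne_zero, norm_sub_sq_real]
  constructor <;> intro h <;> linarith

/-- Near the origin the ball about `u` fills the half-plane ⟪x, u⟫ > 0: after scaling by s = λ⁻ⁿ,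
the quadratic term s²‖x‖² is beaten by the linear term 2s⟪x, u⟫. -/
theorem eventually_smul_near {u p : Plane} (hp : 0 < ⟪p, u⟫) :
    ∃ δ > 0, ∀ᶠ n : ℕ in atTop, ∀ x, ‖x - p‖ < δ →
      ‖(Φ.scale ^ n)⁻¹ • x - u‖ < ‖u‖ := by
  have hu : 0 < ‖u‖ := by
    rw [norm_pos_iff]; rintro rfl; simp at hp
  refine ⟨min 1 (⟪p, u⟫ / (2 * ‖u‖)), by positivity, ?_⟩
  have h1 : Tendsto (fun n : ℕ => (Φ.scale ^ n)⁻¹ * (‖p‖ + 1) ^ 2) atTop (𝓝 (0 * (‖p‖ + 1) ^ 2)) :=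
    (tendsto_inv_atTop_zero.comp (tendsto_pow_atTop_atTop_of_one_lt Φ.one_lt_scale)).mul_const _
  rw [zero_mul] at h1
  filter_upwards [h1.eventually (gt_mem_nhds hp)] with n hn x hx
  have hL := scale_pow_pos (Φ := Φ) n
  rw [norm_sub_lt_norm_iff, norm_smul, norm_inv, Real.norm_of_nonneg hL.le, real_inner_smul_left]
  have h2 : ‖x‖ ≤ ‖p‖ + 1 := by
    have : x = p + (x - p) := by abel
    rw [this]
    exact (norm_add_le _ _).trans (by linarith [hx.trans_le (min_le_left _ _)])
  have h3 : ⟪p, u⟫ / 2 ≤ ⟪x, u⟫ := by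
    have h4 : |⟪x - p, u⟫| ≤ ‖x - p‖ * ‖u‖ := abs_real_inner_le_norm _ _
    rw [inner_sub_left] at h4
    have h5 := hx.trans_le (min_le_right _ _)
    rw [lt_div_iff₀ (by positivity)] at h5
    have := (abs_le.1 h4).1
    linarith
  have h4 : (Φ.scale ^ n)⁻¹ * ‖x‖ ^ 2 ≤ (Φ.scale ^ n)⁻¹ * (‖p‖ + 1) ^ 2 := by gcongr
  have h5 : (Φ.scale ^ n)⁻¹ * ‖x‖ ^ 2 < 2 * ⟪x, u⟫ := by linarith
  calc ((Φ.scale ^ n)⁻¹ * ‖x‖) ^ 2 = (Φ.scale ^ n)⁻¹ * ((Φ.scale ^ n)⁻¹ * ‖x‖ ^ 2) := by ring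
    _ < (Φ.scale ^ n)⁻¹ * (2 * ⟪x, u⟫) := by gcongr
    _ = _ := by ring

/-- Zooming in at the origin turns tangent balls of eventual agreement into half-planes. -/
theorem exists_branchAt_of_tangent [Finite ι] [Nonempty ι] (hprim : Φ.Primitive)
    (hflc : FLC Φ.tilingSpace) (hper : NonPeriodic Φ.tilingSpace) {T T' : Set (Tile M)}
    (hT : T ∈ Φ.tilingSpace) (hT' : T' ∈ Φ.tilingSpace) (h0 : ¬ Φ.Asy T T' 0) {𝒰 : Set Plane}
    (hne : ∃ u ∈ 𝒰, u ≠ 0) (h : ∀ u ∈ 𝒰, ∀ x, ‖x - u‖ < ‖u‖ → Φ.Asy T T' x) :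
    ∃ S S' : Set (Tile M), ∀ u ∈ 𝒰, Φ.BranchAt S S' u := by
  obtain ⟨u₀, hu₀, hu₀ne⟩ := hne
  obtain ⟨δ₀, hδ₀, hev⟩ := eventually_smul_near (Φ := Φ) (real_inner_self_pos.2 hu₀ne)
  obtain ⟨S, hS, S', hS', ha, hb⟩ := exists_limit_asy hprim hflc hper
    (fun n => apply_iterate_mem n hT) (fun n => apply_iterate_mem n hT') hδ₀
    (hev.mono fun n hn x hx => (asy_iterate' n).2 (h u₀ hu₀ _ (hn x hx)))
  refine ⟨S, S', fun u hu => ⟨hS, hS', hb 0 (Eventually.of_forall fun n => ?_), fun p hp => ?_⟩⟩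
  · rwa [asy_iterate', smul_zero]
  · obtain ⟨δ, hδ, hev'⟩ := eventually_smul_near (Φ := Φ) hp
    exact ha p ⟨δ, hδ, hev'.mono fun n hn x hx => (asy_iterate' n).2 (h u hu _ (hn x hx))⟩

/-- If the normals of all branch pairs point in the direction of `e`, then eventual agreement
propagates in that direction. -/
theorem asy_add_smul [Finite ι] [Nonempty ι] (hprim : Φ.Primitive)
    (hflc : FLC Φ.tilingSpace) (hper : NonPeriodic Φ.tilingSpace) {e : Plane}
    (he : ∀ S S' u, u ≠ 0 → Φ.BranchAt S S' u → 0 ≤ ⟪u, e⟫) {T T' : Set (Tile M)}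
    (hT : T ∈ Φ.tilingSpace) (hT' : T' ∈ Φ.tilingSpace) {c : Plane} (hc : Φ.Asy T T' c) {t₀ : ℝ}
    (ht₀ : 0 ≤ t₀) : Φ.Asy T T' (c + t₀ • e) := by
  by_contra hcon
  have hopen := isOpen_asy hflc hT hT'
  have ht₀' : 0 < t₀ := by
    refine lt_of_le_of_ne ht₀ ?_
    rintro rfl
    simp [hc] at hcon
  obtain ⟨r', hr', hball⟩ := Metric.isOpen_iff.1 hopen c hc
  set r := r' / 2 with hr
  have hr0 : 0 < r := by positivity
  -- A disc with centre c + s e and radius r - ε s moves along `e`. It shrinks slowly enough to keep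
  -- radius r/2 at the final time.
  set ε := r / (2 * t₀) with hε
  have hε0 : 0 < ε := by positivity
  have hεt : ε * t₀ = r / 2 := by rw [hε]; field_simp
  set Q : Set (ℝ × Plane) := {p | p.1 ∈ Set.Icc 0 t₀ ∧ ¬ Φ.Asy T T' p.2 ∧
    ‖p.2 - c - p.1 • e‖ ≤ r - ε * p.1} with hQ
  have hQc : IsCompact Q := by
    refine ((isCompact_Icc (a := (0 : ℝ)) (b := t₀)).prod
      (isCompact_closedBall c (r + t₀ * ‖e‖))).of_isClosed_subset ?_ ?_
    · refine IsClosed.inter (isClosed_Icc.preimage continuous_fst) (IsClosed.inter ?_ ?_)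
      · exact (hopen.preimage continuous_snd).isClosed_compl
      · exact isClosed_le (f := fun p : ℝ × Plane => ‖p.2 - c - p.1 • e‖)
          (g := fun p => r - ε * p.1) (by fun_prop) (by fun_prop)
    · rintro ⟨t, x⟩ ⟨ht, -, hx⟩
      refine ⟨ht, ?_⟩
      rw [mem_closedBall_iff_norm]
      have h1 : x - c = (x - c - t • e) + t • e := by abel
      have h2 : 0 ≤ ε * t := mul_nonneg hε0.le ht.1
      calc ‖x - c‖ ≤ ‖x - c - t • e‖ + ‖t • e‖ := (congrArg norm h1).trans_le (norm_add_le _ _)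
        _ ≤ r + t₀ * ‖e‖ := by
          rw [norm_smul, Real.norm_of_nonneg ht.1]
          gcongr
          · dsimp only at hx; linarith
          · exact ht.2
  have hQne : Q.Nonempty := by
    refine ⟨(t₀, c + t₀ • e), ⟨ht₀, le_rfl⟩, hcon, ?_⟩
    simp [hεt]
    linarith
  -- The first time at which the closed disc meets the non-asymptotic set; the open disc is still
  -- asymptotic then, so `x` is a tangency point.
  obtain ⟨⟨t, x⟩, ⟨ht, hx, hxt⟩, hmin⟩ := hQc.exists_isMinOn hQne continuous_fst.continuousOn
  dsimp only at ht hx hxt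
  have hmin' : ∀ s y, s ∈ Set.Icc 0 t₀ → s < t → ¬ Φ.Asy T T' y → r - ε * s < ‖y - c - s • e‖ := by
    intro s y hs hst hy
    by_contra! hle
    exact absurd (hmin (show (s, y) ∈ Q from ⟨hs, hy, hle⟩)) (not_le.2 hst)
  have htpos : 0 < t := by
    refine lt_of_le_of_ne ht.1 ?_
    rintro rfl
    refine hx (hball ?_)
    rw [Metric.mem_ball, dist_eq_norm]
    simp only [zero_smul, sub_zero, mul_zero] at hxt
    linarith
  set ρ := r - ε * t with hρ
  have hρ0 : 0 < ρ := by
    have : ε * t ≤ ε * t₀ := by gcongr; exact ht.2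
    linarith
  have hin : ∀ y, ‖y - c - t • e‖ < ρ → Φ.Asy T T' y := by
    intro y hy
    by_contra hya
    have hcont : ContinuousAt (fun s : ℝ => ‖y - c - s • e‖ - (r - ε * s)) t := by fun_prop
    have h1 : ∀ᶠ s in 𝓝 t, ‖y - c - s • e‖ - (r - ε * s) < 0 :=
      hcont.eventually (gt_mem_nhds (by linarith))
    have h2 : ∀ᶠ s in 𝓝[<] t, ‖y - c - s • e‖ - (r - ε * s) < 0 := nhdsWithin_le_nhds h1
    have h3 : ∀ᶠ s in 𝓝[<] t, s ∈ Set.Ioo 0 t := Ioo_mem_nhdsLT htpos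
    obtain ⟨s, h2, h3⟩ := (h2.and h3).exists
    have := hmin' s y ⟨h3.1.le, h3.2.le.trans ht.2⟩ h3.2 hya
    linarith
  set u := c + t • e - x with hu
  have hxu : x - c - t • e = -u := by rw [hu]; abel
  have hnu : ‖u‖ = ρ := by
    rw [hxu, norm_neg] at hxt
    refine le_antisymm hxt ?_
    by_contra! hlt
    exact hx (hin x (by rwa [hxu, norm_neg]))
  have hu0 : u ≠ 0 := by rw [← norm_pos_iff, hnu]; exact hρ0
  obtain ⟨S, S', hSS'⟩ := exists_branchAt_of_tangent hprim hflc hper (shift_mem hT x)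
    (shift_mem hT' x) (by rwa [asy_shift, zero_add]) (𝒰 := {u}) ⟨u, rfl, hu0⟩ (by
      rintro _ rfl y hy
      rw [asy_shift]
      apply hin
      rw [hnu] at hy
      convert hy using 2
      rw [hu]; abel)
  have hinner := he S S' u hu0 (hSS' u rfl)
  -- As ⟪u, e⟫ ≥ 0, the slightly larger disc a short time `h` earlier already contained `x`: the
  -- gain 2ερh in squared radius outweighs the error h²‖e‖².
  set h := min t (ε * ρ / (‖e‖ ^ 2 + 1)) with hh
  have hh0 : 0 < h := by positivity
  have h1 := hmin' (t - h) x ⟨by linarith [min_le_left t (ε * ρ / (‖e‖ ^ 2 + 1))], by linarith [ht.2]⟩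
    (by linarith) hx
  have h2 : x - c - (t - h) • e = -(u - h • e) := by rw [hu, sub_smul]; abel
  have h3 : h * (‖e‖ ^ 2 + 1) ≤ ε * ρ := by
    have := min_le_right t (ε * ρ / (‖e‖ ^ 2 + 1))
    rwa [le_div_iff₀ (by positivity)] at this
  rw [h2, norm_neg] at h1
  have h4 : r - ε * (t - h) = ρ + ε * h := by rw [hρ]; ring
  rw [h4, ← pow_lt_pow_iff_left₀ (by positivity) (norm_nonneg _) two_ne_zero, norm_sub_sq_real, hnu,
    real_inner_smul_right, norm_smul, Real.norm_of_nonneg hh0.le] at h1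
  have h5 : 0 ≤ h * ⟪u, e⟫ := mul_nonneg hh0.le hinner
  have h6 : h * (h * (‖e‖ ^ 2 + 1)) ≤ h * (ε * ρ) := by gcongr
  have h7 : 0 < h * (ε * ρ) := by positivity
  nlinarith [sq_nonneg (ε * h), sq_nonneg h]

/-! ### Orthonormal coordinates -/

theorem inner_eq (u v : Plane) : ⟪u, v⟫ = u 0 * v 0 + u 1 * v 1 := by
  simp [PiLp.inner_apply, Fin.sum_univ_two, mul_comm]

theorem eq_add_of_orthonormal {u v : Plane} (hu : ‖u‖ = 1) (hv : ‖v‖ = 1) (huv : ⟪u, v⟫ = 0)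
    (x : Plane) : x = ⟪x, u⟫ • u + ⟪x, v⟫ • v := by
  have hu' := real_inner_self_eq_norm_sq u
  have hv' := real_inner_self_eq_norm_sq v
  rw [hu, inner_eq] at hu'
  rw [hv, inner_eq] at hv'
  rw [inner_eq] at huv
  -- The rows of the matrix are orthonormal, hence so are its columns, which gives the expansion.
  have hM : !![u 0, u 1; v 0, v 1] * !![u 0, v 0; u 1, v 1] = (1 : Matrix (Fin 2) (Fin 2) ℝ) := by
    ext i j
    fin_cases i <;> fin_cases j <;> simp [Matrix.mul_apply, Fin.sum_univ_two] <;> linarith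
  have hM' := mul_eq_one_comm.1 hM
  have e00 := congrFun (congrFun hM' 0) 0
  have e01 := congrFun (congrFun hM' 0) 1
  have e11 := congrFun (congrFun hM' 1) 1
  simp [Matrix.mul_apply, Fin.sum_univ_two] at e00 e01 e11
  ext i
  fin_cases i
  · simp [PiLp.inner_apply, Fin.sum_univ_two]
    linear_combination (-x 0) * e00 - x 1 * e01
  · simp [PiLp.inner_apply, Fin.sum_univ_two]
    linear_combination (-x 0) * e01 - x 1 * e11

/-! ### Collapsing lines -/

/-- A pair that agrees in a half-plane, not at a boundary point, but along a boundary segment that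
starts there, reproduces itself exactly under a power of the substitution near that point. -/
theorem exists_selfSimilar [Finite ι] [Nonempty ι] (hprim : Φ.Primitive)
    (hflc : FLC Φ.tilingSpace) (hper : NonPeriodic Φ.tilingSpace) {T T' : Set (Tile M)}
    {u v : Plane} (hu : ‖u‖ = 1) (hv : ‖v‖ = 1) (huv : ⟪u, v⟫ = 0) (hB : Φ.BranchAt T T' u)
    {g : ℝ} (hg : 0 < g) (hgap : ∀ s, 0 < s → s ≤ g → Φ.Asy T T' (s • v)) :
    ∃ Y Y' : Set (Tile M), Φ.BranchAt Y Y' u ∧ (∀ s : ℝ, 0 < s → s ≤ 1 → Φ.Asy Y Y' (s • v)) ∧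
      ∃ L : ℝ, 1 < L ∧ ∀ x, ‖x‖ < 1 → (Φ.Asy Y Y' x ↔ Φ.Asy Y Y' (L⁻¹ • x)) := by
  obtain ⟨hT, hT', h0, hH⟩ := hB
  obtain ⟨K, hK⟩ := exists_uniform_step hprim hflc hper one_pos
  have hBn : ∀ n, Φ.BranchAt (Φ.apply^[n] T) (Φ.apply^[n] T') u := by
    intro n
    refine ⟨apply_iterate_mem n hT, apply_iterate_mem n hT', ?_, fun x hx => ?_⟩
    · rwa [asy_iterate', smul_zero]
    · rw [asy_iterate']
      apply hH
      rw [real_inner_smul_left]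
      exact mul_pos (inv_pos.2 (scale_pow_pos n)) hx
  obtain ⟨S, hS, S', hS', w, hw, hloc⟩ := exists_limit_pair hflc (hyperfilter ℕ)
    (fun n => apply_iterate_mem (n + K) hT) (fun n => apply_iterate_mem (n + K) hT')
    (p := Φ.scale ^ K • u) (Eventually.of_forall fun n => by
      rw [add_comm, Function.iterate_add_apply, Function.iterate_add_apply]
      refine hK _ (hBn n).1 _ (hBn n).2.1 u fun x hx => (hBn n).2.2.2 x ?_
      rw [← hu, norm_sub_lt_norm_iff] at hx
      have := sq_nonneg ‖x‖
      linarith)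
  set Y : ℕ → Set (Tile M) := fun n => Φ.apply^[n + K] T with hY
  set Y' : ℕ → Set (Tile M) := fun n => Φ.apply^[n + K] T' with hY'
  have hgapn : ∀ᶠ n in atTop, ∀ s : ℝ, 0 < s → s ≤ 1 → Φ.Asy (Y n) (Y' n) (s • v) := by
    have h1 : Tendsto (fun n : ℕ => Φ.scale ^ (n + K)) atTop atTop :=
      (tendsto_add_atTop_iff_nat K).2 (tendsto_pow_atTop_atTop_of_one_lt Φ.one_lt_scale)
    filter_upwards [h1.eventually_ge_atTop (1 / g)] with n hn s hs hs1
    have hL := scale_pow_pos (Φ := Φ) (n + K)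
    rw [div_le_iff₀ hg] at hn
    simp only [hY, hY']
    rw [asy_iterate', smul_smul]
    refine hgap _ (by positivity) ?_
    rw [inv_mul_le_iff₀ hL]
    linarith
  set G : ℕ → Prop := fun n => ‖w n‖ < 1 / 4 ∧
    (∀ s : ℝ, 0 < s → s ≤ 1 → Φ.Asy (Y n) (Y' n) (s • v)) ∧
    ∀ x, ‖x‖ < 2 → tilesAt (shift (Y n) (w n)) x = tilesAt S x ∧
      tilesAt (shift (Y' n) (w n)) x = tilesAt S' x with hG
  have hGev : ∀ᶠ n in (hyperfilter ℕ : Filter ℕ), G n := by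
    filter_upwards [(Metric.tendsto_nhds.1 hw) (1 / 4) (by norm_num), hloc 2,
      Nat.hyperfilter_le_atTop hgapn] with n h1 h2 h3
    exact ⟨by simpa [dist_zero_right] using h1, h3, h2⟩
  obtain ⟨n, hn⟩ := hGev.exists
  obtain ⟨m, hm, hnm⟩ := (hGev.and (Nat.hyperfilter_le_atTop (eventually_gt_atTop n))).exists
  -- Near the origin both translated pairs look like (S, S'), so the non-asymptotic origin of pair
  -- `a` reappears in pair `b` at w_b - w_a.
  have key : ∀ a b, G a → G b → ¬ Φ.Asy (Y b) (Y' b) (w b - w a) := by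
    intro a b ha hb hasy
    have h1 : ‖-w a‖ < 2 := by rw [norm_neg]; linarith [ha.1]
    have h2 : Φ.Asy (shift (Y b) (w b)) (shift (Y' b) (w b)) (-w a) := by
      rw [asy_shift]; convert hasy using 1; abel
    rw [asy_congr (hb.2.2 _ h1).1 (hb.2.2 _ h1).2, ← asy_congr (ha.2.2 _ h1).1 (ha.2.2 _ h1).2,
      asy_shift, neg_add_cancel] at h2
    exact (hBn (a + K)).2.2.1 h2
  have hle : ∀ a b, G a → G b → ⟪w b - w a, u⟫ ≤ 0 := by
    intro a b ha hb
    by_contra! hlt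
    exact key a b ha hb ((hBn (b + K)).2.2.2 _ hlt)
  -- The half-plane, used with both orders of n and m, leaves only the boundary line for w_m - w_n;
  -- the asymptotic segment then excludes a nonzero multiple of `v` of either sign.
  have hzu : ⟪w m - w n, u⟫ = 0 := by
    refine le_antisymm (hle n m hn hm) ?_
    have := hle m n hm hn
    rw [← neg_sub, inner_neg_left] at this
    linarith
  have hz := eq_add_of_orthonormal hu hv huv (w m - w n)
  rw [hzu, zero_smul, zero_add] at hz
  set s := ⟪w m - w n, v⟫ with hs
  have hsle : |s| ≤ 1 := by
    have h1 : |s| ≤ ‖w m - w n‖ * ‖v‖ := abs_real_inner_le_norm _ _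
    rw [hv, mul_one] at h1
    have := norm_sub_le (w m) (w n)
    linarith [hm.1, hn.1]
  have hs0 : s = 0 := by
    rcases lt_trichotomy s 0 with h | h | h
    · refine absurd (hn.2.1 (-s) (by linarith) (by linarith [neg_abs_le s])) ?_
      rw [neg_smul, ← hz, neg_sub]
      exact key m n hm hn
    · exact h
    · refine absurd (hm.2.1 s h (by linarith [le_abs_self s])) ?_
      rw [← hz]
      exact key n m hn hm
  rw [hs0, zero_smul, sub_eq_zero] at hz
  obtain ⟨k, hk⟩ := Nat.exists_eq_add_of_le hnm.le
  have hk0 : k ≠ 0 := by rintro rfl; omega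
  refine ⟨Y n, Y' n, hBn (n + K), hn.2.1, Φ.scale ^ k, one_lt_scale_pow hk0, fun x hx => ?_⟩
  have hYm : Y m = Φ.apply^[k] (Y n) := by
    simp only [hY]; rw [← Function.iterate_add_apply, show m + K = k + (n + K) by omega]
  have hYm' : Y' m = Φ.apply^[k] (Y' n) := by
    simp only [hY']; rw [← Function.iterate_add_apply, show m + K = k + (n + K) by omega]
  rw [← asy_iterate', ← hYm, ← hYm']
  have h1 : ‖x - w n‖ < 2 := (norm_sub_le _ _).trans_lt (by linarith [hn.1])
  have h2 := hn.2.2 _ h1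
  have h3 := hm.2.2 _ h1
  rw [hz] at h3
  have h4 := tilesAt_shift_eq_iff.1 (h2.1.trans h3.1.symm)
  have h5 := tilesAt_shift_eq_iff.1 (h2.2.trans h3.2.symm)
  rw [sub_add_cancel] at h4 h5
  exact asy_congr h4 h5

/-- A compact fundamental segment for scaling by L has a uniform asymptotic neighbourhood; its
images under powers of L⁻¹ form a cone about the segment. -/
theorem exists_cone_of_selfSimilar [Finite ι] (hflc : FLC Φ.tilingSpace) {Y Y' : Set (Tile M)}
    (hY : Y ∈ Φ.tilingSpace) (hY' : Y' ∈ Φ.tilingSpace) {v : Plane} (hv : ‖v‖ = 1)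
    (hgap : ∀ s : ℝ, 0 < s → s ≤ 1 → Φ.Asy Y Y' (s • v)) {L : ℝ} (hL : 1 < L)
    (hself : ∀ x, ‖x‖ < 1 → (Φ.Asy Y Y' x ↔ Φ.Asy Y Y' (L⁻¹ • x))) :
    ∃ c : ℝ, 0 < c ∧ ∀ (s : ℝ) (y : Plane), 0 < s → s ≤ 1 / 4 → ‖y‖ < c * s →
      Φ.Asy Y Y' (s • v + y) := by
  have hL0 : 0 < L := by linarith
  set I := Set.Icc (1 / (4 * L)) (1 / 4 : ℝ) with hI
  have hIc : IsCompact ((fun s : ℝ => s • v) '' I) := isCompact_Icc.image (by fun_prop)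
  have hsub : (fun s : ℝ => s • v) '' I ⊆ {x | Φ.Asy Y Y' x} := by
    rintro _ ⟨s, hs, rfl⟩
    exact hgap s (lt_of_lt_of_le (by positivity) hs.1) (hs.2.trans (by norm_num))
  obtain ⟨δ, hδ, hth⟩ := hIc.exists_thickening_subset_open (isOpen_asy hflc hY hY') hsub
  set ε := min δ (1 / 2) with hε
  have hε0 : 0 < ε := by positivity
  have hbase : ∀ s ∈ I, ∀ y : Plane, ‖y‖ < ε → Φ.Asy Y Y' (s • v + y) := by
    intro s hs y hy
    refine hth (Metric.mem_thickening_iff.2 ⟨s • v, ⟨s, hs, rfl⟩, ?_⟩)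
    rw [dist_eq_norm, add_sub_cancel_left]
    exact hy.trans_le (min_le_left _ _)
  have hpow : ∀ (j : ℕ) (x : Plane), ‖x‖ < 1 → Φ.Asy Y Y' x → Φ.Asy Y Y' ((L ^ j)⁻¹ • x) := by
    intro j
    induction j with
    | zero => intro x _ h; simpa using h
    | succ j ih =>
      intro x hx h
      have h1 : ‖(L ^ j)⁻¹ • x‖ < 1 := by
        rw [norm_smul, norm_inv, Real.norm_of_nonneg (by positivity)]
        have : (L ^ j)⁻¹ ≤ 1 := inv_le_one_of_one_le₀ (one_le_pow₀ hL.le)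
        nlinarith [norm_nonneg x]
      have h2 := (hself _ h1).1 (ih x hx h)
      rwa [smul_smul, ← mul_inv, ← pow_succ'] at h2
  refine ⟨4 * ε, by positivity, fun s y hs hs4 hy => ?_⟩
  -- `j` is the power that moves `s` into the fundamental segment `I`.
  obtain ⟨j, hj1, hj2⟩ := exists_nat_pow_near (x := 1 / (4 * s)) (y := L)
    (by rw [le_div_iff₀ (by positivity)]; linarith) hL
  have hLj : 0 < L ^ j := by positivity
  rw [le_div_iff₀ (by positivity)] at hj1
  rw [div_lt_iff₀ (by positivity), pow_succ'] at hj2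
  have h1 : L ^ j * s ∈ I := by
    constructor
    · rw [div_le_iff₀ (by positivity)]
      nlinarith
    · linarith
  have h2 : ‖L ^ j • y‖ < ε := by
    rw [norm_smul, Real.norm_of_nonneg hLj.le]
    calc L ^ j * ‖y‖ < L ^ j * (4 * ε * s) := by gcongr
      _ = ε * (L ^ j * (4 * s)) := by ring
      _ ≤ ε := by nlinarith
  have h3 := hbase _ h1 _ h2
  have h4 : ‖(L ^ j * s) • v + L ^ j • y‖ < 1 := by
    refine (norm_add_le _ _).trans_lt ?_
    rw [norm_smul, hv, mul_one, Real.norm_of_nonneg (by positivity)]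
    have := h1.2
    have : ε ≤ 1 / 2 := min_le_right _ _
    linarith
  have h5 := hpow j _ h4 h3
  rwa [smul_add, smul_smul, smul_smul, ← mul_assoc, inv_mul_cancel₀ hLj.ne', one_mul, one_smul] at h5

/-- If eventual agreement of a branch pair extends to some point of the line that bounds the
half-plane, then there is a branch pair with two distinct half-planes of eventual agreement. -/
theorem exists_two_halfPlanes [Finite ι] [Nonempty ι] (hprim : Φ.Primitive)
    (hflc : FLC Φ.tilingSpace) (hper : NonPeriodic Φ.tilingSpace) {T T' : Set (Tile M)}
    {u v : Plane} (hu : ‖u‖ = 1) (hv : ‖v‖ = 1) (huv : ⟪u, v⟫ = 0) (hB : Φ.BranchAt T T' u)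
    {t₀ : ℝ} (ht₀ : 0 ≤ t₀) (hasy : Φ.Asy T T' (t₀ • v)) :
    ∃ (S S' : Set (Tile M)) (c : ℝ), 0 < c ∧ Φ.BranchAt S S' u ∧ Φ.BranchAt S S' (u + c • v) := by
  obtain ⟨hT, hT', h0, hH⟩ := hB
  have hvu : ⟪v, u⟫ = 0 := by rw [real_inner_comm]; exact huv
  have hcl : IsClosed {t : ℝ | ¬ Φ.Asy T T' (t • v)} :=
    ((isOpen_asy hflc hT hT').preimage (f := fun t : ℝ => t • v) (by fun_prop)).isClosed_compl
  -- The last non-asymptotic point before t₀; an asymptotic segment starts right after it.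
  obtain ⟨α, ⟨⟨hα0, hαt⟩, hαD⟩, hαmax⟩ := (isCompact_Icc.inter_right hcl).exists_isGreatest
    (s := Set.Icc 0 t₀ ∩ {t : ℝ | ¬ Φ.Asy T T' (t • v)})
    ⟨0, ⟨le_rfl, ht₀⟩, by simpa using h0⟩
  have hαD : ¬ Φ.Asy T T' (α • v) := hαD
  have hαlt : α < t₀ := lt_of_le_of_ne hαt (by rintro rfl; exact hαD hasy)
  have hB' : Φ.BranchAt (shift T (α • v)) (shift T' (α • v)) u := by
    refine ⟨shift_mem hT _, shift_mem hT' _, by rwa [asy_shift, zero_add], fun x hx => ?_⟩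
    rw [asy_shift]
    apply hH
    rw [inner_add_left, real_inner_smul_left, hvu]
    simpa using hx
  obtain ⟨Y, Y', ⟨hY, hY', hY0, hYH⟩, hgap, L, hL, hself⟩ := exists_selfSimilar hprim hflc hper
    hu hv huv hB' (g := t₀ - α) (by linarith) (by
      intro s hs hsg
      rw [asy_shift, ← add_smul]
      by_contra hcon
      have : s + α ≤ α := hαmax ⟨⟨by linarith, by linarith⟩, hcon⟩
      linarith)
  obtain ⟨c, hc, hcone⟩ := exists_cone_of_selfSimilar hflc hY hY' hv hgap hL hself
  -- The tilted tangent ball then stays within distance 1/4 of the origin, where the cone covers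
  -- what the half-plane misses.
  set r : ℝ := 1 / (8 * (1 + c)) with hr
  have hr0 : 0 < r := by positivity
  have hnorm : ‖u + c • v‖ ≤ 1 + c := by
    refine (norm_add_le _ _).trans ?_
    rw [norm_smul, hu, hv, Real.norm_of_nonneg hc.le, mul_one]
  have hune : u ≠ 0 := by rw [← norm_pos_iff, hu]; exact one_pos
  obtain ⟨S, S', hSS'⟩ := exists_branchAt_of_tangent hprim hflc hper hY hY' hY0
    (𝒰 := {u, r • (u + c • v)}) ⟨u, by simp, hune⟩ (by
      rintro _ (rfl | rfl) x hx
      · rw [norm_sub_lt_norm_iff] at hx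
        exact hYH x (by have := sq_nonneg ‖x‖; linarith)
      · have hxn : ‖x‖ ≤ 1 / 4 := by
          have h1 : ‖x‖ ≤ ‖x - r • (u + c • v)‖ + ‖r • (u + c • v)‖ := by
            simpa using norm_add_le (x - r • (u + c • v)) (r • (u + c • v))
          have h2 : ‖r • (u + c • v)‖ ≤ 1 / 8 := by
            rw [norm_smul, Real.norm_of_nonneg hr0.le]
            calc r * ‖u + c • v‖ ≤ r * (1 + c) := by gcongr
              _ = 1 / 8 := by rw [hr]; field_simp
          linarith
        rw [norm_sub_lt_norm_iff, real_inner_smul_right, inner_add_right,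
          real_inner_smul_right] at hx
        have hpos : 0 < ⟪x, u⟫ + c * ⟪x, v⟫ := by
          have h1 : 0 < 2 * (r * (⟪x, u⟫ + c * ⟪x, v⟫)) := lt_of_le_of_lt (sq_nonneg _) hx
          exact (mul_pos_iff_of_pos_left hr0).1 (by linarith)
        by_cases hxu : 0 < ⟪x, u⟫
        · exact hYH x hxu
        · push Not at hxu
          have hxv : 0 < ⟪x, v⟫ := (mul_pos_iff_of_pos_left hc).1 (by linarith)
          rw [eq_add_of_orthonormal hu hv huv x, add_comm]
          refine hcone _ _ hxv ?_ ?_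
          · refine le_trans (le_trans (le_abs_self _) (abs_real_inner_le_norm _ _)) ?_
            rwa [hv, mul_one]
          · rw [norm_smul, hu, mul_one, Real.norm_of_nonpos hxu]
            linarith)
  refine ⟨S, S', c, hc, hSS' u (by simp), ?_⟩
  obtain ⟨hS, hS', hS0, hSH⟩ := hSS' (r • (u + c • v)) (by simp)
  refine ⟨hS, hS', hS0, fun x hx => hSH x ?_⟩
  rw [real_inner_smul_right]
  exact mul_pos hr0 hx

/-! ### Eventual agreement of a tiling with its translates -/

theorem asy_translate_trans {T : Set (Tile M)} {w w' x : Plane} (h : Φ.Asy T (shift T w) x)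
    (h' : Φ.Asy T (shift T w') (x + w)) : Φ.Asy T (shift T (w + w')) x := by
  refine h.trans ?_
  rw [← asy_shift, shift_shift, add_comm] at h'
  exact h'

/-- Moving the pair (T, T - w') by `w` changes each member only by an asymptotic one, so
asymptoticity at `x` and at x + w is the same. -/
theorem asy_translate_conj {T : Set (Tile M)} {w w' x : Plane} (h : Φ.Asy T (shift T w) x)
    (h' : Φ.Asy T (shift T w) (x + w')) :
    Φ.Asy T (shift T w') x ↔ Φ.Asy T (shift T w') (x + w) := by
  rw [← asy_shift (v := w')] at h'
  rw [← asy_shift (v := w), shift_comm T w' w]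
  constructor
  · intro h1
    exact (h.symm.trans h1).trans h'
  · intro h1
    exact (h.trans h1).trans h'.symm

/-- By compactness two translates T - j f and T - k f, j < k, agree on a large ball up to a small
vector, and w is (k - j) f plus that vector. -/
theorem exists_return [Finite ι] (hflc : FLC Φ.tilingSpace) {f e : Plane} (hf : ‖f‖ = 1)
    (he : ‖e‖ = 1) (hfe : ⟪f, e⟫ = 0) {T : Set (Tile M)} (hT : T ∈ Φ.tilingSpace) (ρ : ℝ) {ε : ℝ}
    (hε : 0 < ε) :
    ∃ (j : ℕ) (w : Plane), 0 < ⟪w, f⟫ ∧ |⟪w, e⟫| < ε ∧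
      ∀ x, ‖x - (j : ℝ) • f‖ < ρ → tilesAt T x = tilesAt (shift T w) x := by
  obtain ⟨S, hS, v, hv, hloc⟩ := exists_limit hflc (hyperfilter ℕ)
    (fun j : ℕ => shift_mem hT ((j : ℝ) • f))
  have hGev : ∀ᶠ j in (hyperfilter ℕ : Filter ℕ), ‖v j‖ < min (ε / 2) (1 / 4) ∧
      ∀ x, ‖x‖ < ρ + 1 → tilesAt (shift (shift T ((j : ℝ) • f)) (v j)) x = tilesAt S x := by
    filter_upwards [(Metric.tendsto_nhds.1 hv) (min (ε / 2) (1 / 4)) (by positivity),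
      hloc (ρ + 1)] with j h1 h2
    exact ⟨by simpa only [dist_zero_right] using h1, h2⟩
  obtain ⟨j, hj, hj'⟩ := hGev.exists
  obtain ⟨k, ⟨hk, hk'⟩, hjk⟩ :=
    (hGev.and (Nat.hyperfilter_le_atTop (eventually_gt_atTop j))).exists
  rw [lt_min_iff] at hj hk
  have hvv : ∀ a : Plane, ‖a‖ = 1 → |⟪v k - v j, a⟫| ≤ ‖v k‖ + ‖v j‖ := by
    intro a ha
    have h1 : |⟪v k - v j, a⟫| ≤ ‖v k - v j‖ * ‖a‖ := abs_real_inner_le_norm _ _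
    rw [ha, mul_one] at h1
    exact h1.trans (norm_sub_le _ _)
  refine ⟨j, ((k : ℝ) - j) • f + (v k - v j), ?_, ?_, fun x hx => ?_⟩
  · rw [inner_add_left, real_inner_smul_left, real_inner_self_eq_norm_sq, hf]
    have h1 := (abs_le.1 (hvv f hf)).1
    have h2 : (j : ℝ) + 1 ≤ k := by exact_mod_cast hjk
    linarith
  · rw [inner_add_left, real_inner_smul_left, hfe, mul_zero, zero_add]
    exact (hvv e he).trans_lt (by linarith)
  · have hy : ‖x - (j : ℝ) • f - v j‖ < ρ + 1 := (norm_sub_le _ _).trans_lt (by linarith)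
    have h1 := (hj' _ hy).trans (hk' _ hy).symm
    have h2 : shift (shift T ((k : ℝ) • f)) (v k) =
        shift (shift (shift T (((k : ℝ) - j) • f + (v k - v j))) ((j : ℝ) • f)) (v j) := by
      rw [shift_shift, shift_shift, shift_shift]
      congr 1
      rw [sub_smul]; abel
    rw [h2, shift_shift, shift_shift (shift T _), tilesAt_shift_eq_iff] at h1
    convert h1 using 2 <;> abel

/-- If the bounds fail along z_n, a limit of T - z_n still has some return vector, and this one is
inherited by T near z_n for suitable large n. -/
theorem exists_uniform_return [Finite ι] (hflc : FLC Φ.tilingSpace) {f e : Plane} (hf : ‖f‖ = 1)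
    (he : ‖e‖ = 1) (hfe : ⟪f, e⟫ = 0) {T : Set (Tile M)} (hT : T ∈ Φ.tilingSpace) (ρ : ℝ) {ε : ℝ}
    (hε : 0 < ε) :
    ∃ C : ℝ, ∀ z : Plane, ∃ w p : Plane, 0 < ⟪w, f⟫ ∧ ⟪w, f⟫ ≤ C ∧ |⟪w, e⟫| < ε ∧
      ⟪p, e⟫ = ⟪z, e⟫ ∧ ∀ x, ‖x - p‖ < ρ → tilesAt T x = tilesAt (shift T w) x := by
  by_contra! hcon
  choose z hz using fun n : ℕ => hcon n
  obtain ⟨S, hS, v, hv, hloc⟩ := exists_limit hflc (hyperfilter ℕ) (fun n => shift_mem hT (z n))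
  obtain ⟨j, w, hw, hwe, hagree⟩ := exists_return hflc hf he hfe hS (ρ + 1) hε
  obtain ⟨n, h1, h2, h3⟩ := (((Metric.tendsto_nhds.1 hv) 1 one_pos).and
    ((hloc (ρ + 1 + j + ‖w‖)).and (Nat.hyperfilter_le_atTop
      (tendsto_natCast_atTop_atTop.eventually_ge_atTop ⟪w, f⟫)))).exists
  rw [dist_zero_right] at h1
  obtain ⟨x, hx, hne⟩ := hz n w (z n + (j : ℝ) • f) hw h3 hwe (by
    rw [inner_add_left, real_inner_smul_left, hfe, mul_zero, add_zero])
  refine hne ?_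
  have hy : ‖x - z n - v n - (j : ℝ) • f‖ < ρ + 1 := by
    have : x - z n - v n - (j : ℝ) • f = x - (z n + (j : ℝ) • f) - v n := by abel
    rw [this]
    exact (norm_sub_le _ _).trans_lt (by linarith)
  have hy1 : ‖x - z n - v n‖ < ρ + 1 + j := by
    have h4 := norm_add_le (x - z n - v n - (j : ℝ) • f) ((j : ℝ) • f)
    rw [sub_add_cancel, norm_smul (j : ℝ) f, hf, mul_one, Real.norm_natCast] at h4
    linarith
  have e1 := h2 (x - z n - v n) (by linarith [norm_nonneg w])
  have e2 := h2 (x - z n - v n + w) ((norm_add_le _ _).trans_lt (by linarith))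
  have e3 := (e1.trans (hagree _ hy)).trans (tilesAt_shift_eq_iff.2 e2).symm
  rw [shift_comm _ (v n) w, shift_comm T (z n) w, tilesAt_shift_eq_iff, tilesAt_shift_eq_iff] at e3
  simpa using e3

/-- Moving the common tile to prototile position puts both of its copies into one of finitely many
patches. -/
theorem return_vectors_finite [Finite ι] (hflc : FLC Φ.tilingSpace) (C : ℝ) :
    {w : Plane | ‖w‖ ≤ C ∧ ∃ T ∈ Φ.tilingSpace, ∃ x, tilesAt T x = tilesAt (shift T w) x}.Finite := by
  obtain ⟨D, hD, hD'⟩ := Φ.exists_radius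
  set ρ := max D (D + C) + 1 with hρ
  have hfin : (⋃ i : ι, ⋃ P ∈ {P | ∃ T ∈ Φ.tilingSpace, Φ.proto i ∈ T ∧ ballPatch ρ T = P},
      {w : Plane | w +ᵥ Φ.proto i ∈ P}).Finite := by
    refine Set.finite_iUnion fun i => Set.Finite.biUnion (ballPatches_finite hflc hD' i
      (lt_of_le_of_lt (le_max_left _ _) (lt_add_one _))) ?_
    rintro P ⟨T, hT, -, rfl⟩
    exact (ballPatch_finite hflc hT ρ).preimage
      (f := fun w : Plane => w +ᵥ Φ.proto i) fun a _ b _ h => (vadd_proto_injective h).2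
  refine hfin.subset ?_
  rintro w ⟨hw, T, hT, x, h⟩
  obtain ⟨τ, hτ⟩ := hT.1.tilesAt_nonempty x
  have hτ' := hτ
  rw [h] at hτ'
  have h2 := mem_shift.1 hτ'.1
  obtain ⟨i, a, rfl⟩ := tiles_of_mem hT τ hτ.1
  simp only [Set.mem_iUnion]
  refine ⟨i, ballPatch ρ (shift T a), ⟨_, shift_mem hT a, mem_shift.2 hτ.1, rfl⟩, ?_⟩
  obtain ⟨y, hy⟩ := proto_nonempty (Φ := Φ) i
  refine mem_ballPatch.2 ⟨w + y, ?_, ?_, ?_⟩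
  · have := hD' i y hy
    exact (norm_add_le _ _).trans_lt (by linarith [le_max_right D (D + C)])
  · rw [mem_shift, vadd_vadd, add_comm, ← vadd_vadd]
    exact h2
  · rw [mem_vadd_support]; simpa

/-! ### An invariant direction is impossible -/

section Invariant

variable {f e : Plane}

theorem asy_of_inner_eq (hf : ‖f‖ = 1) (he : ‖e‖ = 1) (hfe : ⟪f, e⟫ = 0)
    (hinv : ∀ T ∈ Φ.tilingSpace, ∀ T' ∈ Φ.tilingSpace, ∀ (c : Plane) (t : ℝ),
      Φ.Asy T T' c → Φ.Asy T T' (c + t • f)) {T T' : Set (Tile M)} (hT : T ∈ Φ.tilingSpace)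
    (hT' : T' ∈ Φ.tilingSpace) {c x : Plane} (hc : Φ.Asy T T' c) (h : ⟪x, e⟫ = ⟪c, e⟫) :
    Φ.Asy T T' x := by
  have h1 := eq_add_of_orthonormal hf he hfe (x - c)
  rw [inner_sub_left x c e, h, sub_self, zero_smul, add_zero] at h1
  have h2 : x = c + ⟪x - c, f⟫ • f := by rw [← h1, add_sub_cancel]
  rw [h2]
  exact hinv T hT T' hT' c _ hc

/-- Small steps across an invariant direction do not occur as return vectors of wide strips. -/
theorem exists_strip_rigid [Finite ι] [Nonempty ι] (hprim : Φ.Primitive)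
    (hflc : FLC Φ.tilingSpace) (hper : NonPeriodic Φ.tilingSpace) (hf : ‖f‖ = 1) (he : ‖e‖ = 1)
    (hfe : ⟪f, e⟫ = 0)
    (hinv : ∀ T ∈ Φ.tilingSpace, ∀ T' ∈ Φ.tilingSpace, ∀ (c : Plane) (t : ℝ),
      Φ.Asy T T' c → Φ.Asy T T' (c + t • f)) {T : Set (Tile M)} (hT : T ∈ Φ.tilingSpace) :
    ∃ R : ℝ, 0 < R ∧ ∀ z w : Plane, (∀ x, |⟪x - z, e⟫| < R → Φ.Asy T (shift T w) x) →
      |⟪w, e⟫| < 1 → ⟪w, e⟫ = 0 := by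
  have hee : ⟪e, e⟫ = 1 := by rw [real_inner_self_eq_norm_sq, he, one_pow]
  have habs : ∀ a : Plane, |⟪a, e⟫| ≤ ‖a‖ := fun a => by
    have : |⟪a, e⟫| ≤ ‖a‖ * ‖e‖ := abs_real_inner_le_norm _ _
    rwa [he, mul_one] at this
  obtain ⟨j, w₀, hw₀, -, hw₀'⟩ := exists_return hflc hf he hfe hT 1 one_pos
  set p₀ : Plane := (j : ℝ) • f with hp₀
  have hTw₀ := shift_mem hT w₀
  have hw₀ne : w₀ ≠ 0 := by rintro rfl; simp at hw₀
  -- By non-periodicity the return vector w₀ fails at some height d, although it is exact within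
  -- distance 1 of p₀. Repetitivity copies this profile to a point z' near `z`.
  have hnot : ∃ d : ℝ, ¬ Φ.Asy T (shift T w₀) (p₀ + d • e) := by
    by_contra! hall
    refine hw₀ne (eq_zero_of_forall_asy hprim hflc hper hT fun x => ?_)
    refine asy_of_inner_eq hf he hfe hinv hT hTw₀ (hall ⟪x - p₀, e⟫) ?_
    rw [inner_add_left, real_inner_smul_left e e ⟪x - p₀, e⟫, hee, inner_sub_left]; ring
  obtain ⟨d, hd⟩ := hnot
  set m := |d| + ‖w₀‖ + 2 with hm
  obtain ⟨R, hR⟩ := repetitive hprim hflc m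
  refine ⟨max R 0 + m, by positivity, fun z w hstrip hw => ?_⟩
  obtain ⟨z', hz', hagree⟩ := hR T hT p₀ z
  have hTw := shift_mem hT w
  have hne : ∀ s : ℝ, ‖s • e‖ = |s| := fun s => by
    rw [norm_smul, he, mul_one, Real.norm_eq_abs]
  have htrans : ∀ s : ℝ, |s| < m - ‖w₀‖ →
      (Φ.Asy T (shift T w₀) (p₀ + s • e) ↔ Φ.Asy T (shift T w₀) (z' + s • e)) := by
    intro s hs
    rw [add_comm p₀, add_comm z', ← asy_shift, ← asy_shift, shift_comm, shift_comm T w₀ z']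
    refine asy_congr (hagree _ ?_) (tilesAt_shift_eq_iff.2 (hagree _ ?_))
    · rw [hne]; linarith [norm_nonneg w₀]
    · exact (norm_add_le _ _).trans_lt (by rw [hne]; linarith)
  have hin : ∀ s : ℝ, |s| ≤ |d| → ∀ a : Plane, ‖a‖ ≤ ‖w₀‖ →
      Φ.Asy T (shift T w) (z' + s • e + a) := by
    intro s hs a ha
    apply hstrip
    have h1 : z' + s • e + a - z = (z' - z) + s • e + a := by abel
    refine lt_of_le_of_lt (habs _) ?_
    rw [h1]
    refine (norm_add₃_le).trans_lt ?_
    rw [hne]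
    linarith [le_max_left R 0]
  -- Conjugation by `w`, followed by sliding along `f`, changes only the height, by h = ⟪w, e⟫.
  have hstep : ∀ s : ℝ, |s| ≤ |d| → (Φ.Asy T (shift T w₀) (z' + s • e) ↔
      Φ.Asy T (shift T w₀) (z' + (s + ⟪w, e⟫) • e)) := by
    intro s hs
    rw [asy_translate_conj (w := w) (by simpa using hin s hs 0 (by simp)) (hin s hs w₀ le_rfl)]
    have h1 : ⟪z' + s • e + w, e⟫ = ⟪z' + (s + ⟪w, e⟫) • e, e⟫ := by
      simp only [inner_add_left, real_inner_smul_left, hee]; ring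
    exact ⟨fun h => asy_of_inner_eq hf he hfe hinv hT hTw₀ h h1.symm,
      fun h => asy_of_inner_eq hf he hfe hinv hT hTw₀ h h1⟩
  by_contra hw0
  set h := ⟪w, e⟫ with hh
  have hpos : 0 < |h| := abs_pos.2 hw0
  have hstep' : ∀ s s' : ℝ, |s| ≤ |d| → |s'| ≤ |d| → |s - s'| = |h| →
      (Φ.Asy T (shift T w₀) (z' + s • e) ↔ Φ.Asy T (shift T w₀) (z' + s' • e)) := by
    intro s s' hs hs' hss
    rcases abs_eq_abs.1 hss with h1 | h1
    · rw [hstep s' hs', show s' + h = s by linarith]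
    · rw [hstep s hs, show s + h = s' by linarith]
  obtain ⟨κ, hκ, hdκ⟩ : ∃ κ : ℝ, |κ| = 1 ∧ d = κ * |d| := by
    rcases le_total 0 d with h1 | h1
    · exact ⟨1, by simp, by rw [abs_of_nonneg h1, one_mul]⟩
    · exact ⟨-1, by simp, by rw [abs_of_nonpos h1]; ring⟩
  have hind : ∀ k : ℕ, k * |h| ≤ |d| →
      ¬ Φ.Asy T (shift T w₀) (z' + (κ * (|d| - k * |h|)) • e) := by
    intro k
    induction k with
    | zero =>
      intro _
      rw [Nat.cast_zero, zero_mul, sub_zero, ← hdκ, ← htrans d (by linarith)]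
      exact hd
    | succ k ih =>
      intro hk
      push_cast at hk
      have hk' : k * |h| ≤ |d| := by linarith
      have hkh : 0 ≤ k * |h| := by positivity
      have h1 := ih hk'
      rwa [hstep' _ (κ * (|d| - ((k + 1 : ℕ) : ℝ) * |h|))] at h1
      · rw [abs_mul, hκ, one_mul, abs_of_nonneg (by linarith)]; linarith
      · push_cast
        rw [abs_mul, hκ, one_mul, abs_of_nonneg (by linarith)]; linarith
      · push_cast
        rw [show κ * (|d| - k * |h|) - κ * (|d| - (k + 1) * |h|) = κ * |h| by ring, abs_mul, hκ,
          one_mul, abs_abs]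
  have hfl := Nat.floor_le (show 0 ≤ |d| / |h| by positivity)
  have hfl' := Nat.lt_floor_add_one (|d| / |h|)
  rw [le_div_iff₀ hpos] at hfl
  rw [div_lt_iff₀ hpos] at hfl'
  have habs1 : |κ * (|d| - ⌊|d| / |h|⌋₊ * |h|)| < 1 := by
    rw [abs_mul, hκ, one_mul, abs_of_nonneg (by linarith)]; linarith
  -- Steps of length |h| < 1 carry the failure from height d to a height below 1 in absolute value,
  -- where w₀ is an exact return.
  refine hind _ hfl ((htrans _ ?_).1 (asy_of_tilesAt_eq (hw₀' _ ?_)))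
  · linarith [abs_nonneg d]
  · rw [add_sub_cancel_left, hne]; exact habs1

/-- Positive reals with a common positive integer multiple. -/
def Commens (s t : ℝ) : Prop := ∃ k l : ℕ, 0 < k ∧ 0 < l ∧ k * s = l * t

theorem Commens.trans {r s t : ℝ} (h : Commens r s) (h' : Commens s t) : Commens r t := by
  obtain ⟨k, l, hk, hl, h⟩ := h
  obtain ⟨k', l', hk', hl', h'⟩ := h'
  refine ⟨k' * k, l * l', by positivity, by positivity, ?_⟩
  push_cast
  linear_combination (k' : ℝ) * h + (l : ℝ) * h'

theorem exists_common_multiple {F : Set ℝ} (hF : F.Finite) {t₀ : ℝ} (ht₀ : 0 < t₀)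
    (h : ∀ t ∈ F, Commens t₀ t) :
    ∃ s : ℝ, 0 < s ∧ Commens s t₀ ∧ ∀ t ∈ F, ∃ k : ℕ, s = k * t := by
  induction F, hF using Set.Finite.induction_on with
  | empty => exact ⟨t₀, ht₀, ⟨1, 1, one_pos, one_pos, rfl⟩, by simp⟩
  | @insert a F _ _ ih =>
    obtain ⟨s, hs, ⟨k₁, l₁, hk₁, hl₁, h₁⟩, hmul⟩ := ih fun t ht => h t (Set.mem_insert_of_mem _ ht)
    obtain ⟨k, l, hk, hl, hkl⟩ := Commens.trans ⟨k₁, l₁, hk₁, hl₁, h₁⟩ (h a (Set.mem_insert _ _))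
    refine ⟨k * s, by positivity, ⟨k₁, k * l₁, hk₁, by positivity, ?_⟩, ?_⟩
    · push_cast
      linear_combination (k : ℝ) * h₁
    · rintro t (rfl | ht)
      · exact ⟨l, hkl⟩
      · obtain ⟨m, hm⟩ := hmul t ht
        refine ⟨k * m, ?_⟩
        rw [hm]; push_cast; ring

/-- Under invariance, agreement on a ball spreads to a strip along `f`. On each strip of half-width
`R` the tiling is asymptotic to a translate by some t(y) f, with t(y) bounded. These lengths take
finitely many values and are commensurable, so a common multiple gives a nonzero vector excluded by
`eq_zero_of_forall_asy`. -/
theorem not_invariant_direction [Finite ι] [Nonempty ι] (hprim : Φ.Primitive)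
    (hflc : FLC Φ.tilingSpace) (hper : NonPeriodic Φ.tilingSpace) (hf : ‖f‖ = 1) (he : ‖e‖ = 1)
    (hfe : ⟪f, e⟫ = 0) :
    ¬ ∀ T ∈ Φ.tilingSpace, ∀ T' ∈ Φ.tilingSpace, ∀ (c : Plane) (t : ℝ),
      Φ.Asy T T' c → Φ.Asy T T' (c + t • f) := by
  intro hinv
  have hee : ⟪e, e⟫ = 1 := by rw [real_inner_self_eq_norm_sq, he, one_pow]
  have hf0 : f ≠ 0 := by rw [← norm_pos_iff, hf]; exact one_pos
  obtain ⟨T, hT⟩ := tilingSpace_nonempty hprim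
  obtain ⟨R, hR, hrigid⟩ := exists_strip_rigid hprim hflc hper hf he hfe hinv hT
  obtain ⟨C, hC⟩ := exists_uniform_return hflc hf he hfe hT R one_pos
  have hper' : ∀ y : ℝ, ∃ t : ℝ, 0 < t ∧ t ≤ C ∧
      ∀ x, |⟪x, e⟫ - y| < R → Φ.Asy T (shift T (t • f)) x := by
    intro y
    obtain ⟨w, p, hw, hwC, hwe, hp, hagree⟩ := hC (y • e)
    have hstrip : ∀ x, |⟪x - y • e, e⟫| < R → Φ.Asy T (shift T w) x := by
      intro x hx
      refine asy_of_inner_eq hf he hfe hinv hT (shift_mem hT w)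
        (c := p + ⟪x - y • e, e⟫ • e) (asy_of_tilesAt_eq (hagree _ ?_)) ?_
      · rwa [add_sub_cancel_left, norm_smul, he, mul_one, Real.norm_eq_abs]
      · rw [inner_add_left, real_inner_smul_left, hee, hp, inner_sub_left]; ring
    have h0 := hrigid _ w hstrip hwe
    have hwf := eq_add_of_orthonormal hf he hfe w
    rw [h0, zero_smul, add_zero] at hwf
    refine ⟨⟪w, f⟫, hw, hwC, fun x hx => ?_⟩
    rw [← hwf]
    apply hstrip
    rwa [inner_sub_left, real_inner_smul_left, hee, mul_one]
  choose t ht htC hasy using hper'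
  have hmul : ∀ (y : ℝ) (k : ℕ) (x : Plane), |⟪x, e⟫ - y| < R →
      Φ.Asy T (shift T ((k * t y) • f)) x := by
    intro y k
    induction k with
    | zero => intro x _; simpa [shift_zero] using Asy.refl T x
    | succ k ih =>
      intro x hx
      have h1 := asy_translate_trans (hasy y x hx) (ih (x + t y • f) (by
        rwa [inner_add_left, real_inner_smul_left, hfe, mul_zero, add_zero]))
      rw [← add_smul] at h1
      convert h1 using 3
      push_cast; ring
  obtain ⟨K, hK⟩ := exists_uniform_step hprim hflc hper (r := R / 2) (by positivity)
  have hLpos := scale_pow_pos (Φ := Φ) K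
  -- On a strip of half-width R/2, asymptoticity becomes genuine agreement of translates of Φ^K T,
  -- so finiteness and discreteness of return vectors apply.
  have hstep : ∀ a b y : ℝ, (∀ x, |⟪x, e⟫ - y| < R / 2 →
      Φ.Asy (shift T (a • f)) (shift T (b • f)) x) → ∃ x,
      tilesAt (shift (Φ.apply^[K] T) ((Φ.scale ^ K * a) • f)) x =
        tilesAt (shift (Φ.apply^[K] T) ((Φ.scale ^ K * b) • f)) x := by
    intro a b y h
    have h1 := hK _ (shift_mem hT (a • f)) _ (shift_mem hT (b • f)) (y • e) fun x hx => h x (by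
      refine lt_of_le_of_lt ?_ hx
      have h2 : |⟪x - y • e, e⟫| ≤ ‖x - y • e‖ * ‖e‖ := abs_real_inner_le_norm _ _
      rwa [he, mul_one, inner_sub_left, real_inner_smul_left, hee, mul_one] at h2)
    rw [apply_iterate_shift, apply_iterate_shift, smul_smul, smul_smul, smul_smul] at h1
    exact ⟨_, h1⟩
  have hfin : (Set.range t).Finite := by
    refine ((return_vectors_finite hflc (Φ.scale ^ K * C)).preimage
      (f := fun s : ℝ => (Φ.scale ^ K * s) • f) ?_).subset ?_
    · intro a _ b _ hab
      exact mul_left_cancel₀ hLpos.ne' (smul_left_injective ℝ hf0 hab)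
    · rintro _ ⟨y, rfl⟩
      refine ⟨?_, Φ.apply^[K] T, apply_iterate_mem K hT, ?_⟩
      · rw [norm_smul, hf, mul_one, Real.norm_of_nonneg (mul_nonneg hLpos.le (ht y).le)]
        exact mul_le_mul_of_nonneg_left (htC y) hLpos.le
      · obtain ⟨x, hx⟩ := hstep 0 (t y) y fun x hx => by
          simpa [shift_zero] using hasy y x (by linarith)
        exact ⟨x, by simpa [shift_zero] using hx⟩
  obtain ⟨r, hr, hr'⟩ := Φ.exists_inradius
  have hnear : ∀ y y' : ℝ, |y - y'| ≤ R / 2 → Commens (t y) (t y') := by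
    intro y y' hyy
    obtain ⟨n, hn⟩ := exists_nat_gt (Φ.scale ^ K * t y' / r + 1)
    have hn0 : 0 < n := by
      have h1 : 0 < Φ.scale ^ K * t y' / r := div_pos (mul_pos hLpos (ht y')) hr
      have : (0 : ℝ) < n := by linarith
      exact_mod_cast this
    -- Dirichlet approximation: k t(y) - l t(y') is so small that on the overlap of the two strips
    -- it must vanish by `small_return`.
    obtain ⟨l, k, hk, -, hlk⟩ := Real.exists_int_int_abs_mul_sub_le (t y / t y') hn0
    have hq : 0 < t y / t y' := div_pos (ht y) (ht y')
    have hk' : (0 : ℝ) < k := by exact_mod_cast hk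
    have hn1 : 1 / ((n : ℝ) + 1) < 1 := by
      rw [div_lt_one (by positivity)]
      have : (0 : ℝ) < n := by exact_mod_cast hn0
      linarith
    have hl : 0 ≤ l := by
      by_contra! hneg
      have h1 : (l : ℝ) ≤ -1 := by exact_mod_cast Int.le_sub_one_of_lt hneg
      have h2 := (abs_le.1 hlk).2
      have h3 : 0 < k * (t y / t y') := by positivity
      linarith
    lift l to ℕ using hl
    lift k to ℕ using hk.le
    simp only [Int.cast_natCast] at hlk hk'
    have hdiff : |k * t y - l * t y'| ≤ t y' / (n + 1) := by
      have h1 : k * t y - l * t y' = (k * (t y / t y') - l) * t y' := by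
        have := (ht y').ne'
        field_simp
      rw [h1, abs_mul, abs_of_pos (ht y')]
      calc _ ≤ 1 / ((n : ℝ) + 1) * t y' := by gcongr; exact (ht y').le
        _ = _ := by ring
    have heq : (Φ.scale ^ K * (k * t y)) • f = (Φ.scale ^ K * (l * t y')) • f := by
      obtain ⟨x, hx⟩ := hstep (k * t y) (l * t y') y fun x hx => by
        refine (hmul y k x (by linarith)).symm.trans (hmul y' l x ?_)
        have h1 : ⟪x, e⟫ - y' = (⟪x, e⟫ - y) + (y - y') := by ring
        rw [h1]
        exact (abs_add_le _ _).trans_lt (by linarith)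
      refine small_return (apply_iterate_mem K hT) hr' ?_ hx
      rw [← sub_smul, ← mul_sub, norm_smul, hf, mul_one, Real.norm_eq_abs, abs_mul,
        abs_of_pos hLpos]
      calc Φ.scale ^ K * |k * t y - l * t y'| ≤ Φ.scale ^ K * (t y' / (n + 1)) := by gcongr
        _ = Φ.scale ^ K * t y' / (n + 1) := by ring
        _ < r := by
          rw [div_lt_iff₀ (by positivity)]
          have h1 : Φ.scale ^ K * t y' / r < n + 1 := by linarith
          rw [div_lt_iff₀ hr] at h1
          linarith
    have heq' := mul_left_cancel₀ hLpos.ne' (smul_left_injective ℝ hf0 heq)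
    refine ⟨k, l, by exact_mod_cast hk, ?_, heq'⟩
    rcases Nat.eq_zero_or_pos l with rfl | h
    · have h1 : 0 < k * t y := mul_pos hk' (ht y)
      rw [heq'] at h1
      simp at h1
    · exact h
  have hchain : ∀ (n : ℕ) (y : ℝ), |y| ≤ n * (R / 2) → Commens (t 0) (t y) := by
    intro n
    induction n with
    | zero =>
      intro y hy
      have : y = 0 := by simpa using hy
      rw [this]
      exact ⟨1, 1, one_pos, one_pos, rfl⟩
    | succ n ih =>
      intro y hy
      push_cast at hy
      have hn1 : (0 : ℝ) < n + 1 := by positivity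
      -- Shrinking `y` by the factor n/(n + 1) is a step of length at most R/2.
      refine (ih (n / (n + 1) * y) ?_).trans (hnear _ _ ?_)
      · rw [abs_mul, abs_of_nonneg (by positivity), div_mul_eq_mul_div, div_le_iff₀ hn1]
        calc n * |y| ≤ n * ((n + 1) * (R / 2)) := by gcongr
          _ = _ := by ring
      · have h1 : n / (n + 1) * y - y = -(y / (n + 1)) := by field_simp; ring
        rw [h1, abs_neg, abs_div, abs_of_pos hn1, div_le_iff₀ hn1]
        linarith
  have hcomm : ∀ s ∈ Set.range t, Commens (t 0) s := by
    rintro _ ⟨y, rfl⟩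
    obtain ⟨n, hn⟩ := exists_nat_gt (|y| / (R / 2))
    rw [div_lt_iff₀ (by positivity)] at hn
    exact hchain n y hn.le
  obtain ⟨s, hs, -, hsmul⟩ := exists_common_multiple hfin (ht 0) hcomm
  have hzero := eq_zero_of_forall_asy hprim hflc hper hT (w := s • f) fun x => by
    obtain ⟨k, hk⟩ := hsmul _ ⟨⟪x, e⟫, rfl⟩
    rw [hk]
    exact hmul _ k x (by simpa using hR)
  rcases smul_eq_zero.1 hzero with h | h
  · exact hs.ne' h
  · exact hf0 h

end Invariant

end Substitution

/-! ### Semicircles and their boundaries in the unit circle -/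

theorem Circ.norm_coe (u : Circ) : ‖(u : Plane)‖ = 1 := norm_eq_of_mem_sphere u

theorem Circ.inner_self (u : Circ) : ⟪(u : Plane), (u : Plane)⟫ = 1 := by
  rw [real_inner_self_eq_norm_sq, u.norm_coe, one_pow]

theorem exists_circ_smul {x : Plane} (hx : x ≠ 0) :
    ∃ (u : Circ) (r : ℝ), 0 < r ∧ x = r • (u : Plane) := by
  have h := norm_pos_iff.2 hx
  refine ⟨⟨‖x‖⁻¹ • x, ?_⟩, ‖x‖, h, ?_⟩
  · rw [mem_sphere_zero_iff_norm, norm_smul, norm_inv, norm_norm, inv_mul_cancel₀ h.ne']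
  · rw [smul_smul, mul_inv_cancel₀ h.ne', one_smul]

theorem exists_orthogonal_circ (u : Circ) : ∃ v : Circ, ⟪(u : Plane), (v : Plane)⟫ = 0 := by
  have hu : (u : Plane) 0 ^ 2 + (u : Plane) 1 ^ 2 = 1 := by
    have := u.inner_self
    simp only [Substitution.inner_eq] at this
    linarith [this]
  refine ⟨⟨!₂[-(u : Plane) 1, (u : Plane) 0], ?_⟩, ?_⟩
  · rw [mem_sphere_zero_iff_norm, EuclideanSpace.norm_eq, Real.sqrt_eq_one]
    simp
    linarith
  · simp [Substitution.inner_eq]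
    ring

theorem mem_openSemicircle {u v : Circ} :
    v ∈ openSemicircle u ↔ 0 < ⟪(v : Plane), (u : Plane)⟫ := Iff.rfl

theorem self_mem_openSemicircle (u : Circ) : u ∈ openSemicircle u := by
  rw [mem_openSemicircle, u.inner_self]; exact one_pos

theorem isOpen_openSemicircle (u : Circ) : IsOpen (openSemicircle u) :=
  isOpen_lt continuous_const (continuous_subtype_val.inner continuous_const)

/-- The semicircle is the radial projection of a convex open half-plane. -/
theorem isPreconnected_openSemicircle (u : Circ) : IsPreconnected (openSemicircle u) := by
  rw [← Topology.IsInducing.subtypeVal.isPreconnected_image]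
  have himg : ((↑) : Circ → Plane) '' openSemicircle u =
      (fun x : Plane => ‖x‖⁻¹ • x) '' {x | 0 < ⟪x, (u : Plane)⟫} := by
    ext y
    constructor
    · rintro ⟨v, hv, rfl⟩
      exact ⟨v, hv, by simp only [Circ.norm_coe v, inv_one, one_smul]⟩
    · rintro ⟨x, hx, rfl⟩
      have hx : 0 < ⟪x, (u : Plane)⟫ := hx
      have hx0 : x ≠ 0 := by rintro rfl; simp at hx
      have h := norm_pos_iff.2 hx0
      refine ⟨⟨‖x‖⁻¹ • x, ?_⟩, ?_, rfl⟩
      · rw [mem_sphere_zero_iff_norm, norm_smul, norm_inv, norm_norm, inv_mul_cancel₀ h.ne']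
      · rw [mem_openSemicircle, real_inner_smul_left]
        positivity
  rw [himg]
  refine IsPreconnected.image ?_ _ ((continuous_norm.continuousOn.inv₀ ?_).smul continuousOn_id)
  · refine Convex.isPreconnected fun x hx y hy a b ha hb hab => ?_
    have hx : 0 < ⟪x, (u : Plane)⟫ := hx
    have hy : 0 < ⟪y, (u : Plane)⟫ := hy
    show 0 < ⟪a • x + b • y, (u : Plane)⟫
    rw [inner_add_left, real_inner_smul_left, real_inner_smul_left]
    rcases ha.eq_or_lt with rfl | ha
    · rw [zero_add] at hab; subst hab; simpa
    · positivity
  · rintro x hx h0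
    have hx : 0 < ⟪x, (u : Plane)⟫ := hx
    rw [norm_eq_zero.1 h0, inner_zero_left] at hx
    exact hx.false

/-- Two open semicircles meet unless they are opposite. -/
theorem openSemicircle_inter_nonempty {u v : Circ} (h : (u : Plane) + v ≠ 0) :
    (openSemicircle u ∩ openSemicircle v).Nonempty := by
  have hpos : 0 < 1 + ⟪(u : Plane), (v : Plane)⟫ := by
    have h1 := real_inner_self_pos.2 h
    rw [inner_add_left, inner_add_right, inner_add_right, u.inner_self, v.inner_self,
      real_inner_comm (u : Plane) v] at h1
    linarith
  obtain ⟨w, r, hr, hw⟩ := exists_circ_smul h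
  have key : ∀ z : Circ, 0 < ⟪(u : Plane) + v, (z : Plane)⟫ → w ∈ openSemicircle z := by
    intro z hz
    rw [hw, real_inner_smul_left] at hz
    exact pos_of_mul_pos_right hz hr.le
  refine ⟨w, key u ?_, key v ?_⟩
  · rw [inner_add_left, u.inner_self, real_inner_comm]; exact hpos
  · rw [inner_add_left, v.inner_self, add_comm]; exact hpos

/-- The arc cos t · v + sin t · u, 0 < t < π, lies in the semicircle and tends to `v` as t → 0. -/
theorem mem_closure_of_openSemicircle_subset {u v : Circ} {S : Set Circ}
    (hS : openSemicircle u ⊆ S) (hv : ⟪(v : Plane), (u : Plane)⟫ = 0) : v ∈ closure S := by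
  have hn : ∀ t : ℝ, Real.cos t • (v : Plane) + Real.sin t • (u : Plane) ∈
      Metric.sphere (0 : Plane) 1 := by
    intro t
    rw [mem_sphere_zero_iff_norm, ← sq_eq_sq₀ (norm_nonneg _) zero_le_one,
      ← real_inner_self_eq_norm_sq]
    simp only [inner_add_left, inner_add_right, real_inner_smul_left, real_inner_smul_right,
      u.inner_self, v.inner_self, hv, real_inner_comm (v : Plane) u]
    linarith [Real.sin_sq_add_cos_sq t]
  let γ : ℝ → Circ := fun t => ⟨_, hn t⟩
  have hγ : Continuous γ := by
    refine Continuous.subtype_mk ?_ _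
    fun_prop
  have hγ0 : γ 0 = v := Subtype.ext (by simp [γ])
  have ht : Tendsto γ (𝓝[>] 0) (𝓝 v) := by
    have := hγ.tendsto 0
    rw [hγ0] at this
    exact this.mono_left nhdsWithin_le_nhds
  refine mem_closure_of_tendsto ht ?_
  filter_upwards [Ioo_mem_nhdsGT Real.pi_pos] with t ht
  refine hS ?_
  rw [mem_openSemicircle]
  show 0 < ⟪Real.cos t • (v : Plane) + Real.sin t • (u : Plane), (u : Plane)⟫
  rw [inner_add_left, real_inner_smul_left, real_inner_smul_left, hv, u.inner_self, mul_zero,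
    zero_add, mul_one]
  exact Real.sin_pos_of_pos_of_lt_pi ht.1 ht.2

/-- A set squeezed between an open semicircle and its closure has the same boundary. -/
theorem frontier_eq_of_openSemicircle_subset {u : Circ} {S : Set Circ}
    (hS : openSemicircle u ⊆ S) (hS' : ∀ v ∈ S, 0 ≤ ⟪(v : Plane), (u : Plane)⟫) :
    frontier S = {v : Circ | ⟪(v : Plane), (u : Plane)⟫ = 0} := by
  have hcl : IsClosed {v : Circ | 0 ≤ ⟪(v : Plane), (u : Plane)⟫} :=
    isClosed_le continuous_const (continuous_subtype_val.inner continuous_const)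
  ext v
  constructor
  · rintro ⟨h1, h2⟩
    refine le_antisymm (not_lt.1 fun h => h2 ?_) (closure_minimal hS' hcl h1)
    exact interior_maximal hS (isOpen_openSemicircle u) h
  · intro hv
    have hv : ⟪(v : Plane), (u : Plane)⟫ = 0 := hv
    refine ⟨mem_closure_of_openSemicircle_subset hS hv, ?_⟩
    rw [← Set.mem_compl_iff, ← closure_compl]
    refine mem_closure_of_openSemicircle_subset (u := -u) (fun w hw hwS => ?_) ?_
    · have hw : 0 < ⟪(w : Plane), -(u : Plane)⟫ := hw
      rw [inner_neg_right] at hw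
      linarith [hS' w hwS]
    · show ⟪(v : Plane), -(u : Plane)⟫ = 0
      rw [inner_neg_right, hv, neg_zero]

/-- Ensures that a nonempty proper sector has a nonempty boundary. -/
instance : PreconnectedSpace Circ :=
  isPreconnected_iff_preconnectedSpace.1 (isPreconnected_sphere (by
    rw [← Module.finrank_eq_rank, finrank_euclideanSpace_fin]; norm_num) 0 1)

/-! ### Sectors of branch pairs and the two claims -/

namespace Substitution

variable {Φ : Substitution ι M}

theorem branchAt_smul_iff {T T' : Set (Tile M)} {u : Plane} {r : ℝ} (hr : 0 < r) :
    Φ.BranchAt T T' (r • u) ↔ Φ.BranchAt T T' u := by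
  simp only [BranchAt, real_inner_smul_right, mul_pos_iff_of_pos_left hr]

theorem isBranchPair_iff [Finite ι] (hflc : FLC Φ.tilingSpace) {T T' : Set (Tile M)} :
    Φ.IsBranchPair T T' ↔ ∃ u : Circ, Φ.BranchAt T T' u := by
  constructor
  · rintro ⟨hT, hT', h0, u, hu⟩
    exact ⟨u, hT, hT', fun h => h0 ((stablyEquiv_iff hflc hT hT').2 h), fun x hx =>
      (stablyEquiv_shift_iff hflc hT hT' x).1 (hu x hx)⟩
  · rintro ⟨u, hT, hT', h0, hu⟩
    exact ⟨hT, hT', fun h => h0 ((stablyEquiv_iff hflc hT hT').1 h), u, fun x hx =>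
      (stablyEquiv_shift_iff hflc hT hT' x).2 (hu x hx)⟩

theorem mem_asymptoticDirections_iff [Finite ι] (hflc : FLC Φ.tilingSpace) {T T' : Set (Tile M)}
    (hT : T ∈ Φ.tilingSpace) (hT' : T' ∈ Φ.tilingSpace) {v : Circ} :
    v ∈ Φ.asymptoticDirections T T' ↔ ∀ t : ℝ, 0 < t → Φ.Asy T T' (t • (v : Plane)) :=
  forall₂_congr fun _ _ => stablyEquiv_shift_iff hflc hT hT' _

theorem BranchAt.openSemicircle_subset [Finite ι] (hflc : FLC Φ.tilingSpace)
    {T T' : Set (Tile M)} {u : Circ} (h : Φ.BranchAt T T' u) :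
    openSemicircle u ⊆ Φ.asymptoticDirections T T' := fun v hv =>
  (mem_asymptoticDirections_iff hflc h.1 h.2.1).2 fun t ht => h.2.2.2 _ (by
    rw [real_inner_smul_left]; exact mul_pos ht hv)

theorem branchAt_of_openSemicircle_subset [Finite ι] (hflc : FLC Φ.tilingSpace)
    {T T' : Set (Tile M)} {u : Circ} (hB : Φ.IsBranchPair T T')
    (h : openSemicircle u ⊆ Φ.asymptoticDirections T T') : Φ.BranchAt T T' u := by
  obtain ⟨w, hw⟩ := (isBranchPair_iff hflc).1 hB
  refine ⟨hw.1, hw.2.1, hw.2.2.1, fun x hx => ?_⟩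
  have hx0 : x ≠ 0 := by rintro rfl; simp at hx
  obtain ⟨v, r, hr, rfl⟩ := exists_circ_smul hx0
  rw [real_inner_smul_left] at hx
  exact (mem_asymptoticDirections_iff hflc hw.1 hw.2.1).1 (h (pos_of_mul_pos_right hx hr.le)) r hr

theorem BranchAt.isSector [Finite ι] (hflc : FLC Φ.tilingSpace)
    {T T' : Set (Tile M)} {u : Circ} (h : Φ.BranchAt T T' u) :
    Φ.IsSector T T' (connectedComponentIn (Φ.asymptoticDirections T T') u) :=
  ⟨(isBranchPair_iff hflc).2 ⟨u, h⟩, u, h.openSemicircle_subset hflc, rfl⟩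

theorem openSemicircle_subset_component {T T' : Set (Tile M)} {u : Circ}
    (h : openSemicircle u ⊆ Φ.asymptoticDirections T T') :
    openSemicircle u ⊆ connectedComponentIn (Φ.asymptoticDirections T T') u :=
  (isPreconnected_openSemicircle u).subset_connectedComponentIn (self_mem_openSemicircle u) h

/-- The boundary of an asymptotic sector does not depend on the sector chosen. -/
theorem frontier_sector_eq {T T' : Set (Tile M)} {S S' : Set Circ} (hS : Φ.IsSector T T' S)
    (hS' : Φ.IsSector T T' S') : frontier S = frontier S' := by
  obtain ⟨-, u, hu, rfl⟩ := hS
  obtain ⟨-, u', hu', rfl⟩ := hS'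
  have h1 := openSemicircle_subset_component hu
  have h2 := openSemicircle_subset_component hu'
  by_cases hd : Disjoint (connectedComponentIn (Φ.asymptoticDirections T T') u)
    (connectedComponentIn (Φ.asymptoticDirections T T') u')
  -- Disjoint sectors contain disjoint, hence opposite, open semicircles; each is squeezed between
  -- its semicircle and the closure, so the boundaries are the same two points.
  · have h0 : (u : Plane) + u' = 0 := by
      by_contra h
      obtain ⟨w, hw, hw'⟩ := openSemicircle_inter_nonempty h
      exact Set.disjoint_left.1 hd (h1 hw) (h2 hw')
    have hneg : ∀ v : Circ, ⟪(v : Plane), (u' : Plane)⟫ = -⟪(v : Plane), (u : Plane)⟫ := fun v => by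
      rw [← inner_neg_right, ← eq_neg_of_add_eq_zero_right h0]
    rw [frontier_eq_of_openSemicircle_subset h1, frontier_eq_of_openSemicircle_subset h2]
    · ext v
      show _ = _ ↔ _ = _
      rw [hneg, neg_eq_zero]
    · intro v hv
      refine not_lt.1 fun h => Set.disjoint_right.1 hd hv (h1 ?_)
      rw [hneg] at h
      exact neg_neg_iff_pos.1 h
    · intro v hv
      refine not_lt.1 fun h => Set.disjoint_left.1 hd hv (h2 ?_)
      rw [mem_openSemicircle, hneg]
      exact neg_pos.2 h
  · obtain ⟨w, hw, hw'⟩ := Set.not_disjoint_iff.1 hd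
    rw [connectedComponentIn_eq hw, connectedComponentIn_eq hw']

/-- A normal `u` of a branch pair whose boundary line avoids the asymptotic set. -/
theorem frontier_component_of_not_asy [Finite ι] (hflc : FLC Φ.tilingSpace)
    {T T' : Set (Tile M)} {u : Circ} (h : Φ.BranchAt T T' u)
    (hline : ∀ x : Plane, ⟪x, (u : Plane)⟫ = 0 → ¬ Φ.Asy T T' x) :
    frontier (connectedComponentIn (Φ.asymptoticDirections T T') u) =
      {v : Circ | ⟪(v : Plane), (u : Plane)⟫ = 0} := by
  have hu := h.openSemicircle_subset hflc
  refine frontier_eq_of_openSemicircle_subset (openSemicircle_subset_component hu) fun v hv => ?_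
  by_contra! hneg
  -- A connected sector that leaves the closed half-plane would contain a direction of the boundary
  -- line.
  have hc : IsPreconnected ((fun v : Circ => ⟪(v : Plane), (u : Plane)⟫) ''
      connectedComponentIn (Φ.asymptoticDirections T T') u) :=
    isPreconnected_connectedComponentIn.image _
      (continuous_subtype_val.inner continuous_const).continuousOn
  obtain ⟨w, hw, hw0⟩ := hc.ordConnected.out ⟨v, hv, rfl⟩
    ⟨u, openSemicircle_subset_component hu (self_mem_openSemicircle u), rfl⟩
    ⟨hneg.le, zero_le_one.trans_eq u.inner_self.symm⟩
  have hw1 := (mem_asymptoticDirections_iff hflc h.1 h.2.1).1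
    (connectedComponentIn_subset _ _ hw) 1 one_pos
  rw [one_smul] at hw1
  exact hline _ hw0 hw1

/-- For a return vector w ≠ 0, T and T - w agree on a ball but are not asymptotic everywhere. A
non-asymptotic point nearest to the centre of the ball is a tangency point. -/
theorem exists_branchAt [Finite ι] [Nonempty ι] (hprim : Φ.Primitive)
    (hflc : FLC Φ.tilingSpace) (hper : NonPeriodic Φ.tilingSpace) :
    ∃ (T T' : Set (Tile M)) (u : Circ), Φ.BranchAt T T' u := by
  obtain ⟨T, hT⟩ := tilingSpace_nonempty hprim
  obtain ⟨f, -, -, -⟩ := exists_circ_smul (x := !₂[(1 : ℝ), 0]) (by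
    intro h; simpa using congrArg (fun x : Plane => x 0) h)
  obtain ⟨e, hfe⟩ := exists_orthogonal_circ f
  obtain ⟨j, w, hw, -, hj⟩ := exists_return hflc f.norm_coe e.norm_coe hfe hT 1 one_pos
  have hw0 : w ≠ 0 := by rintro rfl; simp at hw
  have hTw := shift_mem hT w
  have hD : ∃ x, ¬ Φ.Asy T (shift T w) x := by
    by_contra! h
    exact hw0 (eq_zero_of_forall_asy hprim hflc hper hT h)
  have hcl : IsClosed {x | ¬ Φ.Asy T (shift T w) x} := (isOpen_asy hflc hT hTw).isClosed_compl
  obtain ⟨x, hx, hdist⟩ := hcl.exists_infDist_eq_dist hD ((j : ℝ) • (f : Plane))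
  have hx : ¬ Φ.Asy T (shift T w) x := hx
  have hne : (j : ℝ) • (f : Plane) - x ≠ 0 := by
    intro h
    refine hx (asy_of_tilesAt_eq (hj x ?_))
    rw [sub_eq_zero.1 h, sub_self, norm_zero]; exact one_pos
  obtain ⟨S, S', hS⟩ := exists_branchAt_of_tangent hprim hflc hper (shift_mem hT x)
    (shift_mem hTw x) (by rwa [asy_shift, zero_add]) (𝒰 := {(j : ℝ) • (f : Plane) - x})
    ⟨_, rfl, hne⟩ (by
      rintro _ rfl y hy
      rw [asy_shift]
      by_contra hcon
      have h1 : Metric.infDist ((j : ℝ) • (f : Plane)) {x | ¬ Φ.Asy T (shift T w) x} ≤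
        dist ((j : ℝ) • (f : Plane)) (y + x) := Metric.infDist_le_dist_of_mem hcon
      rw [hdist, dist_eq_norm, dist_eq_norm, norm_sub_rev _ (y + x)] at h1
      refine h1.not_gt ?_
      rwa [← sub_sub_eq_add_sub])
  obtain ⟨u, r, hr, hu⟩ := exists_circ_smul hne
  have h1 := hS _ rfl
  rw [hu, branchAt_smul_iff hr] at h1
  exact ⟨S, S', u, h1⟩

/-- If all asymptotic sectors had one and the same boundary, then asymptoticity would be invariant
in the direction of any point of that boundary. -/
theorem not_common_frontier [Finite ι] [Nonempty ι] (hprim : Φ.Primitive)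
    (hflc : FLC Φ.tilingSpace) (hper : NonPeriodic Φ.tilingSpace)
    (hiso : ¬ ∃ T T', Φ.IsIsolatedPair T T') {F : Set Circ}
    (hF : ∀ T T' S, Φ.IsSector T T' S → frontier S = F) : False := by
  obtain ⟨T, T', u, hB⟩ := exists_branchAt hprim hflc hper
  have hpush : ∀ f ∈ F, ∀ T ∈ Φ.tilingSpace, ∀ T' ∈ Φ.tilingSpace, ∀ (c : Plane) (t : ℝ), 0 ≤ t →
      Φ.Asy T T' c → Φ.Asy T T' (c + t • -(f : Plane)) := by
    intro f hf T hT T' hT' c t ht hc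
    refine asy_add_smul hprim hflc hper (fun S S' u hu h => ?_) hT hT' hc ht
    obtain ⟨u, r, hr, rfl⟩ := exists_circ_smul hu
    rw [branchAt_smul_iff hr] at h
    rw [← hF _ _ _ (h.isSector hflc)] at hf
    rw [inner_neg_right, real_inner_smul_left, neg_nonneg]
    -- A boundary point of a sector is not interior to it, so it cannot lie in the open semicircle
    -- about `u`.
    refine mul_nonpos_of_nonneg_of_nonpos hr.le (not_lt.1 fun hfu => hf.2 ?_)
    rw [real_inner_comm] at hfu
    exact interior_maximal (openSemicircle_subset_component (h.openSemicircle_subset hflc))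
      (isOpen_openSemicircle u) hfu
  have hsub := openSemicircle_subset_component (hB.openSemicircle_subset hflc)
  set S := connectedComponentIn (Φ.asymptoticDirections T T') u with hS
  have hsec : Φ.IsSector T T' S := hB.isSector hflc
  obtain ⟨hT, hT', h0, hH⟩ := id hB
  have hSasy : ∀ s ∈ S, ∀ t : ℝ, 0 < t → Φ.Asy T T' (t • (s : Plane)) := fun s hs =>
    (mem_asymptoticDirections_iff hflc hT hT').1 (connectedComponentIn_subset _ _ hs)
  obtain ⟨f, hf⟩ : (frontier S).Nonempty := nonempty_frontier_iff.2
    ⟨⟨u, hsub (self_mem_openSemicircle u)⟩, fun h => hiso ⟨T, T', by rwa [h] at hsec⟩⟩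
  have hfF : f ∈ F := by rwa [← hF _ _ _ hsec]
  have hff := f.inner_self
  -- Points of `S` other than `f` accumulate at `f`; close to `f` they are off the line spanned by
  -- `f`, so one side of it, with normal `g`, is met arbitrarily near `f`.
  obtain ⟨g, hfg, hside⟩ : ∃ g : Circ, ⟪(f : Plane), (g : Plane)⟫ = 0 ∧
      ∃ᶠ s in 𝓝 f, s ∈ S ∧ 0 < ⟪(s : Plane), (g : Plane)⟫ := by
    have hacc : ∃ᶠ s in 𝓝[≠] f, s ∈ S := by
      by_cases hfS : f ∈ S
      · refine accPt_iff_frequently_nhdsNE.1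
          (isPreconnected_connectedComponentIn.preperfect_of_nontrivial ?_ f hfS)
        refine ⟨u, hsub (self_mem_openSemicircle u), f, hfS, ?_⟩
        rintro rfl
        exact hf.2 (interior_maximal hsub (isOpen_openSemicircle u) (self_mem_openSemicircle u))
      · have h1 := mem_closure_iff_frequently.1 hf.1
        rw [frequently_nhdsWithin_iff]
        exact h1.mono fun s hs => ⟨hs, fun h => hfS (h ▸ hs)⟩
    obtain ⟨g, hg⟩ := exists_orthogonal_circ f
    have hfne : ∀ᶠ s : Circ in 𝓝 f, 0 < ⟪(s : Plane), (f : Plane)⟫ :=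
      (isOpen_openSemicircle f).mem_nhds (self_mem_openSemicircle f)
    have h2 : ∃ᶠ s in 𝓝 f, (s ∈ S ∧ 0 < ⟪(s : Plane), (g : Plane)⟫) ∨
        (s ∈ S ∧ 0 < ⟪(s : Plane), -(g : Plane)⟫) := by
      refine ((frequently_nhdsWithin_iff.1 hacc).and_eventually hfne).mono ?_
      rintro s ⟨⟨hs, hsf⟩, hpos⟩
      have hne : ⟪(s : Plane), (g : Plane)⟫ ≠ 0 := by
        intro h
        have h3 := eq_add_of_orthonormal f.norm_coe g.norm_coe hg s
        rw [h, zero_smul, add_zero] at h3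
        have h4 := s.norm_coe
        rw [h3, norm_smul, f.norm_coe, mul_one, Real.norm_of_nonneg hpos.le] at h4
        rw [h4, one_smul] at h3
        exact hsf (Subtype.ext h3)
      rw [inner_neg_right, neg_pos]
      exact hne.lt_or_gt.elim (fun h => Or.inr ⟨hs, h⟩) fun h => Or.inl ⟨hs, h⟩
    rcases frequently_or_distrib.1 h2 with h | h
    · exact ⟨g, hg, h⟩
    · exact ⟨-g, by rw [show ((-g : Circ) : Plane) = -(g : Plane) from rfl, inner_neg_right, hg,
        neg_zero], h⟩
  have hgf : ⟪(g : Plane), (f : Plane)⟫ = 0 := by rw [real_inner_comm]; exact hfg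
  -- For s ∈ S close enough to `f` on the side of `g`, x is a positive multiple of s plus a
  -- nonnegative multiple of -f, the direction of propagation.
  have hHg : ∀ x : Plane, 0 < ⟪x, (g : Plane)⟫ → Φ.Asy T T' x := by
    intro x hx
    have hlim : Tendsto (fun s : Circ => ⟪(s : Plane), (f : Plane)⟫ * ⟪x, (g : Plane)⟫ -
        ⟪x, (f : Plane)⟫ * ⟪(s : Plane), (g : Plane)⟫) (𝓝 f) (𝓝 ⟪x, (g : Plane)⟫) := by
      have : Continuous fun s : Circ => ⟪(s : Plane), (f : Plane)⟫ * ⟪x, (g : Plane)⟫ -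
        ⟪x, (f : Plane)⟫ * ⟪(s : Plane), (g : Plane)⟫ := by fun_prop
      have h1 := this.tendsto f
      simpa only [hff, hfg, one_mul, mul_zero, sub_zero] using h1
    obtain ⟨s, ⟨hs, hsg⟩, hpos⟩ := (hside.and_eventually (hlim.eventually_const_lt hx)).exists
    have h1 := hpush f hfF T hT T' hT' _ ((⟪(s : Plane), (f : Plane)⟫ * ⟪x, (g : Plane)⟫ -
      ⟪x, (f : Plane)⟫ * ⟪(s : Plane), (g : Plane)⟫) / ⟪(s : Plane), (g : Plane)⟫)
      (div_nonneg hpos.le hsg.le)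
      (hSasy s hs (⟪x, (g : Plane)⟫ / ⟪(s : Plane), (g : Plane)⟫) (by positivity))
    convert h1 using 1
    nth_rewrite 2 [eq_add_of_orthonormal f.norm_coe g.norm_coe hfg (s : Plane)]
    nth_rewrite 1 [eq_add_of_orthonormal f.norm_coe g.norm_coe hfg x]
    generalize ⟪(s : Plane), (f : Plane)⟫ = a, ⟪(s : Plane), (g : Plane)⟫ = b,
      ⟪x, (f : Plane)⟫ = a', ⟪x, (g : Plane)⟫ = b' at *
    match_scalars <;> field_simp
    ring
  -- An asymptotic point on the ray through `f` would be pushed back to the origin.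
  have hDf : ∀ t : ℝ, 0 ≤ t → ¬ Φ.Asy T T' (t • (f : Plane)) := by
    intro t ht h
    have h1 := hpush f hfF T hT T' hT' _ t ht h
    rw [smul_neg, add_neg_cancel] at h1
    exact h0 h1
  -- Translation to infinity along `f` turns the non-asymptotic ray into a full line and keeps the
  -- half-plane with normal `g`.
  obtain ⟨Y, hY, Y', hY', hYA, hYD⟩ := exists_limit_asy hprim hflc hper
    (T := fun n => shift T ((n : ℝ) • (f : Plane)))
    (T' := fun n => shift T' ((n : ℝ) • (f : Plane)))
    (fun n => shift_mem hT _) (fun n => shift_mem hT' _) (p₀ := (g : Plane)) one_pos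
    (Eventually.of_forall fun n x hx => by
      rw [asy_shift]
      refine hHg _ ?_
      rw [inner_add_left, real_inner_smul_left, hfg, mul_zero, add_zero]
      have h1 : |⟪x - g, (g : Plane)⟫| ≤ ‖x - g‖ * ‖(g : Plane)‖ := abs_real_inner_le_norm _ _
      rw [g.norm_coe, mul_one, inner_sub_left, g.inner_self] at h1
      linarith [abs_le.1 h1])
  have hBY : Φ.BranchAt Y Y' g := by
    refine ⟨hY, hY', ?_, fun p hp => hYA p ⟨⟪p, (g : Plane)⟫, hp, Eventually.of_forall
      fun n x hx => ?_⟩⟩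
    · refine hYD 0 (Eventually.of_forall fun n => ?_)
      rw [asy_shift, zero_add]
      exact hDf _ n.cast_nonneg
    · rw [asy_shift]
      refine hHg _ ?_
      rw [inner_add_left, real_inner_smul_left, hfg, mul_zero, add_zero]
      have h1 : |⟪x - p, (g : Plane)⟫| ≤ ‖x - p‖ * ‖(g : Plane)‖ := abs_real_inner_le_norm _ _
      rw [g.norm_coe, mul_one, inner_sub_left] at h1
      linarith [abs_le.1 h1]
  have hline : ∀ x : Plane, ⟪x, (g : Plane)⟫ = 0 → ¬ Φ.Asy Y Y' x := by
    intro x hx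
    rw [eq_add_of_orthonormal f.norm_coe g.norm_coe hfg x, hx, zero_smul, add_zero]
    refine hYD _ ?_
    filter_upwards [eventually_ge_atTop ⌈-⟪x, (f : Plane)⟫⌉₊] with n hn
    rw [asy_shift, ← add_smul]
    refine hDf _ ?_
    linarith [Nat.ceil_le.1 hn]
  have hnf : -f ∈ F := by
    rw [← hF _ _ _ (hBY.isSector hflc), frontier_component_of_not_asy hflc hBY hline]
    show ⟪-(f : Plane), (g : Plane)⟫ = 0
    rw [inner_neg_left, hfg, neg_zero]
  refine not_invariant_direction hprim hflc hper f.norm_coe g.norm_coe hfg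
    fun T hT T' hT' c t hc => ?_
  rcases le_total 0 t with ht | ht
  · simpa using hpush (-f) hnf T hT T' hT' c t ht hc
  · simpa using hpush f hfF T hT T' hT' c (-t) (neg_nonneg.2 ht) hc

/-- Two half-planes with independent normals produce a corner pair. -/
theorem isCornerPair_of_two_halfPlanes [Finite ι] (hflc : FLC Φ.tilingSpace)
    (hiso : ¬ ∃ T T', Φ.IsIsolatedPair T T') {T T' : Set (Tile M)} {u v : Circ}
    (huv : ⟪(u : Plane), (v : Plane)⟫ = 0) {c : ℝ} (hc : 0 < c) (hB : Φ.BranchAt T T' u)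
    (hB' : Φ.BranchAt T T' ((u : Plane) + c • (v : Plane))) : Φ.IsCornerPair T T' := by
  have hne : (u : Plane) + c • (v : Plane) ≠ 0 := by
    intro h
    have h1 := congrArg (fun x => ⟪(u : Plane), x⟫) h
    simp only [inner_add_right, real_inner_smul_right, huv, u.inner_self, inner_zero_right,
      mul_zero, add_zero] at h1
    exact one_ne_zero h1
  obtain ⟨u', r, hr, hu'⟩ := exists_circ_smul hne
  rw [hu', branchAt_smul_iff hr] at hB'
  have hne' : (u : Plane) + u' ≠ 0 := by
    intro h
    rw [eq_neg_of_add_eq_zero_right h] at hu'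
    have h1 := congrArg (fun x => ⟪(v : Plane), x⟫) hu'
    simp only [inner_add_right, real_inner_smul_right, inner_neg_right,
      real_inner_comm (u : Plane) v,
      huv, v.inner_self, mul_zero, zero_add, neg_zero, mul_one] at h1
    exact hc.ne' h1
  have h1 := hB.openSemicircle_subset hflc
  have h2 := hB'.openSemicircle_subset hflc
  obtain ⟨z, hz, hz'⟩ := openSemicircle_inter_nonempty hne'
  have hcomp : connectedComponentIn (Φ.asymptoticDirections T T') u =
      connectedComponentIn (Φ.asymptoticDirections T T') u' := by
    rw [connectedComponentIn_eq (openSemicircle_subset_component h1 hz),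
      connectedComponentIn_eq (openSemicircle_subset_component h2 hz')]
  have hsec := hB.isSector hflc
  refine ⟨_, hsec, fun h => hiso ⟨T, T', by rwa [h] at hsec⟩, ?_⟩
  -- `w` bisects the two normals; the two open semicircles together cover the closed semicircle
  -- about `w`.
  obtain ⟨w, ρ, hρ, hw⟩ := exists_circ_smul hne'
  refine ⟨w, fun x hx => ?_⟩
  have hx : 0 ≤ ⟪(x : Plane), (w : Plane)⟫ := hx
  rw [mem_interior_iff_mem_nhds]
  by_cases hxu : x ∈ openSemicircle u
  · exact Filter.mem_of_superset ((isOpen_openSemicircle u).mem_nhds hxu)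
      (openSemicircle_subset_component h1)
  by_cases hxu' : x ∈ openSemicircle u'
  · rw [hcomp]
    exact Filter.mem_of_superset ((isOpen_openSemicircle u').mem_nhds hxu')
      (openSemicircle_subset_component h2)
  exfalso
  rw [mem_openSemicircle, not_lt] at hxu hxu'
  have hsum : ⟪(x : Plane), (u : Plane)⟫ + ⟪(x : Plane), (u' : Plane)⟫ =
      ρ * ⟪(x : Plane), (w : Plane)⟫ := by
    rw [← inner_add_right, hw, real_inner_smul_right]
  have hsum' := mul_nonneg hρ.le hx
  have hx0 : ⟪(x : Plane), (u : Plane)⟫ = 0 := by linarith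
  have hx0' : ⟪(x : Plane), (u' : Plane)⟫ = 0 := by linarith
  have hxv : c * ⟪(x : Plane), (v : Plane)⟫ = 0 := by
    have h3 := congrArg (fun y => ⟪(x : Plane), y⟫) hu'
    simpa only [inner_add_right, real_inner_smul_right, hx0, hx0', zero_add, mul_zero] using h3
  have h4 := eq_add_of_orthonormal u.norm_coe v.norm_coe huv x
  rw [hx0, (mul_eq_zero.1 hxv).resolve_left hc.ne', zero_smul, zero_smul, add_zero] at h4
  have h5 := x.norm_coe
  rw [h4, norm_zero] at h5
  exact zero_ne_one h5

theorem BranchAt.not_asy_of_orthogonal [Finite ι] [Nonempty ι] (hprim : Φ.Primitive)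
    (hflc : FLC Φ.tilingSpace) (hper : NonPeriodic Φ.tilingSpace)
    (hiso : ¬ ∃ T T', Φ.IsIsolatedPair T T') (hcorner : ¬ ∃ T T', Φ.IsCornerPair T T')
    {T T' : Set (Tile M)} {u v : Circ} (hB : Φ.BranchAt T T' u)
    (huv : ⟪(u : Plane), (v : Plane)⟫ = 0) {t : ℝ} (ht : 0 ≤ t) :
    ¬ Φ.Asy T T' (t • (v : Plane)) := fun h => by
  obtain ⟨S, S', c, hc, h1, h2⟩ :=
    exists_two_halfPlanes hprim hflc hper u.norm_coe v.norm_coe huv hB ht h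
  exact hcorner ⟨S, S', isCornerPair_of_two_halfPlanes hflc hiso huv hc h1 h2⟩

end Substitution

end SubstTiling
theorem mainTheorem5 {ι M : Type*} [Finite ι] [Nonempty ι] (Φ : SubstTiling.Substitution ι M)
    (hprim : Φ.Primitive) (hflc : SubstTiling.FLC Φ.tilingSpace)
    (hper : SubstTiling.NonPeriodic Φ.tilingSpace)
    (hiso : ¬ ∃ T T', Φ.IsIsolatedPair T T') :
    (∃ T₁ T₁' T₂ T₂', Φ.IsBranchPair T₁ T₁' ∧ Φ.IsBranchPair T₂ T₂' ∧
      ∀ S₁ S₂, Φ.IsSector T₁ T₁' S₁ → Φ.IsSector T₂ T₂' S₂ → frontier S₁ ≠ frontier S₂) ∧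
    ((¬ ∃ T T', Φ.IsCornerPair T T') →
      ∀ T T', Φ.IsLinePair T T' → ∀ S, Φ.IsSector T T' S → ∀ v ∈ frontier S, ∀ t : ℝ,
        ¬ Φ.StablyEquiv (SubstTiling.shift T (t • (v : SubstTiling.Plane)))
          (SubstTiling.shift T' (t • (v : SubstTiling.Plane)))) := by
  refine ⟨?_, fun hcorner T T' hline S hS v hv t ht => ?_⟩
  · by_contra! hcon
    obtain ⟨T, T', u, hB⟩ := SubstTiling.Substitution.exists_branchAt hprim hflc hper
    have hsec := hB.isSector hflc
    refine SubstTiling.Substitution.not_common_frontier hprim hflc hper hiso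
      -- If no two branch pairs had different boundaries, every sector boundary would equal that of
      -- this one pair.
      (F := frontier (connectedComponentIn (Φ.asymptoticDirections T T') u)) fun T₁ T₁' S₁ h₁ => ?_
    obtain ⟨A, B, hA, hAB⟩ := hcon T₁ T₁' T T' h₁.1 hsec.1
    rw [SubstTiling.Substitution.frontier_sector_eq h₁ hA, hAB.2,
      SubstTiling.Substitution.frontier_sector_eq hAB.1 hsec]
  · obtain ⟨u, hu⟩ := hline
    have hu' : SubstTiling.openSemicircle u ⊆ Φ.asymptoticDirections T T' := by
      obtain ⟨-, w, -, hw⟩ := id hu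
      rw [hw]
      exact connectedComponentIn_subset _ _
    have hB := SubstTiling.Substitution.branchAt_of_openSemicircle_subset hflc hu.1 hu'
    rw [SubstTiling.Substitution.frontier_sector_eq hS hu,
      SubstTiling.frontier_eq_of_openSemicircle_subset subset_rfl fun _ h => le_of_lt h] at hv
    have huv : inner ℝ (u : SubstTiling.Plane) (v : SubstTiling.Plane) = 0 := by
      rw [real_inner_comm]; exact hv
    rw [SubstTiling.Substitution.stablyEquiv_shift_iff hflc hB.1 hB.2.1] at ht
    rcases le_total 0 t with h | h
    · exact hB.not_asy_of_orthogonal hprim hflc hper hiso hcorner huv h ht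
    -- Negative `t` is the same point seen along the opposite direction -v.
    · refine hB.not_asy_of_orthogonal hprim hflc hper hiso hcorner (v := -v) (t := -t) ?_
        (neg_nonneg.2 h) ?_
      · change inner ℝ (u : SubstTiling.Plane) (-(v : SubstTiling.Plane)) = 0
        rw [inner_neg_right, huv, neg_zero]
      · change Φ.Asy T T' ((-t) • (-(v : SubstTiling.Plane)))
        rwa [neg_smul_neg]
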